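/- Let $\hbar>0$, $n\in\mathbb{N}$, $q_1,\dots,q_n>0$, $Q_n=\mathrm{diag}(q_1,\dots,q_n)$, and consider the Gaussian window $g_n(x)=(2\pi\hbar)^{-n/2}e^{-\frac{1}{2\hbar}\langle x,Q_nx\rangle}$ on $\mathbb{R}^n$. Let $\langle g,\gamma\rangle=\int_{\mathbb{R}^n} g\,\overline{\gamma}\,dy$, and for $f\in\mathcal{S}'(\mathbb{R}^n)$ and $g\in\mathcal{S}(\mathbb{R}^n)$ let $V_gf(x,\xi)=f\big(\overline{\pi(x,\xi)g}\big)$, where $\pi(x,\xi)g(y)=(2\pi\hbar)^{-n/2}e^{\frac{i}{\hbar}\xi\cdot y}g(y-x)$, be the Gabor transform. Let $\|f\|_{M^{p,q}_{(g)}}\in[0,\infty]$ be the $L^q_\xi(L^p_x)$ norm of $V_gf(x,\xi)$; thus $\|f\|_{M^{\infty,1}_{(g)}}=\int\sup_x|V_gf(x,\xi)|\,d\xi$ and $\|f\|_{M^{1,\infty}_{(g)}}=\operatorname{ess\,sup}_\xi\int|V_gf(x,\xi)|\,dx$. Let $M^{\infty,1}(\mathbb{R}^n)$ be the set of all $f\in\mathcal{S}'(\mathbb{R}^n)$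 with $\|f\|_{M^{\infty,1}_{(g)}}<\infty$ for some $g\in\mathcal{S}(\mathbb{R}^n)\setminus\{0\}$. Then $M^{\infty,1}(\mathbb{R}^n)$ is a linear space on which $\|\cdot\|_{M^{\infty,1}_{(g_n)}}$ is finite, each of its elements $f$ is given by a unique bounded continuous function, again denoted by $f$, and this function is Fresnel integrable: for every $\varphi\in\mathcal{S}(\mathbb{R}^n)$ with $\varphi(0)=1$ the limit $$L_n(f)=\lim_{\varepsilon\downarrow0}(2\pi i\hbar)^{-n/2}\int_{\mathbb{R}^n}e^{\frac{i}{2\hbar}|x|^2}f(x)\varphi(\varepsilon x)\,dx$$ exists and does not depend on $\varphi$ (principal branch of the power). The functional $L_n$ is linear on $M^{\infty,1}(\mathbb{R}^n)$, and, with $F_+(x)=(2\pi i\hbar)^{-n/2}e^{\frac{i}{2\hbar}|x|^2}$, $$\sup_{f\in M^{\infty,1}(\mathbb{R}^n)\setminus\{0\}}\frac{|L_n(f)|}{\|f\|_{M^{\infty,1}_{(g_n)}}}=\prod_{j=1}^n(q_j^2+1)^{1/4}=\inf_{\substack{\gamma\in\mathcal{S}(\mathbb{R}^n)\\ \langle g_n,\gamma\rangle\neq0}}\frac{\|F_+\|_{M^{1,\infty}_{(\gamma)}}}{|\langle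 g_n,\gamma\rangle|}.$$ -/

import Mathlib

open MeasureTheory Filter Topology
open scoped SchwartzMap ENNReal BoundedContinuousFunction

noncomputable section

namespace Sjostrand

/-! ### Smooth functions of controlled growth -/

/-- The function `t ↦ e^{it}` and all its derivatives are bounded. -/
theorem hasTemperateGrowth_exp_I :
    Function.HasTemperateGrowth (fun t : ℝ => Complex.exp (Complex.I * (t : ℂ))) := by
  have hd : ∀ (m : ℕ) (t : ℝ),
      iteratedDeriv m (fun t : ℝ => Complex.exp (Complex.I * (t : ℂ))) t =
        Complex.I ^ m * Complex.exp (Complex.I * (t : ℂ)) := by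
    intro m
    induction m with
    | zero => intro t; simp
    | succ m ih =>
      intro t
      rw [iteratedDeriv_succ, funext ih]
      have h : HasDerivAt (fun t : ℝ => Complex.exp (Complex.I * (t : ℂ)))
          (Complex.exp (Complex.I * (t : ℂ)) * (Complex.I * 1)) t :=
        ((Complex.ofRealCLM.hasDerivAt (x := t)).const_mul Complex.I).cexp
      rw [(h.const_mul (Complex.I ^ m)).deriv]
      ring
  refine ⟨?_, fun m => ⟨0, 1, fun t => ?_⟩⟩
  · exact (contDiff_const.mul Complex.ofRealCLM.contDiff).cexp
  · rw [norm_iteratedFDeriv_eq_norm_iteratedDeriv, hd, norm_mul, norm_pow, Complex.norm_I,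
      mul_comm Complex.I, Complex.norm_exp_ofReal_mul_I]
    simp

/-- `e^{-h}` decays rapidly with all its derivatives, if `h` is a smooth function of temperate
growth with `h x ≥ c ‖x‖²` for some `c > 0`. -/
theorem exp_neg_decay {E : Type*} [NormedAddCommGroup E] [NormedSpace ℝ E] {h : E → ℝ}
    (hh : h.HasTemperateGrowth) {c : ℝ} (hc : 0 < c) (hb : ∀ x, c * ‖x‖ ^ 2 ≤ h x) (k m : ℕ) :
    ∃ C : ℝ, ∀ x, ‖x‖ ^ k * ‖iteratedFDeriv ℝ m (fun x => Real.exp (-h x)) x‖ ≤ C := by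
  obtain ⟨l, D, hD, hgr⟩ := hh.norm_iteratedFDeriv_le_uniform m
  obtain ⟨B, hB⟩ : ∃ B : ℝ, ∀ r : ℝ, 0 ≤ r →
      (1 + r) ^ (k + l * m) * Real.exp (-(c * r ^ 2)) ≤ B := by
    set N := k + l * m
    refine ⟨((N.factorial : ℝ) * (Real.exp (1 + 1 / (4 * 1)) * Real.exp (1 / (4 * c)))), ?_⟩
    intro r hr
    have h1 : (1 + r) ^ N ≤ N.factorial * Real.exp (1 + r) := by
      have := Real.pow_div_factorial_le_exp (1 + r) (by linarith) N
      rwa [div_le_iff₀ (by positivity), mul_comm] at this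
    have h2 : Real.exp (1 + r) * Real.exp (-(c * r ^ 2)) ≤
        Real.exp (1 + 1 / (4 * 1)) * Real.exp (1 / (4 * c)) := by
      rw [← Real.exp_add, ← Real.exp_add]
      apply Real.exp_le_exp.2
      have h3 : r - c * r ^ 2 ≤ 1 / (4 * c) := by
        rw [le_div_iff₀ (by positivity)]
        nlinarith [sq_nonneg (2 * c * r - 1)]
      linarith
    calc (1 + r) ^ N * Real.exp (-(c * r ^ 2))
        ≤ (N.factorial * Real.exp (1 + r)) * Real.exp (-(c * r ^ 2)) := by gcongr
      _ = N.factorial * (Real.exp (1 + r) * Real.exp (-(c * r ^ 2))) := by ring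
      _ ≤ _ := by gcongr
  refine ⟨m.factorial * (D + 1) ^ m * B, fun x => ?_⟩
  have h1 : ∀ i, i ≤ m → ‖iteratedFDeriv ℝ i Real.exp (-h x)‖ ≤ Real.exp (-h x) := by
    intro i _
    rw [norm_iteratedFDeriv_eq_norm_iteratedDeriv, iteratedDeriv_eq_iterate,
      Real.iter_deriv_exp, Real.norm_eq_abs, abs_of_pos (Real.exp_pos _)]
  have h2 : ∀ i, 1 ≤ i → i ≤ m →
      ‖iteratedFDeriv ℝ i (fun x => -h x) x‖ ≤ ((D + 1) * (1 + ‖x‖) ^ l) ^ i := by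
    intro i hi him
    have : iteratedFDeriv ℝ i (fun x => -h x) x = - iteratedFDeriv ℝ i h x :=
      iteratedFDeriv_neg_apply
    rw [this, norm_neg]
    have hone : 1 ≤ (D + 1) * (1 + ‖x‖) ^ l :=
      one_le_mul_of_one_le_of_one_le (by linarith)
        (one_le_pow₀ (by linarith [norm_nonneg x]))
    calc _ ≤ D * (1 + ‖x‖) ^ l := hgr i him x
      _ ≤ (D + 1) * (1 + ‖x‖) ^ l := by gcongr; linarith
      _ ≤ _ := le_self_pow₀ hone (by omega)
  have h3 := norm_iteratedFDeriv_comp_le (n := m) (N := ((⊤ : ℕ∞) : WithTop ℕ∞)) Real.contDiff_exp hh.1.neg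
    (mod_cast le_top) x h1 h2
  have h4 : Real.exp (-h x) ≤ Real.exp (-(c * ‖x‖ ^ 2)) :=
    Real.exp_le_exp.2 (neg_le_neg (hb x))
  have h5 : ‖x‖ ^ k ≤ (1 + ‖x‖) ^ k := by gcongr; linarith
  calc ‖x‖ ^ k * ‖iteratedFDeriv ℝ m (fun x => Real.exp (-h x)) x‖
      ≤ (1 + ‖x‖) ^ k *
        (m.factorial * Real.exp (-(c * ‖x‖ ^ 2)) * ((D + 1) * (1 + ‖x‖) ^ l) ^ m) := by
        refine mul_le_mul h5 (h3.trans ?_) (norm_nonneg _) (by positivity)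
        gcongr
    _ = m.factorial * (D + 1) ^ m *
        ((1 + ‖x‖) ^ (k + l * m) * Real.exp (-(c * ‖x‖ ^ 2))) := by
        rw [mul_pow, pow_add, pow_mul]; ring
    _ ≤ _ := by
        gcongr
        exact hB _ (norm_nonneg x)

variable {n : ℕ}

/-! ### Gabor analysis -/

/-- The plane wave `y ↦ e^{(i/ħ) ξ·y}`. -/
def planeWave (ħ : ℝ) (ξ : EuclideanSpace ℝ (Fin n)) (y : EuclideanSpace ℝ (Fin n)) : ℂ :=
  Complex.exp (Complex.I * ((inner ℝ ξ y / ħ : ℝ) : ℂ))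

theorem planeWave_hasTemperateGrowth (ħ : ℝ) (ξ : EuclideanSpace ℝ (Fin n)) :
    (planeWave ħ ξ).HasTemperateGrowth := by
  have h : (fun y : EuclideanSpace ℝ (Fin n) => inner ℝ ξ y / ħ).HasTemperateGrowth := by
    simp only [div_eq_mul_inv]
    fun_prop
  exact hasTemperateGrowth_exp_I.comp h

/-- The phase space shift `π(x,ξ) g = M_ξ T_x g`, that is
`y ↦ (2πħ)^{-n/2} e^{(i/ħ) ξ·y} g(y - x)`. -/
def phaseShift (ħ : ℝ) (x ξ : EuclideanSpace ℝ (Fin n)) (g : 𝓢(EuclideanSpace ℝ (Fin n), ℂ)) :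
    𝓢(EuclideanSpace ℝ (Fin n), ℂ) :=
  (((2 * Real.pi * ħ) ^ (-((n : ℝ) / 2)) : ℝ) : ℂ) •
    SchwartzMap.smulLeftCLM ℂ (planeWave ħ ξ) (SchwartzMap.compSubConstCLM ℂ x g)

theorem phaseShift_apply (ħ : ℝ) (x ξ : EuclideanSpace ℝ (Fin n))
    (g : 𝓢(EuclideanSpace ℝ (Fin n), ℂ)) (y : EuclideanSpace ℝ (Fin n)) :
    phaseShift ħ x ξ g y =
      (((2 * Real.pi * ħ) ^ (-((n : ℝ) / 2)) : ℝ) : ℂ) *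
        Complex.exp (Complex.I * ((inner ℝ ξ y / ħ : ℝ) : ℂ)) * g (y - x) := by
  simp only [phaseShift, smul_apply, smul_eq_mul,
    SchwartzMap.smulLeftCLM_apply_apply (planeWave_hasTemperateGrowth ħ ξ),
    SchwartzMap.compSubConstCLM_apply, planeWave]
  ring

/-- The complex conjugate of a Schwartz function. -/
def conjS (g : 𝓢(EuclideanSpace ℝ (Fin n), ℂ)) : 𝓢(EuclideanSpace ℝ (Fin n), ℂ) :=
  SchwartzMap.postcompCLM (Complex.conjCLE : ℂ →L[ℝ] ℂ) g

theorem conjS_apply (g : 𝓢(EuclideanSpace ℝ (Fin n), ℂ)) (y : EuclideanSpace ℝ (Fin n)) :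
    conjS g y = starRingEnd ℂ (g y) := rfl

/-- The `L²` inner product `⟨g, γ⟩ = ∫ g(y) conj(γ(y)) dy`, linear in the first entry. -/
def innerS (g γ : 𝓢(EuclideanSpace ℝ (Fin n), ℂ)) : ℂ :=
  ∫ y, g y * starRingEnd ℂ (γ y)

/-- The Gabor (short-time Fourier) transform `V_g f(x,ξ) = ⟨f, π(x,ξ) g⟩`, where
`⟨f, φ⟩ = f(conj φ)` is the pairing of a tempered distribution with a Schwartz function. -/
def stft (ħ : ℝ) (g : 𝓢(EuclideanSpace ℝ (Fin n), ℂ)) (f : 𝓢'(EuclideanSpace ℝ (Fin n), ℂ))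
    (x ξ : EuclideanSpace ℝ (Fin n)) : ℂ :=
  f (conjS (phaseShift ħ x ξ g))

/-- The modulation space norm `‖f‖_{M^{p,q}_{(g)}}`: the `L^p` norm in `x`, followed by the
`L^q` norm in `ξ`, of `V_g f(x,ξ)`, with values in `[0,∞]`. -/
def modNorm (ħ : ℝ) (p q : ℝ≥0∞) (g : 𝓢(EuclideanSpace ℝ (Fin n), ℂ))
    (f : 𝓢'(EuclideanSpace ℝ (Fin n), ℂ)) : ℝ≥0∞ :=
  eLpNorm (fun ξ => eLpNorm (fun x => stft ħ g f x ξ) p volume) q volume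

/-- The modulation space `M^{p,q}(ℝⁿ)`: the tempered distributions whose norm with respect to some
nonzero window is finite. -/
def modSpace (ħ : ℝ) (n : ℕ) (p q : ℝ≥0∞) : Set 𝓢'(EuclideanSpace ℝ (Fin n), ℂ) :=
  {f | ∃ g : 𝓢(EuclideanSpace ℝ (Fin n), ℂ), g ≠ 0 ∧ modNorm ħ p q g f < ∞}

/-! ### Fresnel integrals -/

/-- `u` is Fresnel integrable with Fresnel integral `c`: for every Schwartz function `φ` with
`φ(0) = 1`, the integrals `(2πiħ)^{-n/2} ∫ e^{(i/2ħ)|x|²} u(x) φ(εx) dx` exist for small `ε > 0`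
and tend to `c` as `ε ↓ 0`. -/
def HasFresnelIntegral (ħ : ℝ) (u : EuclideanSpace ℝ (Fin n) → ℂ) (c : ℂ) : Prop :=
  ∀ φ : 𝓢(EuclideanSpace ℝ (Fin n), ℂ), φ 0 = 1 →
    (∀ᶠ ε : ℝ in 𝓝[>] 0, Integrable (fun x =>
      Complex.exp (Complex.I * ((‖x‖ ^ 2 / (2 * ħ) : ℝ) : ℂ)) * u x * φ (ε • x))) ∧
    Tendsto (fun ε : ℝ => (2 * Real.pi * Complex.I * ħ : ℂ) ^ (-((n : ℂ) / 2)) *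
        ∫ x, Complex.exp (Complex.I * ((‖x‖ ^ 2 / (2 * ħ) : ℝ) : ℂ)) * u x * φ (ε • x))
      (𝓝[>] 0) (𝓝 c)

/-- The Fresnel integral of `u` (an arbitrary number if `u` is not Fresnel integrable). -/
def fresnelIntegral (ħ : ℝ) (u : EuclideanSpace ℝ (Fin n) → ℂ) : ℂ :=
  Classical.epsilon (HasFresnelIntegral ħ u)

/-- The tempered distribution `f` is the bounded continuous function `u`. -/
def Represents (f : 𝓢'(EuclideanSpace ℝ (Fin n), ℂ)) (u : EuclideanSpace ℝ (Fin n) →ᵇ ℂ) : Prop :=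
  ∀ φ : 𝓢(EuclideanSpace ℝ (Fin n), ℂ), f φ = ∫ x, u x * φ x

/-- The bounded continuous function that a tempered distribution is (arbitrary if there is none). -/
def toFunction (f : 𝓢'(EuclideanSpace ℝ (Fin n), ℂ)) : EuclideanSpace ℝ (Fin n) →ᵇ ℂ :=
  Classical.epsilon (Represents f)

/-- The Fresnel functional `L_n(f)`: the Fresnel integral of `f`. -/
def fresnelFunctional (ħ : ℝ) (f : 𝓢'(EuclideanSpace ℝ (Fin n), ℂ)) : ℂ :=
  fresnelIntegral ħ (toFunction f)

/-- The Fresnel function `F₊(x) = (2πiħ)^{-n/2} e^{(i/2ħ)|x|²}`. -/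
def fresnelFun (ħ : ℝ) (n : ℕ) (x : EuclideanSpace ℝ (Fin n)) : ℂ :=
  (2 * Real.pi * Complex.I * ħ : ℂ) ^ (-((n : ℂ) / 2)) *
    Complex.exp (Complex.I * ((‖x‖ ^ 2 / (2 * ħ) : ℝ) : ℂ))

theorem fresnelFun_hasTemperateGrowth (ħ : ℝ) (n : ℕ) :
    (fresnelFun ħ n).HasTemperateGrowth := by
  have h : (fun x : EuclideanSpace ℝ (Fin n) => ‖x‖ ^ 2 / (2 * ħ)).HasTemperateGrowth := by
    simp only [div_eq_mul_inv]
    fun_prop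
  exact (Function.HasTemperateGrowth.const _).mul (hasTemperateGrowth_exp_I.comp h)

/-- `F₊` as a tempered distribution, `φ ↦ ∫ φ F₊`. -/
def fresnelDist (ħ : ℝ) (n : ℕ) : 𝓢'(EuclideanSpace ℝ (Fin n), ℂ) :=
  Function.HasTemperateGrowth.toTemperedDistribution volume (fresnelFun_hasTemperateGrowth ħ n)

/-! ### Gaussian windows -/

/-- The quadratic form `x ↦ (1/2ħ) ⟨x, Qx⟩` with `Q = diag(q₁,…,q_n)`. -/
def quadForm (ħ : ℝ) (q : Fin n → ℝ) (x : EuclideanSpace ℝ (Fin n)) : ℝ :=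
  1 / (2 * ħ) * ∑ j, q j * x j ^ 2

theorem quadForm_hasTemperateGrowth (ħ : ℝ) (q : Fin n → ℝ) :
    (quadForm ħ q).HasTemperateGrowth := by
  have hj : ∀ j : Fin n, (fun x : EuclideanSpace ℝ (Fin n) => x j).HasTemperateGrowth :=
    fun j => (EuclideanSpace.proj j : EuclideanSpace ℝ (Fin n) →L[ℝ] ℝ).hasTemperateGrowth
  have hs : (fun x : EuclideanSpace ℝ (Fin n) => ∑ j, q j * x j ^ 2).HasTemperateGrowth :=
    Function.HasTemperateGrowth.sum fun j _ =>
      (Function.HasTemperateGrowth.const (q j)).mul ((hj j).pow 2)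
  exact (Function.HasTemperateGrowth.const (1 / (2 * ħ))).mul hs

theorem quadForm_coercive {ħ : ℝ} (hħ : 0 < ħ) {q : Fin n → ℝ} (hq : ∀ j, 0 < q j) :
    ∃ c : ℝ, 0 < c ∧ ∀ x : EuclideanSpace ℝ (Fin n), c * ‖x‖ ^ 2 ≤ quadForm ħ q x := by
  obtain ⟨m, hm, hmq⟩ : ∃ m : ℝ, 0 < m ∧ ∀ j, m ≤ q j := by
    rcases isEmpty_or_nonempty (Fin n) with h | h
    · exact ⟨1, one_pos, fun j => (h.false j).elim⟩
    · obtain ⟨j₀, hj₀⟩ := Finite.exists_min q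
      exact ⟨q j₀, hq j₀, hj₀⟩
  refine ⟨1 / (2 * ħ) * m, by positivity, fun x => ?_⟩
  rw [EuclideanSpace.norm_sq_eq, mul_assoc, Finset.mul_sum]
  unfold quadForm
  refine mul_le_mul_of_nonneg_left (Finset.sum_le_sum fun j _ => ?_) (by positivity)
  rw [Real.norm_eq_abs, sq_abs]
  exact mul_le_mul_of_nonneg_right (hmq j) (sq_nonneg _)

/-- The Gaussian window `g_n(x) = (2πħ)^{-n/2} e^{-(1/2ħ)⟨x, Qx⟩}`, `Q = diag(q₁,…,q_n)`. -/
def gaussWindow {ħ : ℝ} (hħ : 0 < ħ) {q : Fin n → ℝ} (hq : ∀ j, 0 < q j) :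
    𝓢(EuclideanSpace ℝ (Fin n), ℂ) :=
  (((2 * Real.pi * ħ) ^ (-((n : ℝ) / 2)) : ℝ) : ℂ) •
    SchwartzMap.postcompCLM Complex.ofRealCLM
      (⟨fun x => Real.exp (-quadForm ħ q x),
        Real.contDiff_exp.comp (quadForm_hasTemperateGrowth ħ q).1.neg,
        fun k m => by
          obtain ⟨c, hc, hb⟩ := quadForm_coercive hħ hq
          exact exp_neg_decay (quadForm_hasTemperateGrowth ħ q) hc hb k m⟩ :
        𝓢(EuclideanSpace ℝ (Fin n), ℝ))

theorem gaussWindow_apply {ħ : ℝ} (hħ : 0 < ħ) {q : Fin n → ℝ} (hq : ∀ j, 0 < q j)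
    (x : EuclideanSpace ℝ (Fin n)) :
    gaussWindow hħ hq x = (((2 * Real.pi * ħ) ^ (-((n : ℝ) / 2)) : ℝ) : ℂ) *
      ((Real.exp (-(1 / (2 * ħ) * ∑ j, q j * x j ^ 2)) : ℝ) : ℂ) := rfl

end Sjostrand

end

/-! The proof is a duality argument for Gabor transforms, with Gaussian chirps as extremizing
families on both sides.

Upper bound. The inversion formula `inversion` reads ⟨γ,g⟩ f(φ) = ∫∫ V_g f(x,ξ) (∫ π(x,ξ)γ · φ) dx
dξ. Put φ = F₊ φ₀(ε·) and let ε ↓ 0. The coefficients of F₊ have modulus depending only on x + ξ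
(`norm_fresnelCoeff`), and those of the regularized functions are bounded by C(1+|x+ξ|)^{-(n+1)}
uniformly in ε. The integral of this bound over x does not depend on ξ, while |V_g f(x,ξ)| is at
most its supremum over x, which is integrable in ξ. Dominated convergence gives Fresnel
integrability and writes L_n(f) as a pairing of V_g f with the coefficients of F₊. Hölder's
inequality for this pairing bounds the supremum by the infimum (`enorm_fresnelFunctional_le`).

Sharpness. For a > 0 let c_a(y) = e^{-(a+i)|y|²/(2ħ)}, so that F₊ c_a is a constant times a real
Gaussian. With γ the conjugate of c_a, the M^{1,∞} norm of F₊ is exactly 1 and |⟨g_n,γ⟩| =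
∏((q_j+a)²+1)^{-1/4}; letting a ↓ 0 bounds the infimum by the product. With f = c_a, |L_n(f)| =
a^{-n/2}, and an explicit Gaussian bound on V_{g_n} f gives a quotient of at least
∏((q_j+a)²+1)^{1/4}(1+a(q_j+a))^{-1/2}; letting a ↓ 0 bounds the supremum below by the product. The
three inequalities close up.

Two preliminary facts make M^{∞,1} usable: its definition does not depend on the window
(`modNorm_lt_top_of_window`), and the synthesis integral of V_g f is a bounded continuous function
representing f (`exists_represents`). -/

namespace Sjostrand

/-! ### Interchanging a tempered functional with an integral -/

section Interchange

variable {E : Type} [NormedAddCommGroup E] [NormedSpace ℝ E]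
variable {Z : Type*} [TopologicalSpace Z] [SecondCountableTopology Z] [MeasurableSpace Z]
  [OpensMeasurableSpace Z] {μ : Measure Z}

theorem continuous_seminorm {F : Type*} [NormedAddCommGroup F] [NormedSpace ℝ F] (k m : ℕ) :
    Continuous (SchwartzMap.seminorm ℝ k m : 𝓢(E, F) → ℝ) :=
  (schwartz_withSeminorms ℝ E F).continuous_seminorm (k, m)

theorem seminorm_fderivCLM_le {F : Type*} [NormedAddCommGroup F] [NormedSpace ℝ F] (k m : ℕ)
    (φ : 𝓢(E, F)) :
    SchwartzMap.seminorm ℝ k m (SchwartzMap.fderivCLM ℝ E F φ) ≤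
      SchwartzMap.seminorm ℝ k (m + 1) φ := by
  refine SchwartzMap.seminorm_le_bound ℝ k m _ (apply_nonneg _ _) fun x => ?_
  have h : (SchwartzMap.fderivCLM ℝ E F φ : E → E →L[ℝ] F) = fderiv ℝ φ :=
    funext fun x => SchwartzMap.fderivCLM_apply ℝ φ x
  rw [h, norm_iteratedFDeriv_fderiv]
  exact SchwartzMap.le_seminorm ℝ k (m + 1) φ x

/-- Differentiation under the integral sign for a family of Schwartz functions. -/
theorem iteratedFDeriv_integral (m : ℕ) : ∀ {F : Type} [NormedAddCommGroup F]
    [NormedSpace ℝ F] (Φ : Z → 𝓢(E, F)) (ψ : 𝓢(E, F)) (_ : Continuous Φ)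
    (_ : ∀ k m, Integrable (fun z => SchwartzMap.seminorm ℝ k m (Φ z)) μ)
    (_ : ∀ y, ψ y = ∫ z, Φ z y ∂μ) (y : E),
    iteratedFDeriv ℝ m ψ y = ∫ z, iteratedFDeriv ℝ m (Φ z) y ∂μ := by
  -- The target space is quantified inside the statement because the inductive step applies the
  -- hypothesis to derivatives, whose values lie in `E →L[ℝ] F`.
  induction m with
  | zero =>
    intro F _ _ Φ ψ hΦ hi hψ y
    simp only [iteratedFDeriv_zero_eq_comp, Function.comp_apply]
    rw [hψ]
    exact ((continuousMultilinearCurryFin0 ℝ E F).symm.toContinuousLinearEquiv.integral_comp_comm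
      (fun z => Φ z y)).symm
  | succ m ih =>
    intro F _ _ Φ ψ hΦ hi hψ y
    have hco : ∀ {G : Type} [NormedAddCommGroup G] [NormedSpace ℝ G]
        {Φ : Z → 𝓢(E, G)} (_ : Continuous Φ) (y : E), Continuous (fun z => Φ z y) := by
      intro G _ _ Φ hΦ y
      exact ((BoundedContinuousFunction.evalCLM ℝ y).continuous.comp
        (SchwartzMap.toBoundedContinuousFunctionCLM ℝ E G).continuous).comp hΦ
    have hc' : Continuous (fun z => SchwartzMap.fderivCLM ℝ E F (Φ z)) :=
      (SchwartzMap.fderivCLM ℝ E F).continuous.comp hΦ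
    have hd := ih (F := E →L[ℝ] F) (fun z => SchwartzMap.fderivCLM ℝ E F (Φ z))
      (SchwartzMap.fderivCLM ℝ E F ψ) hc'
      (fun k m => (hi k (m + 1)).mono' ((continuous_seminorm k m).comp hc').aestronglyMeasurable
        (ae_of_all _ fun z => by
          rw [Real.norm_of_nonneg (apply_nonneg _ _)]
          exact seminorm_fderivCLM_le k m (Φ z)))
      (fun y => ?_) y
    · have e : ∀ φ : 𝓢(E, F), iteratedFDeriv ℝ (m + 1) φ y =
          (continuousMultilinearCurryRightEquiv' ℝ m E F).symm
            (iteratedFDeriv ℝ m (SchwartzMap.fderivCLM ℝ E F φ) y) := by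
        intro φ
        have h : (SchwartzMap.fderivCLM ℝ E F φ : E → E →L[ℝ] F) = fderiv ℝ φ :=
          funext fun x => SchwartzMap.fderivCLM_apply ℝ φ x
        rw [iteratedFDeriv_succ_eq_comp_right, h]
        rfl
      rw [e, hd]
      simp_rw [e]
      exact (ContinuousLinearEquiv.integral_comp_comm (𝕜 := ℝ) (E := E [×m]→L[ℝ] E →L[ℝ] F)
        (F := E [×m.succ]→L[ℝ] F) (continuousMultilinearCurryRightEquiv' ℝ m E
        F).symm.toContinuousLinearEquiv (μ := μ)
        (fun z => iteratedFDeriv ℝ m (SchwartzMap.fderivCLM ℝ E F (Φ z)) y)).symm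
    -- The seminorm of order (0,1) dominates the first derivative at all points at once, so the
    -- neighbourhood can be the whole space.
    · have h := hasFDerivAt_integral_of_dominated_of_fderiv_le (𝕜 := ℝ) (μ := μ)
        (F := fun y z => Φ z y) (F' := fun y z => SchwartzMap.fderivCLM ℝ E F (Φ z) y)
        (x₀ := y) (s := Set.univ) (bound := fun z => SchwartzMap.seminorm ℝ 0 1 (Φ z)) univ_mem
        (Eventually.of_forall fun y => (hco hΦ y).aestronglyMeasurable)
        ((hi 0 0).mono' (hco hΦ y).aestronglyMeasurable
          (ae_of_all _ fun z => SchwartzMap.norm_le_seminorm ℝ (Φ z) y))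
        (hco hc' y).aestronglyMeasurable
        (ae_of_all _ fun z y _ => ?_) (hi 0 1)
        (ae_of_all _ fun z y _ => ?_)
      · have h2 : (ψ : E → F) = fun y => ∫ z, Φ z y ∂μ := funext hψ
        rw [SchwartzMap.fderivCLM_apply, h2]
        exact h.fderiv
      · have := SchwartzMap.norm_le_seminorm ℝ (SchwartzMap.fderivCLM ℝ E F (Φ z)) y
        exact this.trans (seminorm_fderivCLM_le 0 0 (Φ z))
      · exact SchwartzMap.hasFDerivAt (Φ z) y

/-- Bounded continuous functions with values in the `m`-linear forms. -/
def BoundedForms (E : Type) [NormedAddCommGroup E] [NormedSpace ℝ E] (m : ℕ) : Type :=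
  E →ᵇ (E [×m]→L[ℝ] ℂ)

noncomputable instance (m : ℕ) : NormedAddCommGroup (BoundedForms E m) :=
  inferInstanceAs (NormedAddCommGroup (E →ᵇ (E [×m]→L[ℝ] ℂ)))

noncomputable instance (m : ℕ) : NormedSpace ℂ (BoundedForms E m) :=
  inferInstanceAs (NormedSpace ℂ (E →ᵇ (E [×m]→L[ℝ] ℂ)))

instance (m : ℕ) : CompleteSpace (BoundedForms E m) :=
  inferInstanceAs (CompleteSpace (E →ᵇ (E [×m]→L[ℝ] ℂ)))

/-- Evaluation of a bounded form-valued function. -/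
noncomputable def BoundedForms.eval (m : ℕ) (y : E) : BoundedForms E m →L[ℂ] (E [×m]→L[ℝ] ℂ) :=
  BoundedContinuousFunction.evalCLM ℂ y

theorem BoundedForms.ext {m : ℕ} {a b : BoundedForms E m}
    (h : ∀ y, BoundedForms.eval m y a = BoundedForms.eval m y b) : a = b :=
  BoundedContinuousFunction.ext h

/-- `y ↦ ‖y‖^k D^m φ(y)` as a bounded continuous function, linear in `φ`. -/
noncomputable def weightedDeriv (k m : ℕ) : 𝓢(E, ℂ) →ₗ[ℂ] BoundedForms E m where
  toFun φ := BoundedContinuousFunction.ofNormedAddCommGroup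
    (fun y => ‖y‖ ^ k • iteratedFDeriv ℝ m φ y)
    ((continuous_norm.pow k).smul ((φ.smooth ⊤).continuous_iteratedFDeriv (mod_cast le_top)))
    (SchwartzMap.seminorm ℝ k m φ) (fun y => by
      rw [norm_smul, norm_pow, norm_norm]
      exact SchwartzMap.le_seminorm ℝ k m φ y)
  map_add' φ ψ := by
    refine BoundedForms.ext fun y => ?_
    have := iteratedFDeriv_add_apply (i := m) (x := y) (𝕜 := ℝ) (f := φ) (g := ψ)
      ((φ.smooth m).contDiffAt) ((ψ.smooth m).contDiffAt)
    change ‖y‖ ^ k • iteratedFDeriv ℝ m (⇑(φ + ψ)) y =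
      ‖y‖ ^ k • iteratedFDeriv ℝ m φ y + ‖y‖ ^ k • iteratedFDeriv ℝ m ψ y
    rw [← smul_add, ← this]
    rfl
  map_smul' c φ := by
    refine BoundedForms.ext fun y => ?_
    have := iteratedFDeriv_const_smul_apply (i := m) (x := y) (𝕜 := ℝ) (f := φ) (a := c)
      ((φ.smooth m).contDiffAt)
    change ‖y‖ ^ k • iteratedFDeriv ℝ m (⇑(c • φ)) y =
      c • ‖y‖ ^ k • iteratedFDeriv ℝ m φ y
    rw [smul_comm, ← this]
    rfl

theorem eval_weightedDeriv (k m : ℕ) (φ : 𝓢(E, ℂ)) (y : E) :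
    BoundedForms.eval m y (weightedDeriv k m φ) = ‖y‖ ^ k • iteratedFDeriv ℝ m φ y := rfl

theorem norm_weightedDeriv (k m : ℕ) (φ : 𝓢(E, ℂ)) :
    ‖weightedDeriv k m φ‖ = SchwartzMap.seminorm ℝ k m φ := by
  refine le_antisymm ?_ ?_
  · refine (BoundedContinuousFunction.norm_le (apply_nonneg _ _)).2 fun y => ?_
    refine le_trans (le_of_eq ?_) (SchwartzMap.le_seminorm ℝ k m φ y)
    change ‖‖y‖ ^ k • iteratedFDeriv ℝ m φ y‖ = _
    rw [norm_smul, norm_pow, norm_norm]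
  · refine SchwartzMap.seminorm_le_bound ℝ k m _ (norm_nonneg (weightedDeriv k m φ)) fun y => ?_
    have : ‖BoundedForms.eval m y (weightedDeriv k m φ)‖ ≤ ‖weightedDeriv k m φ‖ :=
      BoundedContinuousFunction.norm_coe_le_norm
        (weightedDeriv k m φ : E →ᵇ (E [×m]→L[ℝ] ℂ)) y
    rwa [eval_weightedDeriv, norm_smul, norm_pow, norm_norm] at this

theorem continuous_weightedDeriv (k m : ℕ) :
    Continuous (weightedDeriv k m : 𝓢(E, ℂ) → BoundedForms E m) := by
  rw [continuous_iff_continuousAt]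
  intro φ
  rw [ContinuousAt, tendsto_iff_norm_sub_tendsto_zero]
  simp_rw [← map_sub, norm_weightedDeriv]
  have : Continuous fun χ : 𝓢(E, ℂ) => SchwartzMap.seminorm ℝ k m (χ - φ) :=
    (continuous_seminorm k m).comp (continuous_id.sub continuous_const)
  simpa using this.tendsto φ

/-- A tempered functional commutes with integrals of continuous families of Schwartz functions
all of whose seminorms are integrable. -/
theorem apply_eq_integral (T : 𝓢(E, ℂ) →L[ℂ] ℂ) (Φ : Z → 𝓢(E, ℂ)) (ψ : 𝓢(E, ℂ))
    (hΦ : Continuous Φ)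
    (hi : ∀ k m, Integrable (fun z => SchwartzMap.seminorm ℝ k m (Φ z)) μ)
    (hψ : ∀ y, ψ y = ∫ z, Φ z y ∂μ) :
    T ψ = ∫ z, T (Φ z) ∂μ := by
  -- `T` is controlled by finitely many seminorms, hence factors through the map `ι` into a finite
  -- product of Banach spaces. Hahn–Banach extends it from the range of `ι` to a continuous
  -- functional `S`, and Bochner integration in the Banach space replaces integration in the
  -- Schwartz space.
  obtain ⟨s, C, -, hC⟩ := Seminorm.bound_of_continuous (schwartz_withSeminorms ℂ E ℂ)
    ((normSeminorm ℂ ℂ).comp T.toLinearMap) (by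
      exact continuous_norm.comp T.continuous)
  let ι : 𝓢(E, ℂ) →ₗ[ℂ] ((i : s) → BoundedForms E i.1.2) :=
    LinearMap.pi fun i => weightedDeriv i.1.1 i.1.2
  have hιc : Continuous ι := continuous_pi fun i => continuous_weightedDeriv i.1.1 i.1.2
  have hιn : ∀ φ, ‖T φ‖ ≤ C * ‖ι φ‖ := by
    intro φ
    refine (hC φ).trans ?_
    rw [smul_apply, NNReal.smul_def, smul_eq_mul]
    gcongr
    refine Seminorm.finset_sup_apply_le (norm_nonneg _) fun i hi => ?_
    have h := norm_le_pi_norm (ι φ) ⟨i, hi⟩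
    have h2 : ‖ι φ ⟨i, hi⟩‖ = SchwartzMap.seminorm ℝ i.1 i.2 φ := norm_weightedDeriv i.1 i.2 φ
    rw [h2] at h
    exact h
  have hker : ∀ φ, ι φ = 0 → T φ = 0 := fun φ h => by
    have := hιn φ
    rw [h, norm_zero (E := (i : s) → BoundedForms E i.1.2), mul_zero] at this
    exact norm_le_zero_iff.1 this
  obtain ⟨T₀, hT₀⟩ : ∃ T₀ : LinearMap.range ι →ₗ[ℂ] ℂ, ∀ φ, T₀ ⟨ι φ, φ, rfl⟩ = T φ := by
    have hle : LinearMap.ker ι ≤ LinearMap.ker T.toLinearMap := fun φ h => hker φ h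
    refine ⟨((LinearMap.ker ι).liftQ T.toLinearMap hle) ∘ₗ
      ι.quotKerEquivRange.symm.toLinearMap, fun φ => ?_⟩
    have : ι.quotKerEquivRange.symm ⟨ι φ, φ, rfl⟩ = (LinearMap.ker ι).mkQ φ := by
      rw [LinearEquiv.symm_apply_eq]
      rfl
    simp only [LinearMap.comp_apply, LinearEquiv.coe_coe, this]
    rfl
  have hT₀b : ∀ x, ‖T₀ x‖ ≤ C * ‖x‖ := by
    rintro ⟨_, φ, rfl⟩
    rw [hT₀]
    exact hιn φ
  obtain ⟨S, hS, -⟩ := exists_extension_norm_eq (LinearMap.range ι) (T₀.mkContinuous C hT₀b)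
  have hSι : ∀ φ, S (ι φ) = T φ := fun φ => by
    rw [← hT₀]
    exact hS ⟨ι φ, φ, rfl⟩
  have hint : Integrable (fun z => ι (Φ z)) μ := by
    have hb : Integrable (fun z => ∑ i : s, SchwartzMap.seminorm ℝ i.1.1 i.1.2 (Φ z)) μ :=
      integrable_finsetSum _ fun i _ => hi _ _
    refine hb.mono' (hιc.comp hΦ).aestronglyMeasurable (ae_of_all _ fun z => ?_)
    have hn : ∀ i : s, 0 ≤ SchwartzMap.seminorm ℝ i.1.1 i.1.2 (Φ z) := fun i => apply_nonneg _ _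
    rw [pi_norm_le_iff_of_nonneg (Finset.sum_nonneg fun i _ => hn i)]
    intro i
    have h2 : ‖ι (Φ z) i‖ = SchwartzMap.seminorm ℝ i.1.1 i.1.2 (Φ z) :=
      norm_weightedDeriv _ _ _
    rw [h2]
    exact Finset.single_le_sum (f := fun i : s => SchwartzMap.seminorm ℝ i.1.1 i.1.2 (Φ z))
      (fun i _ => hn i) (Finset.mem_univ i)
  -- Point evaluations separate bounded functions, so the identity reduces to differentiation under
  -- the integral sign.
  have key : ι ψ = ∫ z, ι (Φ z) ∂μ := by
    ext1 i
    refine BoundedForms.ext fun y => ?_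
    have h1 := ContinuousLinearMap.integral_comp_comm
      ((BoundedForms.eval i.1.2 y).comp (ContinuousLinearMap.proj (R := ℂ)
        (φ := fun i : s => BoundedForms E i.1.2) i)) hint
    simp only [ContinuousLinearMap.comp_apply, ContinuousLinearMap.proj_apply] at h1
    rw [← h1]
    change ‖y‖ ^ i.1.1 • iteratedFDeriv ℝ i.1.2 ψ y =
      ∫ z, ‖y‖ ^ i.1.1 • iteratedFDeriv ℝ i.1.2 (Φ z) y ∂μ
    rw [integral_smul, iteratedFDeriv_integral i.1.2 Φ ψ hΦ hi hψ]
  rw [← hSι, key, ← S.integral_comp_comm hint]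
  simp_rw [hSι]

end Interchange
end Sjostrand

namespace Sjostrand

/-! ### Translations of Schwartz functions -/

section Translation

variable {E : Type} [NormedAddCommGroup E] [NormedSpace ℝ E]

theorem iteratedFDeriv_compSubConst (m : ℕ) (a : E) (g : 𝓢(E, ℂ)) (y : E) :
    iteratedFDeriv ℝ m (SchwartzMap.compSubConstCLM ℂ a g) y = iteratedFDeriv ℝ m g (y - a) := by
  have h : (SchwartzMap.compSubConstCLM ℂ a g : E → ℂ) = fun z => g (z - a) :=
    rfl
  rw [h, iteratedFDeriv_comp_sub]

theorem norm_pow_le_add {E : Type} [NormedAddCommGroup E] (y a : E) (k : ℕ) :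
    ‖y‖ ^ k ≤ 2 ^ k * (‖y - a‖ ^ k + ‖a‖ ^ k) := by
  have h : ‖y‖ ≤ ‖y - a‖ + ‖a‖ := by simpa using norm_add_le (y - a) a
  calc ‖y‖ ^ k ≤ (‖y - a‖ + ‖a‖) ^ k := by gcongr
    _ ≤ 2 ^ (k - 1) * (‖y - a‖ ^ k + ‖a‖ ^ k) :=
      add_pow_le (norm_nonneg _) (norm_nonneg _) k
    _ ≤ _ := by
      gcongr
      · norm_num
      · omega

/-- Splitting the weight ‖y‖^k between y - a and a shows that translation costs only polynomial
growth in the shift. -/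
theorem seminorm_compSubConst_le (k m : ℕ) (a : E) (g : 𝓢(E, ℂ)) :
    SchwartzMap.seminorm ℝ k m (SchwartzMap.compSubConstCLM ℂ a g) ≤
      2 ^ k * (SchwartzMap.seminorm ℝ k m g + ‖a‖ ^ k * SchwartzMap.seminorm ℝ 0 m g) := by
  refine SchwartzMap.seminorm_le_bound ℝ k m _ (by positivity) fun y => ?_
  rw [iteratedFDeriv_compSubConst]
  have h1 := SchwartzMap.le_seminorm ℝ k m g (y - a)
  have h2 := SchwartzMap.le_seminorm ℝ 0 m g (y - a)
  rw [pow_zero, one_mul] at h2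
  calc ‖y‖ ^ k * ‖iteratedFDeriv ℝ m g (y - a)‖
      ≤ (2 ^ k * (‖y - a‖ ^ k + ‖a‖ ^ k)) * ‖iteratedFDeriv ℝ m g (y - a)‖ := by
        gcongr; exact norm_pow_le_add y a k
    _ = 2 ^ k * (‖y - a‖ ^ k * ‖iteratedFDeriv ℝ m g (y - a)‖ +
        ‖a‖ ^ k * ‖iteratedFDeriv ℝ m g (y - a)‖) := by ring
    _ ≤ _ := by gcongr

/-- Mean value inequality on the segment from y to y - a. Since ‖a‖ ≤ 1, the weights at y and at
points of the segment are comparable. -/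
theorem seminorm_compSubConst_sub_le (k m : ℕ) {a : E} (ha : ‖a‖ ≤ 1) (g : 𝓢(E, ℂ)) :
    SchwartzMap.seminorm ℝ k m (SchwartzMap.compSubConstCLM ℂ a g - g) ≤
      ‖a‖ * (2 ^ k * (SchwartzMap.seminorm ℝ k (m + 1) g +
        SchwartzMap.seminorm ℝ 0 (m + 1) g)) := by
  refine SchwartzMap.seminorm_le_bound ℝ k m _ (by positivity) fun y => ?_
  have e : iteratedFDeriv ℝ m (SchwartzMap.compSubConstCLM ℂ a g - g : 𝓢(E, ℂ)) y =
      iteratedFDeriv ℝ m g (y - a) - iteratedFDeriv ℝ m g y := by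
    have := iteratedFDeriv_sub_apply (i := m) (x := y) (𝕜 := ℝ)
      (f := SchwartzMap.compSubConstCLM ℂ a g) (g := g)
      (((SchwartzMap.compSubConstCLM ℂ a g).smooth m).contDiffAt) ((g.smooth m).contDiffAt)
    rw [iteratedFDeriv_compSubConst] at this
    exact this
  rw [e]
  have hmv : ‖iteratedFDeriv ℝ m g (y - a) - iteratedFDeriv ℝ m g y‖ * ‖y‖ ^ k ≤
      (2 ^ k * (SchwartzMap.seminorm ℝ k (m + 1) g +
        SchwartzMap.seminorm ℝ 0 (m + 1) g)) * ‖(y - a) - y‖ := by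
    have hd : Differentiable ℝ (iteratedFDeriv ℝ m g) :=
      (g.smooth ⊤).differentiable_iteratedFDeriv (mod_cast WithTop.coe_lt_top _)
    -- The derivative bound below divides by ‖y‖^k, so a vanishing weight is treated apart.
    rcases (pow_nonneg (norm_nonneg y) k).eq_or_lt with h0 | h0
    · rw [← h0, mul_zero]
      positivity
    have hb : ∀ z ∈ segment ℝ y (y - a), ‖fderiv ℝ (iteratedFDeriv ℝ m g) z‖ ≤
        (2 ^ k * (SchwartzMap.seminorm ℝ k (m + 1) g + SchwartzMap.seminorm ℝ 0 (m + 1) g)) /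
          ‖y‖ ^ k := by
      intro z hz
      rw [norm_fderiv_iteratedFDeriv, le_div_iff₀ h0, mul_comm]
      have h1 := SchwartzMap.le_seminorm ℝ k (m + 1) g z
      have h2 := SchwartzMap.le_seminorm ℝ 0 (m + 1) g z
      rw [pow_zero, one_mul] at h2
      have hyz : ‖y - z‖ ≤ 1 := by
        have := norm_sub_le_of_mem_segment hz
        rw [norm_sub_rev]
        refine this.trans ?_
        simpa using ha
      have h3 := norm_pow_le_add y (y - z) k
      rw [sub_sub_cancel] at h3
      calc ‖y‖ ^ k * ‖iteratedFDeriv ℝ (m + 1) g z‖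
          ≤ (2 ^ k * (‖z‖ ^ k + 1)) * ‖iteratedFDeriv ℝ (m + 1) g z‖ := by
            gcongr
            refine h3.trans ?_
            gcongr
            exact pow_le_one₀ (norm_nonneg _) hyz
        _ = 2 ^ k * (‖z‖ ^ k * ‖iteratedFDeriv ℝ (m + 1) g z‖ +
            ‖iteratedFDeriv ℝ (m + 1) g z‖) := by ring
        _ ≤ _ := by gcongr
    have hmv := (convex_segment y (y - a)).norm_image_sub_le_of_norm_fderiv_le (𝕜 := ℝ)
      (fun z _ => hd z) hb (left_mem_segment ℝ y (y - a)) (right_mem_segment ℝ y (y - a))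
    rwa [div_mul_eq_mul_div, le_div_iff₀ h0] at hmv
  rw [sub_sub_cancel_left, norm_neg] at hmv
  linarith

/-- Translation is jointly continuous. -/
theorem continuous_compSubConst :
    Continuous fun p : E × 𝓢(E, ℂ) => SchwartzMap.compSubConstCLM ℂ p.1 p.2 := by
  rw [continuous_iff_continuousAt]
  rintro ⟨a, g⟩
  rw [ContinuousAt, (schwartz_withSeminorms ℝ E ℂ).tendsto_nhds]
  rintro ⟨k, m⟩ ε hε
  have hbd : ∀ᶠ p : E × 𝓢(E, ℂ) in 𝓝 (a, g), ‖p.1 - a‖ ≤ 1 := by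
    have : Continuous fun p : E × 𝓢(E, ℂ) => ‖p.1 - a‖ := by fun_prop
    have h := this.tendsto (a, g)
    simp only [sub_self, norm_zero] at h
    exact (h.eventually_le_const one_pos)
  set B : E × 𝓢(E, ℂ) → ℝ := fun p =>
    2 ^ k * (SchwartzMap.seminorm ℝ k m (p.2 - g) +
        ‖p.1‖ ^ k * SchwartzMap.seminorm ℝ 0 m (p.2 - g)) +
    ‖p.1 - a‖ * (2 ^ k * (SchwartzMap.seminorm ℝ k (m + 1) (SchwartzMap.compSubConstCLM ℂ a g) +
        SchwartzMap.seminorm ℝ 0 (m + 1) (SchwartzMap.compSubConstCLM ℂ a g))) with hB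
  have hBc : Continuous B := by
    have h1 : ∀ k m, Continuous fun p : E × 𝓢(E, ℂ) => SchwartzMap.seminorm ℝ k m (p.2 - g) :=
      fun k m => (continuous_seminorm k m).comp (continuous_snd.sub continuous_const)
    exact (continuous_const.mul ((h1 k m).add (((continuous_norm.comp continuous_fst).pow k).mul
      (h1 0 m)))).add ((continuous_norm.comp (continuous_fst.sub continuous_const)).mul
      continuous_const)
  have hB0 : Tendsto B (𝓝 (a, g)) (𝓝 0) := by
    have := hBc.tendsto (a, g)
    simpa [hB] using this
  filter_upwards [hbd, hB0.eventually_lt_const hε] with p hp hlt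
  refine lt_of_le_of_lt ?_ hlt
  change SchwartzMap.seminorm ℝ k m (SchwartzMap.compSubConstCLM ℂ p.1 p.2 -
    SchwartzMap.compSubConstCLM ℂ a g) ≤ _
  -- The change of function is estimated with locally bounded shifts; the change of shift acts on
  -- one fixed function, the translate of g by a.
  have e : SchwartzMap.compSubConstCLM ℂ p.1 p.2 - SchwartzMap.compSubConstCLM ℂ a g =
      SchwartzMap.compSubConstCLM ℂ p.1 (p.2 - g) +
      (SchwartzMap.compSubConstCLM ℂ (p.1 - a) (SchwartzMap.compSubConstCLM ℂ a g) -
        SchwartzMap.compSubConstCLM ℂ a g) := by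
    rw [SchwartzMap.compSubConstCLM_comp, map_sub, add_sub_cancel]
    abel
  rw [e]
  exact (map_add_le_add _ _ _).trans
    (add_le_add (seminorm_compSubConst_le k m _ _) (seminorm_compSubConst_sub_le k m hp _))

end Translation

/-! ### Families of Schwartz functions of polynomial growth -/

section PolyBounded

variable {E : Type} [NormedAddCommGroup E] [NormedSpace ℝ E]
variable {Z : Type*} [NormedAddCommGroup Z]

/-- A family of Schwartz functions whose seminorms grow at most polynomially. -/
def PolyBounded (Φ : Z → 𝓢(E, ℂ)) : Prop :=
  ∀ k m : ℕ, ∃ (N : ℕ) (C : ℝ), 0 ≤ C ∧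
    ∀ z, SchwartzMap.seminorm ℝ k m (Φ z) ≤ C * (1 + ‖z‖) ^ N

theorem polyBounded_const (g : 𝓢(E, ℂ)) : PolyBounded fun _ : Z => g :=
  fun k m => ⟨0, SchwartzMap.seminorm ℝ k m g, apply_nonneg _ _, fun z => by simp⟩

/-- A continuous seminorm of a polynomially bounded family is polynomially bounded. -/
theorem PolyBounded.seminorm_comp {Φ : Z → 𝓢(E, ℂ)} (hΦ : PolyBounded Φ)
    {p : Seminorm ℝ 𝓢(E, ℂ)} (hp : Continuous p) :
    ∃ (N : ℕ) (C : ℝ), 0 ≤ C ∧ ∀ z, p (Φ z) ≤ C * (1 + ‖z‖) ^ N := by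
  obtain ⟨s, C, -, hC⟩ := Seminorm.bound_of_continuous (schwartz_withSeminorms ℝ E ℂ) p hp
  choose N D hD h using hΦ
  refine ⟨∑ i ∈ s, N i.1 i.2, C * ∑ i ∈ s, D i.1 i.2,
    mul_nonneg C.2 (Finset.sum_nonneg fun i _ => hD _ _), fun z => ?_⟩
  refine (hC (Φ z)).trans ?_
  rw [smul_apply, NNReal.smul_def, smul_eq_mul, mul_assoc]
  refine mul_le_mul_of_nonneg_left ?_ C.2
  have h1 : (1 : ℝ) ≤ 1 + ‖z‖ := by linarith [norm_nonneg z]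
  refine Seminorm.finset_sup_apply_le (mul_nonneg (Finset.sum_nonneg fun i _ => hD _ _)
    (by positivity)) fun i hi => ?_
  refine (h i.1 i.2 z).trans ?_
  have h2 : D i.1 i.2 ≤ ∑ i ∈ s, D i.1 i.2 :=
    Finset.single_le_sum (f := fun i : ℕ × ℕ => D i.1 i.2) (fun i _ => hD _ _) hi
  have h3 : N i.1 i.2 ≤ ∑ i ∈ s, N i.1 i.2 :=
    Finset.single_le_sum (f := fun i : ℕ × ℕ => N i.1 i.2) (fun i _ => Nat.zero_le _) hi
  exact mul_le_mul h2 (pow_le_pow_right₀ h1 h3) (by positivity) ((hD _ _).trans h2)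

theorem PolyBounded.comp_clm {Φ : Z → 𝓢(E, ℂ)} (hΦ : PolyBounded Φ)
    (A : 𝓢(E, ℂ) →L[ℝ] 𝓢(E, ℂ)) : PolyBounded fun z => A (Φ z) := fun k m => by
  exact hΦ.seminorm_comp (p := (SchwartzMap.seminorm ℝ k m).comp A.toLinearMap)
    (by exact (continuous_seminorm k m).comp A.continuous)

theorem PolyBounded.compSubConst {Φ : Z → 𝓢(E, ℂ)} (hΦ : PolyBounded Φ) {a : Z → E} {c : ℝ}
    (hc : 0 ≤ c) (ha : ∀ z, ‖a z‖ ≤ c * (1 + ‖z‖)) :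
    PolyBounded fun z => SchwartzMap.compSubConstCLM ℂ (a z) (Φ z) := by
  intro k m
  obtain ⟨N, C, hC, h⟩ := hΦ k m
  obtain ⟨N', C', hC', h'⟩ := hΦ 0 m
  refine ⟨N + (k + N'), 2 ^ k * (C + c ^ k * C'), by positivity, fun z => ?_⟩
  refine (seminorm_compSubConst_le k m _ _).trans ?_
  have h1 : (1 : ℝ) ≤ 1 + ‖z‖ := by linarith [norm_nonneg z]
  have h2 : SchwartzMap.seminorm ℝ k m (Φ z) ≤ C * (1 + ‖z‖) ^ (N + (k + N')) :=
    (h z).trans (mul_le_mul_of_nonneg_left (pow_le_pow_right₀ h1 (by omega)) hC)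
  have h3 : ‖a z‖ ^ k * SchwartzMap.seminorm ℝ 0 m (Φ z) ≤
      c ^ k * C' * (1 + ‖z‖) ^ (N + (k + N')) := by
    calc ‖a z‖ ^ k * SchwartzMap.seminorm ℝ 0 m (Φ z)
        ≤ (c * (1 + ‖z‖)) ^ k * (C' * (1 + ‖z‖) ^ N') := by
          gcongr
          · exact ha z
          · exact h' z
      _ = c ^ k * C' * (1 + ‖z‖) ^ (k + N') := by rw [mul_pow, pow_add]; ring
      _ ≤ _ := mul_le_mul_of_nonneg_left (pow_le_pow_right₀ h1 (by omega)) (by positivity)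
  calc _ ≤ 2 ^ k * (C * (1 + ‖z‖) ^ (N + (k + N')) +
        c ^ k * C' * (1 + ‖z‖) ^ (N + (k + N'))) := by gcongr
    _ = _ := by ring

end PolyBounded

end Sjostrand

/-! ### Phase space shifts as families of Schwartz functions -/

namespace Sjostrand

open scoped FourierTransform

variable {n : ℕ}

/-- Multiplication by a plane wave is a translation on the Fourier side. -/
theorem smulLeft_planeWave (ħ : ℝ) (ξ : EuclideanSpace ℝ (Fin n))
    (h : 𝓢(EuclideanSpace ℝ (Fin n), ℂ)) :
    SchwartzMap.smulLeftCLM ℂ (planeWave ħ ξ) h =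
      𝓕⁻ (SchwartzMap.compSubConstCLM ℂ ((2 * Real.pi * ħ)⁻¹ • ξ) (𝓕 h)) := by
  rw [← FourierTransform.fourierInv_fourier_eq (F := 𝓢(EuclideanSpace ℝ (Fin n), ℂ))
    (SchwartzMap.smulLeftCLM ℂ (planeWave ħ ξ) h)]
  congr 1
  ext w
  rw [SchwartzMap.compSubConstCLM_apply, SchwartzMap.fourier_coe, SchwartzMap.fourier_coe,
    Real.fourier_eq', Real.fourier_eq']
  congr 1
  ext v
  rw [SchwartzMap.smulLeftCLM_apply_apply (planeWave_hasTemperateGrowth ħ ξ), planeWave, smul_smul,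
    ← Complex.exp_add]
  congr 2
  rw [inner_sub_right, inner_smul_right, real_inner_comm v ξ, mul_comm Complex.I, ← add_mul,
    ← Complex.ofReal_add]
  congr 2
  have hp : Real.pi ≠ 0 := Real.pi_ne_zero
  rw [mul_inv, mul_inv]
  field_simp
  ring

/-- With modulation written as a translation between two Fourier transforms, continuity and
polynomial growth of phase space shifts follow from the same facts for translations. -/
theorem phaseShift_eq_fourierInv (ħ : ℝ) (x ξ : EuclideanSpace ℝ (Fin n))
    (g : 𝓢(EuclideanSpace ℝ (Fin n), ℂ)) :
    phaseShift ħ x ξ g = (((2 * Real.pi * ħ) ^ (-((n : ℝ) / 2)) : ℝ) : ℂ) •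
      𝓕⁻ (SchwartzMap.compSubConstCLM ℂ ((2 * Real.pi * ħ)⁻¹ • ξ)
        (𝓕 (SchwartzMap.compSubConstCLM ℂ x g))) := by
  rw [phaseShift, smulLeft_planeWave]

/-- The phase space shifts of a Schwartz function depend continuously on the shift. -/
theorem continuous_phaseShift (ħ : ℝ) (g : 𝓢(EuclideanSpace ℝ (Fin n), ℂ)) :
    Continuous fun z : EuclideanSpace ℝ (Fin n) × EuclideanSpace ℝ (Fin n) =>
      phaseShift ħ z.1 z.2 g := by
  simp_rw [phaseShift_eq_fourierInv]
  have h1 : Continuous fun z : EuclideanSpace ℝ (Fin n) × EuclideanSpace ℝ (Fin n) =>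
      𝓕 (SchwartzMap.compSubConstCLM ℂ z.1 g) :=
    (FourierTransform.fourierCLM ℂ 𝓢(EuclideanSpace ℝ (Fin n), ℂ)).continuous.comp
      (continuous_compSubConst.comp (continuous_fst.prodMk continuous_const))
  have h2 := continuous_compSubConst.comp ((continuous_snd.const_smul (2 * Real.pi * ħ)⁻¹).prodMk h1)
  exact ((FourierTransform.fourierInvCLM ℂ 𝓢(EuclideanSpace ℝ (Fin n), ℂ)).continuous.comp
    h2).const_smul ((((2 * Real.pi * ħ) ^ (-((n : ℝ) / 2)) : ℝ) : ℂ))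

theorem polyBounded_compSubConst {Z : Type*} [NormedAddCommGroup Z]
    (g : 𝓢(EuclideanSpace ℝ (Fin n), ℂ)) {a : Z → EuclideanSpace ℝ (Fin n)}
    (ha : ∀ z, ‖a z‖ ≤ ‖z‖) :
    PolyBounded fun z : Z => SchwartzMap.compSubConstCLM ℂ (a z) g :=
  (polyBounded_const g).compSubConst zero_le_one fun z => by linarith [ha z]

theorem polyBounded_phaseShift (ħ : ℝ) (g : 𝓢(EuclideanSpace ℝ (Fin n), ℂ)) :
    PolyBounded fun z : EuclideanSpace ℝ (Fin n) × EuclideanSpace ℝ (Fin n) =>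
      phaseShift ħ z.1 z.2 g := by
  simp_rw [phaseShift_eq_fourierInv]
  have h1 := (polyBounded_compSubConst g
    (a := fun z : EuclideanSpace ℝ (Fin n) × EuclideanSpace ℝ (Fin n) => z.1) norm_fst_le).comp_clm
      (FourierTransform.fourierCLM ℝ 𝓢(EuclideanSpace ℝ (Fin n), ℂ))
  have h2 := h1.compSubConst (a := fun z => (2 * Real.pi * ħ)⁻¹ • z.2)
    (c := ‖(2 * Real.pi * ħ)⁻¹‖) (norm_nonneg _) (fun z => by
      rw [norm_smul]
      gcongr
      linarith [norm_snd_le z])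
  exact (h2.comp_clm (FourierTransform.fourierInvCLM ℝ 𝓢(EuclideanSpace ℝ (Fin n), ℂ))).comp_clm
    (((((2 * Real.pi * ħ) ^ (-((n : ℝ) / 2)) : ℝ) : ℂ) •
      ContinuousLinearMap.id ℂ 𝓢(EuclideanSpace ℝ (Fin n), ℂ)).restrictScalars ℝ)

/-- Complex conjugation on Schwartz functions, as a continuous real-linear map. -/
noncomputable def conjSCLM :
    𝓢(EuclideanSpace ℝ (Fin n), ℂ) →L[ℝ] 𝓢(EuclideanSpace ℝ (Fin n), ℂ) :=
  SchwartzMap.postcompCLM (Complex.conjCLE : ℂ →L[ℝ] ℂ)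

theorem continuous_conjS_phaseShift (ħ : ℝ) (g : 𝓢(EuclideanSpace ℝ (Fin n), ℂ)) :
    Continuous fun z : EuclideanSpace ℝ (Fin n) × EuclideanSpace ℝ (Fin n) =>
      conjS (phaseShift ħ z.1 z.2 g) :=
  conjSCLM.continuous.comp (continuous_phaseShift ħ g)

theorem polyBounded_conjS_phaseShift (ħ : ℝ) (g : 𝓢(EuclideanSpace ℝ (Fin n), ℂ)) :
    PolyBounded fun z : EuclideanSpace ℝ (Fin n) × EuclideanSpace ℝ (Fin n) =>
      conjS (phaseShift ħ z.1 z.2 g) :=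
  (polyBounded_phaseShift ħ g).comp_clm conjSCLM

theorem continuous_stft (ħ : ℝ) (g : 𝓢(EuclideanSpace ℝ (Fin n), ℂ))
    (f : 𝓢'(EuclideanSpace ℝ (Fin n), ℂ)) :
    Continuous fun z : EuclideanSpace ℝ (Fin n) × EuclideanSpace ℝ (Fin n) =>
      stft ħ g f z.1 z.2 :=
  (ContinuousLinearMap.continuous
    (f : 𝓢(EuclideanSpace ℝ (Fin n), ℂ) →L[ℂ] ℂ)).comp (continuous_conjS_phaseShift ħ g)

theorem continuous_finset_sup_seminorm {E : Type} [NormedAddCommGroup E] [NormedSpace ℝ E]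
    (s : Finset (ℕ × ℕ)) : Continuous ⇑(s.sup (fun m : ℕ × ℕ =>
      SchwartzMap.seminorm ℝ m.1 m.2) : Seminorm ℝ 𝓢(E, ℂ)) := by
  induction s using Finset.cons_induction with
  | empty => exact continuous_const
  | cons i s hi ih =>
    rw [Finset.sup_cons, Seminorm.coe_sup]
    exact (continuous_seminorm i.1 i.2).sup ih

/-- Pointwise decay of a polynomially bounded family. -/
theorem PolyBounded.decay {E : Type} [NormedAddCommGroup E] [NormedSpace ℝ E]
    {Z : Type*} [NormedAddCommGroup Z] {Φ : Z → 𝓢(E, ℂ)} (hΦ : PolyBounded Φ) (N : ℕ) :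
    ∃ (M : ℕ) (C : ℝ), 0 ≤ C ∧ ∀ z y, (1 + ‖y‖) ^ N * ‖Φ z y‖ ≤ C * (1 + ‖z‖) ^ M := by
  obtain ⟨M, C, hC, h⟩ := hΦ.seminorm_comp
    (p := ((Finset.Iic (N, 0)).sup (fun m : ℕ × ℕ => SchwartzMap.seminorm ℝ m.1 m.2) :
      Seminorm ℝ 𝓢(E, ℂ)))
    (continuous_finset_sup_seminorm _)
  refine ⟨M, 2 ^ N * C, by positivity, fun z y => ?_⟩
  have := SchwartzMap.one_add_le_sup_seminorm_apply (𝕜 := ℝ) (m := (N, 0)) (k := N) (n := 0) le_rfl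
    le_rfl (Φ z) y
  rw [norm_iteratedFDeriv_zero] at this
  refine this.trans ?_
  rw [mul_assoc]
  gcongr
  exact h z

theorem schwartz_decay {E : Type} [NormedAddCommGroup E] [NormedSpace ℝ E] (g : 𝓢(E, ℂ)) (N : ℕ) :
    ∃ C : ℝ, 0 ≤ C ∧ ∀ y, (1 + ‖y‖) ^ N * ‖g y‖ ≤ C := by
  obtain ⟨M, C, hC, h⟩ := (polyBounded_const (Z := ℝ) g).decay N
  exact ⟨C, hC, fun y => by simpa using h 0 y⟩

theorem integrable_inv_one_add_norm_pow {N : ℕ} (hN : n < N) :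
    Integrable fun x : EuclideanSpace ℝ (Fin n) => ((1 + ‖x‖) ^ N)⁻¹ := by
  have h := integrable_one_add_norm (E := EuclideanSpace ℝ (Fin n)) (μ := volume) (r := N)
    (by simpa using hN)
  refine h.congr (ae_of_all _ fun x => ?_)
  simp only
  rw [Real.rpow_neg (by positivity), Real.rpow_natCast]

/-! ### Decay of Gabor coefficients -/

/-- The pairing of a phase space shift with a Schwartz function. -/
noncomputable def coeff (ħ : ℝ) (γ φ : 𝓢(EuclideanSpace ℝ (Fin n), ℂ))
    (x ξ : EuclideanSpace ℝ (Fin n)) : ℂ :=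
  ∫ y, phaseShift ħ x ξ γ y * φ y

theorem coeff_eq_fourier (ħ : ℝ) (γ φ : 𝓢(EuclideanSpace ℝ (Fin n), ℂ))
    (x ξ : EuclideanSpace ℝ (Fin n)) :
    coeff ħ γ φ x ξ = (((2 * Real.pi * ħ) ^ (-((n : ℝ) / 2)) : ℝ) : ℂ) *
      𝓕 (SchwartzMap.smulLeftCLM ℂ φ (SchwartzMap.compSubConstCLM ℂ x γ))
        ((-(2 * Real.pi * ħ)⁻¹) • ξ) := by
  rw [coeff, SchwartzMap.fourier_coe, Real.fourier_eq', ← integral_const_mul]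
  congr 1
  ext y
  rw [phaseShift_apply, SchwartzMap.smulLeftCLM_apply_apply φ.hasTemperateGrowth,
    SchwartzMap.compSubConstCLM_apply, inner_smul_right, real_inner_comm ξ y, smul_eq_mul,
    smul_eq_mul]
  have e : (Complex.I * ((inner ℝ ξ y / ħ : ℝ) : ℂ)) =
      ((-2 * Real.pi * (-(2 * Real.pi * ħ)⁻¹ * inner ℝ ξ y) : ℝ) : ℂ) * Complex.I := by
    rw [mul_comm]
    congr 2
    have hp : Real.pi ≠ 0 := Real.pi_ne_zero
    rw [mul_inv, mul_inv]
    field_simp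
  rw [e]
  ring

/-- A Peetre-type inequality: it distributes a weight in x over factors decaying in y - x and in y.
-/
theorem one_add_norm_le_mul (x y : EuclideanSpace ℝ (Fin n)) :
    1 + ‖x‖ ≤ (1 + ‖y - x‖) * (1 + ‖y‖) := by
  have h : ‖x‖ ≤ ‖y‖ + ‖y - x‖ := by simpa using norm_sub_le y (y - x)
  nlinarith [norm_nonneg y, norm_nonneg (y - x), mul_nonneg (norm_nonneg (y - x)) (norm_nonneg y)]

theorem coeff_decay_fst (ħ : ℝ) (γ φ : 𝓢(EuclideanSpace ℝ (Fin n), ℂ)) (N : ℕ) :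
    ∃ C : ℝ, 0 ≤ C ∧ ∀ x ξ, (1 + ‖x‖) ^ N * ‖coeff ħ γ φ x ξ‖ ≤ C := by
  obtain ⟨C, hC, h⟩ := schwartz_decay γ N
  -- N orders of decay absorb the weight; the other n + 1 make the integral over y converge.
  obtain ⟨D, hD, h'⟩ := schwartz_decay φ (N + (n + 1))
  set c := ‖(((2 * Real.pi * ħ) ^ (-((n : ℝ) / 2)) : ℝ) : ℂ)‖
  refine ⟨∫ y : EuclideanSpace ℝ (Fin n), c * C * D * ((1 + ‖y‖) ^ (n + 1))⁻¹,
    integral_nonneg fun y => by positivity, fun x ξ => ?_⟩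
  have hx : 0 ≤ (1 + ‖x‖) ^ N := by positivity
  rw [← Real.norm_of_nonneg hx, ← Complex.norm_real, ← norm_mul, coeff, ← integral_const_mul]
  refine norm_integral_le_of_norm_le ((integrable_inv_one_add_norm_pow n.lt_add_one).const_mul _)
    (ae_of_all _ fun y => ?_)
  rw [phaseShift_apply, norm_mul, norm_mul, norm_mul, norm_mul, mul_comm Complex.I,
    Complex.norm_exp_ofReal_mul_I, mul_one, Complex.norm_real, Real.norm_of_nonneg hx]
  have h1 := h (y - x)
  have h2 := h' y
  have h3 : (1 + ‖x‖) ^ N ≤ (1 + ‖y - x‖) ^ N * (1 + ‖y‖) ^ N := by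
    rw [← mul_pow]
    gcongr
    exact one_add_norm_le_mul x y
  rw [pow_add] at h2
  have hy : 0 < (1 + ‖y‖) ^ (n + 1) := by positivity
  rw [mul_comm] at h2
  have h4 : (1 + ‖y‖) ^ N * ‖φ y‖ ≤ D * ((1 + ‖y‖) ^ (n + 1))⁻¹ := by
    rw [← div_eq_mul_inv, le_div_iff₀ hy]
    linarith
  calc (1 + ‖x‖) ^ N * (c * ‖γ (y - x)‖ * ‖φ y‖)
      ≤ ((1 + ‖y - x‖) ^ N * (1 + ‖y‖) ^ N) * (c * ‖γ (y - x)‖ * ‖φ y‖) := by gcongr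
    _ = c * ((1 + ‖y - x‖) ^ N * ‖γ (y - x)‖) * ((1 + ‖y‖) ^ N * ‖φ y‖) := by ring
    _ ≤ c * C * (D * ((1 + ‖y‖) ^ (n + 1))⁻¹) := by gcongr
    _ = _ := by ring

/-- The coefficient is a Fourier transform of φ times a translate of γ, a family growing
polynomially in x. Decay in ξ therefore comes with a polynomial loss in x, which `coeff_decay`
removes. -/
theorem coeff_decay_snd {ħ : ℝ} (hħ : 0 < ħ) (γ φ : 𝓢(EuclideanSpace ℝ (Fin n), ℂ)) (N : ℕ) :
    ∃ (M : ℕ) (C : ℝ), 0 ≤ C ∧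
      ∀ x ξ, (1 + ‖ξ‖) ^ N * ‖coeff ħ γ φ x ξ‖ ≤ C * (1 + ‖x‖) ^ M := by
  have hb := (((polyBounded_compSubConst γ (a := fun x : EuclideanSpace ℝ (Fin n) => x)
    (fun _ => le_rfl)).comp_clm ((SchwartzMap.smulLeftCLM ℂ φ).restrictScalars ℝ)).comp_clm
      (FourierTransform.fourierCLM ℝ 𝓢(EuclideanSpace ℝ (Fin n), ℂ)))
  obtain ⟨M, C, hC, h⟩ := hb.decay N
  set c := ‖(((2 * Real.pi * ħ) ^ (-((n : ℝ) / 2)) : ℝ) : ℂ)‖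
  set K := 1 + 2 * Real.pi * ħ
  have hK : 0 ≤ K := by positivity
  refine ⟨M, K ^ N * c * C, by positivity, fun x ξ => ?_⟩
  have h0 := h x ((-(2 * Real.pi * ħ)⁻¹) • ξ)
  have e : ‖coeff ħ γ φ x ξ‖ = c * ‖𝓕 (SchwartzMap.smulLeftCLM ℂ φ
      (SchwartzMap.compSubConstCLM ℂ x γ)) ((-(2 * Real.pi * ħ)⁻¹) • ξ)‖ := by
    rw [coeff_eq_fourier, norm_mul]
  have h1 : 1 + ‖ξ‖ ≤ K * (1 + ‖(-(2 * Real.pi * ħ)⁻¹) • ξ‖) := by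
    have hp : 0 < 2 * Real.pi * ħ := by positivity
    rw [norm_smul, norm_neg, Real.norm_of_nonneg (by positivity)]
    have : (1 + 2 * Real.pi * ħ) * (1 + (2 * Real.pi * ħ)⁻¹ * ‖ξ‖) =
      1 + ‖ξ‖ + 2 * Real.pi * ħ + (2 * Real.pi * ħ)⁻¹ * ‖ξ‖ := by
      field_simp
      ring
    rw [this]
    have : 0 ≤ (2 * Real.pi * ħ)⁻¹ * ‖ξ‖ := by positivity
    linarith
  rw [e]
  set X := ‖𝓕 (SchwartzMap.smulLeftCLM ℂ φ
      (SchwartzMap.compSubConstCLM ℂ x γ)) ((-(2 * Real.pi * ħ)⁻¹) • ξ)‖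
  set Y := 1 + ‖(-(2 * Real.pi * ħ)⁻¹) • ξ‖
  calc (1 + ‖ξ‖) ^ N * (c * X)
      ≤ (K * Y) ^ N * (c * X) := by gcongr
    _ = K ^ N * c * (Y ^ N * X) := by rw [mul_pow]; ring
    _ ≤ K ^ N * c * (C * (1 + ‖x‖) ^ M) := mul_le_mul_of_nonneg_left h0 (by positivity)
    _ = _ := by ring

/-- Joint rapid decay of the pairing with phase space shifts. -/
theorem coeff_decay {ħ : ℝ} (hħ : 0 < ħ) (γ φ : 𝓢(EuclideanSpace ℝ (Fin n), ℂ)) (N : ℕ) :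
    ∃ C : ℝ, 0 ≤ C ∧ ∀ x ξ, ‖coeff ħ γ φ x ξ‖ ≤ C * (((1 + ‖x‖) ^ N)⁻¹ * ((1 + ‖ξ‖) ^ N)⁻¹) := by
  obtain ⟨M, C, hC, h⟩ := coeff_decay_snd hħ γ φ (2 * N)
  obtain ⟨D, hD, h'⟩ := coeff_decay_fst ħ γ φ (2 * N + M)
  -- Geometric mean of the two one-sided bounds: their product controls the squared coefficient, and
  -- the extra M orders in x cancel the loss (1+‖x‖)^M.
  refine ⟨Real.sqrt (C * D), Real.sqrt_nonneg _, fun x ξ => ?_⟩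
  rw [← mul_inv, ← div_eq_mul_inv, le_div_iff₀ (by positivity)]
  refine Real.le_sqrt_of_sq_le ?_
  have hx : 0 < (1 + ‖x‖) ^ M := by positivity
  have h1 := mul_le_mul (h x ξ) (h' x ξ) (by positivity) (by positivity)
  refine le_of_mul_le_mul_right ?_ hx
  calc _ = (1 + ‖ξ‖) ^ (2 * N) * ‖coeff ħ γ φ x ξ‖ *
        ((1 + ‖x‖) ^ (2 * N + M) * ‖coeff ħ γ φ x ξ‖) := by ring
    _ ≤ _ := h1
    _ = _ := by ring

theorem coeff_eq_apply (ħ : ℝ) (γ φ : 𝓢(EuclideanSpace ℝ (Fin n), ℂ))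
    (x ξ : EuclideanSpace ℝ (Fin n)) :
    coeff ħ γ φ x ξ = SchwartzMap.integralCLM ℂ volume
      (SchwartzMap.smulLeftCLM ℂ φ (phaseShift ħ x ξ γ)) := by
  rw [SchwartzMap.integralCLM_apply, coeff]
  congr 1
  ext y
  rw [SchwartzMap.smulLeftCLM_apply_apply φ.hasTemperateGrowth, smul_eq_mul, mul_comm]

theorem continuous_coeff (ħ : ℝ) (γ φ : 𝓢(EuclideanSpace ℝ (Fin n), ℂ)) :
    Continuous fun z : EuclideanSpace ℝ (Fin n) × EuclideanSpace ℝ (Fin n) =>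
      coeff ħ γ φ z.1 z.2 := by
  simp_rw [coeff_eq_apply]
  exact ((SchwartzMap.integralCLM ℂ volume).continuous.comp
    (SchwartzMap.smulLeftCLM ℂ φ).continuous).comp (continuous_phaseShift ħ γ)

theorem integrable_prod_weight {N : ℕ} (hN : n < N) :
    Integrable (fun z : EuclideanSpace ℝ (Fin n) × EuclideanSpace ℝ (Fin n) =>
      ((1 + ‖z.1‖) ^ N)⁻¹ * ((1 + ‖z.2‖) ^ N)⁻¹) (volume.prod volume) :=
  (integrable_inv_one_add_norm_pow hN).mul_prod (integrable_inv_one_add_norm_pow hN)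

/-- The coefficients beat the polynomial growth of every seminorm of the phase space shifts, as the
interchange in `inversion` requires. -/
theorem integrable_coeff_mul_pow {ħ : ℝ} (hħ : 0 < ħ) (γ φ : 𝓢(EuclideanSpace ℝ (Fin n), ℂ))
    (M : ℕ) :
    Integrable (fun z : EuclideanSpace ℝ (Fin n) × EuclideanSpace ℝ (Fin n) =>
      ‖coeff ħ γ φ z.1 z.2‖ * (1 + ‖z‖) ^ M) (volume.prod volume) := by
  obtain ⟨C, hC, h⟩ := coeff_decay hħ γ φ (M + (n + 1))
  refine ((integrable_prod_weight n.lt_add_one).const_mul C).mono'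
    (((continuous_coeff ħ γ φ).norm.mul (by fun_prop)).aestronglyMeasurable)
    (ae_of_all _ fun z => ?_)
  rw [Real.norm_of_nonneg (by positivity)]
  have h1 : 1 + ‖z‖ ≤ (1 + ‖z.1‖) * (1 + ‖z.2‖) := by
    rcases max_choice ‖z.1‖ ‖z.2‖ with h | h <;> rw [Prod.norm_def, h] <;>
      nlinarith [norm_nonneg z.1, norm_nonneg z.2, mul_nonneg (norm_nonneg z.1) (norm_nonneg z.2)]
  calc ‖coeff ħ γ φ z.1 z.2‖ * (1 + ‖z‖) ^ M
      ≤ (C * (((1 + ‖z.1‖) ^ (M + (n + 1)))⁻¹ * ((1 + ‖z.2‖) ^ (M + (n + 1)))⁻¹)) *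
        ((1 + ‖z.1‖) * (1 + ‖z.2‖)) ^ M := by
        gcongr
        exact h z.1 z.2
    _ = _ := by
      have a1 : (1 + ‖z.1‖) ≠ 0 := by positivity
      have a2 : (1 + ‖z.2‖) ≠ 0 := by positivity
      rw [pow_add (1 + ‖z.1‖), pow_add (1 + ‖z.2‖), mul_pow]
      field_simp

theorem integrable_coeff {ħ : ℝ} (hħ : 0 < ħ) (γ φ : 𝓢(EuclideanSpace ℝ (Fin n), ℂ)) :
    Integrable (fun z : EuclideanSpace ℝ (Fin n) × EuclideanSpace ℝ (Fin n) =>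
      coeff ħ γ φ z.1 z.2) (volume.prod volume) := by
  have h := integrable_coeff_mul_pow hħ γ φ 0
  simp only [pow_zero, mul_one] at h
  exact (integrable_norm_iff (continuous_coeff ħ γ φ).aestronglyMeasurable).1 h

/-! ### The inversion formula -/

theorem rpow_neg_half_sq {ħ : ℝ} (hħ : 0 < ħ) (n : ℕ) :
    ((2 * Real.pi * ħ) ^ (-((n : ℝ) / 2)) : ℝ) * (2 * Real.pi * ħ) ^ (-((n : ℝ) / 2)) =
      ((2 * Real.pi * ħ) ^ n)⁻¹ := by
  have hp : 0 < 2 * Real.pi * ħ := by positivity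
  rw [← Real.rpow_add hp, ← Real.rpow_natCast, ← Real.rpow_neg hp.le]
  congr 1
  ring

/-- Fourier inversion in the frequency variable. -/
theorem integral_coeff_mul_conj {ħ : ℝ} (hħ : 0 < ħ) (g γ φ : 𝓢(EuclideanSpace ℝ (Fin n), ℂ))
    (x y : EuclideanSpace ℝ (Fin n)) :
    ∫ ξ, coeff ħ γ φ x ξ * conjS (phaseShift ħ x ξ g) y =
      (γ (y - x) * starRingEnd ℂ (g (y - x))) * φ y := by
  set h := SchwartzMap.smulLeftCLM ℂ φ (SchwartzMap.compSubConstCLM ℂ x γ) with hh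
  have hp : 0 < 2 * Real.pi * ħ := by positivity
  have e : ∀ ξ, coeff ħ γ φ x ξ * conjS (phaseShift ħ x ξ g) y =
      ((((2 * Real.pi * ħ) ^ n)⁻¹ : ℝ) : ℂ) * starRingEnd ℂ (g (y - x)) *
        (fun w => Complex.exp (((-2 * Real.pi * inner ℝ w y : ℝ) : ℂ) * Complex.I) • 𝓕 h (-w))
          ((2 * Real.pi * ħ)⁻¹ • ξ) := by
    intro ξ
    rw [coeff_eq_fourier, conjS_apply, phaseShift_apply, ← rpow_neg_half_sq hħ, map_mul, map_mul,
      Complex.conj_ofReal, ← Complex.exp_conj, map_mul, Complex.conj_I, Complex.conj_ofReal,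
      Complex.ofReal_mul, ← hh]
    simp only [neg_smul, smul_eq_mul]
    have e2 : -Complex.I * ((inner ℝ ξ y / ħ : ℝ) : ℂ) =
        ((-2 * Real.pi * inner ℝ ((2 * Real.pi * ħ)⁻¹ • ξ) y : ℝ) : ℂ) * Complex.I := by
      rw [inner_smul_left, neg_mul, mul_comm, ← neg_mul, ← Complex.ofReal_neg]
      congr 2
      have hp : Real.pi ≠ 0 := Real.pi_ne_zero
      simp only [conj_trivial]
      field_simp
    rw [e2]
    ring
  simp_rw [e]
  -- The Jacobian (2πħ)^n of the rescaled frequency cancels the two normalizing factors of the phase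
  -- space shifts.
  rw [integral_const_mul, Measure.integral_comp_inv_smul_of_nonneg volume
    (fun w => Complex.exp (((-2 * Real.pi * inner ℝ w y : ℝ) : ℂ) * Complex.I) • 𝓕 h (-w)) hp.le,
    ← integral_neg_eq_self]
  simp only [inner_neg_left, neg_neg, mul_neg, neg_mul, finrank_euclideanSpace, Fintype.card_fin]
  have hinv : ∫ w, Complex.exp (((2 * Real.pi * inner ℝ w y : ℝ) : ℂ) * Complex.I) • 𝓕 h w =
      h y := by
    conv_rhs => rw [← FourierTransform.fourierInv_fourier_eq
      (F := 𝓢(EuclideanSpace ℝ (Fin n), ℂ)) h]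
    rw [SchwartzMap.fourierInv_coe, Real.fourierInv_eq']
  rw [hinv, hh, SchwartzMap.smulLeftCLM_apply_apply φ.hasTemperateGrowth,
    SchwartzMap.compSubConstCLM_apply, Complex.real_smul, smul_eq_mul]
  push_cast
  have hp' : (2 * (Real.pi : ℂ) * (ħ : ℂ)) ^ n ≠ 0 := by
    have : (((2 * Real.pi * ħ) ^ n : ℝ) : ℂ) ≠ 0 := Complex.ofReal_ne_zero.2 (by positivity)
    simpa using this
  field_simp

/-- The inversion formula of the Gabor transform of a tempered distribution. -/
theorem inversion {ħ : ℝ} (hħ : 0 < ħ) (f : 𝓢'(EuclideanSpace ℝ (Fin n), ℂ))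
    (g γ φ : 𝓢(EuclideanSpace ℝ (Fin n), ℂ)) :
    innerS γ g * f φ = ∫ z : EuclideanSpace ℝ (Fin n) × EuclideanSpace ℝ (Fin n),
      stft ħ g f z.1 z.2 * coeff ħ γ φ z.1 z.2 ∂(volume.prod volume) := by
  -- The formula is first proved pointwise for test functions, with ⟨γ,g⟩φ as the superposition of
  -- these shifts; `apply_eq_integral` then carries `f` inside.
  set Φ : EuclideanSpace ℝ (Fin n) × EuclideanSpace ℝ (Fin n) → 𝓢(EuclideanSpace ℝ (Fin n), ℂ) :=
    fun z => coeff ħ γ φ z.1 z.2 • conjS (phaseShift ħ z.1 z.2 g) with hΦ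
  have hc : Continuous Φ := (continuous_coeff ħ γ φ).smul (continuous_conjS_phaseShift ħ g)
  have hs : ∀ k m z, SchwartzMap.seminorm ℝ k m (Φ z) =
      ‖coeff ħ γ φ z.1 z.2‖ * SchwartzMap.seminorm ℝ k m (conjS (phaseShift ħ z.1 z.2 g)) := by
    intro k m z
    exact map_smul_eq_mul (SchwartzMap.seminorm ℂ k m : Seminorm ℂ 𝓢(EuclideanSpace ℝ (Fin n), ℂ))
      _ _
  have hi : ∀ k m, Integrable (fun z => SchwartzMap.seminorm ℝ k m (Φ z))
      ((volume : Measure (EuclideanSpace ℝ (Fin n))).prod volume) := by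
    intro k m
    obtain ⟨N, C, hC, h⟩ := polyBounded_conjS_phaseShift ħ g k m
    refine ((integrable_coeff_mul_pow hħ γ φ N).const_mul C).mono'
      ((continuous_seminorm k m).comp hc).aestronglyMeasurable (ae_of_all _ fun z => ?_)
    rw [Real.norm_of_nonneg (apply_nonneg _ _), hs]
    calc _ ≤ ‖coeff ħ γ φ z.1 z.2‖ * (C * (1 + ‖z‖) ^ N) := by gcongr; exact h z
      _ = _ := by ring
  have key : f (innerS γ g • φ) = ∫ z, f (Φ z) ∂(volume.prod volume) := apply_eq_integral (f : 𝓢(EuclideanSpace ℝ (Fin n), ℂ) →L[ℂ] ℂ) Φ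
    (innerS γ g • φ) hc hi (fun y => ?_)
  · have hsm : ∀ (c : ℂ) (χ : 𝓢(EuclideanSpace ℝ (Fin n), ℂ)), f (c • χ) = c * f χ := fun c χ =>
      (f : 𝓢(EuclideanSpace ℝ (Fin n), ℂ) →L[ℂ] ℂ).map_smul c χ
    rw [hsm] at key
    refine key.trans (integral_congr_ae (ae_of_all _ fun z => ?_))
    simp only [hΦ, hsm, stft]
    exact mul_comm _ _
  · have hint : Integrable (fun z => Φ z y)
        ((volume : Measure (EuclideanSpace ℝ (Fin n))).prod volume) := by
      refine (hi 0 0).mono' ?_ (ae_of_all _ fun z => SchwartzMap.norm_le_seminorm ℝ (Φ z) y)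
      exact (((BoundedContinuousFunction.evalCLM ℝ y).continuous.comp
        (SchwartzMap.toBoundedContinuousFunctionCLM ℝ _ ℂ).continuous).comp
          hc).aestronglyMeasurable
    -- The ξ-integral is Fourier inversion; the remaining x-integral of translates is ⟨γ,g⟩.
    rw [integral_prod _ hint]
    have e : ∀ x, ∫ ξ, Φ (x, ξ) y = (γ (y - x) * starRingEnd ℂ (g (y - x))) * φ y :=
      fun x => integral_coeff_mul_conj hħ g γ φ x y
    simp_rw [e]
    rw [integral_mul_const, integral_sub_left_eq_self (fun t => γ t * starRingEnd ℂ (g t))]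
    rfl

end Sjostrand

/-! ### The norm of M^{∞,1} as an integral of suprema -/

namespace Sjostrand

open scoped FourierTransform

variable {n : ℕ}

/-- Nonempty superlevel sets of a continuous function are open, hence of positive measure. -/
theorem eLpNorm_top_eq_iSup {h : EuclideanSpace ℝ (Fin n) → ℂ} (hh : Continuous h) :
    eLpNorm h ∞ volume = ⨆ x, ‖h x‖ₑ := by
  rw [eLpNorm_exponent_top, eLpNormEssSup]
  refine (iSup_eq_essSup fun x a ha => ?_).symm
  exact ((isOpen_lt continuous_const hh.enorm).measure_pos volume ⟨x, ha⟩).ne'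

theorem continuous_stft_left (ħ : ℝ) (g : 𝓢(EuclideanSpace ℝ (Fin n), ℂ))
    (f : 𝓢'(EuclideanSpace ℝ (Fin n), ℂ)) (ξ : EuclideanSpace ℝ (Fin n)) :
    Continuous fun x => stft ħ g f x ξ :=
  (continuous_stft ħ g f).comp (f := fun x => (x, ξ)) (continuous_id.prodMk continuous_const)

theorem continuous_stft_right (ħ : ℝ) (g : 𝓢(EuclideanSpace ℝ (Fin n), ℂ))
    (f : 𝓢'(EuclideanSpace ℝ (Fin n), ℂ)) (x : EuclideanSpace ℝ (Fin n)) :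
    Continuous fun ξ => stft ħ g f x ξ :=
  (continuous_stft ħ g f).comp (f := fun ξ => (x, ξ)) (continuous_const.prodMk continuous_id)

/-- The supremum of the Gabor transform over all positions. -/
noncomputable def supStft (ħ : ℝ) (g : 𝓢(EuclideanSpace ℝ (Fin n), ℂ))
    (f : 𝓢'(EuclideanSpace ℝ (Fin n), ℂ)) (ξ : EuclideanSpace ℝ (Fin n)) : ℝ≥0∞ :=
  ⨆ x, ‖stft ħ g f x ξ‖ₑ

theorem enorm_stft_le_supStft (ħ : ℝ) (g : 𝓢(EuclideanSpace ℝ (Fin n), ℂ))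
    (f : 𝓢'(EuclideanSpace ℝ (Fin n), ℂ)) (x ξ : EuclideanSpace ℝ (Fin n)) :
    ‖stft ħ g f x ξ‖ₑ ≤ supStft ħ g f ξ :=
  le_iSup (fun x => ‖stft ħ g f x ξ‖ₑ) x

/-- The supremum is uncountable; measurability comes from lower semicontinuity of a supremum of
continuous functions. -/
theorem measurable_supStft (ħ : ℝ) (g : 𝓢(EuclideanSpace ℝ (Fin n), ℂ))
    (f : 𝓢'(EuclideanSpace ℝ (Fin n), ℂ)) : Measurable (supStft ħ g f) := by
  refine LowerSemicontinuous.measurable ?_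
  refine lowerSemicontinuous_iSup fun x => Continuous.lowerSemicontinuous ?_
  exact (continuous_stft_right ħ g f x).enorm

theorem modNorm_top_one (ħ : ℝ) (g : 𝓢(EuclideanSpace ℝ (Fin n), ℂ))
    (f : 𝓢'(EuclideanSpace ℝ (Fin n), ℂ)) :
    modNorm ħ ∞ 1 g f = ∫⁻ ξ, supStft ħ g f ξ := by
  have h : ∀ ξ, eLpNorm (fun x => stft ħ g f x ξ) ∞ volume = supStft ħ g f ξ := fun ξ =>
    eLpNorm_top_eq_iSup (continuous_stft_left ħ g f ξ)
  rw [modNorm, eLpNorm_one_eq_lintegral_enorm]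
  simp_rw [h, enorm_eq_self]

/-- Tonelli bound for the product of a function of the frequency with a kernel that is integrable
in the position, uniformly in the frequency. -/
theorem lintegral_mul_kernel_le {H : EuclideanSpace ℝ (Fin n) → ℝ≥0∞} (hH : Measurable H)
    {b : EuclideanSpace ℝ (Fin n) × EuclideanSpace ℝ (Fin n) → ℝ≥0∞} (hb : Measurable b)
    {C : ℝ≥0∞} (hC : ∀ ξ, ∫⁻ x, b (x, ξ) ≤ C) :
    ∫⁻ z, H z.2 * b z ∂(volume.prod volume) ≤ C * ∫⁻ ξ, H ξ := by
  rw [lintegral_prod_symm' (fun z => H z.2 * b z) ((hH.comp measurable_snd).mul hb), ← lintegral_const_mul _ hH]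
  refine lintegral_mono fun ξ => ?_
  simp only
  have h1 : Measurable fun x => b (x, ξ) :=
    hb.comp (f := fun x => (x, ξ)) (measurable_id.prodMk measurable_const)
  rw [lintegral_const_mul _ h1, mul_comm]
  gcongr
  exact hC ξ

/-- The estimate that pairs the Gabor transform with a kernel. -/
theorem enorm_integral_stft_mul_le (ħ : ℝ) (g : 𝓢(EuclideanSpace ℝ (Fin n), ℂ))
    (f : 𝓢'(EuclideanSpace ℝ (Fin n), ℂ))
    {c : EuclideanSpace ℝ (Fin n) × EuclideanSpace ℝ (Fin n) → ℂ} :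
    ‖∫ z, stft ħ g f z.1 z.2 * c z ∂(volume.prod volume)‖ₑ ≤
      ∫⁻ z, supStft ħ g f z.2 * ‖c z‖ₑ ∂(volume.prod volume) := by
  refine (enorm_integral_le_lintegral_enorm _).trans (lintegral_mono fun z => ?_)
  simp only
  rw [enorm_mul]
  gcongr
  exact enorm_stft_le_supStft ħ g f z.1 z.2

/-! ### Change of window -/

theorem innerS_self_ne_zero {g : 𝓢(EuclideanSpace ℝ (Fin n), ℂ)} (hg : g ≠ 0) :
    innerS g g ≠ 0 := by
  have e : innerS g g = ((∫ y, ‖g y‖ ^ 2 : ℝ) : ℂ) := by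
    rw [innerS, ← integral_complex_ofReal]
    congr 1
    ext y
    rw [Complex.mul_conj, Complex.normSq_eq_norm_sq]
  rw [e, Complex.ofReal_ne_zero]
  have hint : Integrable fun y => ‖g y‖ ^ 2 := by
    have := (g.memLp 2 volume).integrable_norm_pow (by norm_num)
    simpa using this
  obtain ⟨y, hy⟩ : ∃ y, g y ≠ 0 := by
    by_contra! h
    exact hg (SchwartzMap.ext h)
  exact (integral_pos_of_integrable_nonneg_nonzero (x := y) (g.continuous.norm.pow 2) hint
    (fun y => sq_nonneg ‖g y‖) (pow_ne_zero 2 (norm_ne_zero_iff.2 hy))).ne'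

/-- Covariance of the pairing under phase space shifts of both windows. -/
theorem norm_coeff_conjS_phaseShift (ħ : ℝ) (γ θ : 𝓢(EuclideanSpace ℝ (Fin n), ℂ))
    (x ξ x' ξ' : EuclideanSpace ℝ (Fin n)) :
    ‖coeff ħ γ (conjS (phaseShift ħ x' ξ' θ)) x ξ‖ =
      ‖(((2 * Real.pi * ħ) ^ (-((n : ℝ) / 2)) : ℝ) : ℂ)‖ *
        ‖coeff ħ γ (conjS θ) (x - x') (ξ - ξ')‖ := by
  have e : coeff ħ γ (conjS (phaseShift ħ x' ξ' θ)) x ξ =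
      (((2 * Real.pi * ħ) ^ (-((n : ℝ) / 2)) : ℝ) : ℂ) *
        Complex.exp (((inner ℝ (ξ - ξ') x' / ħ : ℝ) : ℂ) * Complex.I) *
        coeff ħ γ (conjS θ) (x - x') (ξ - ξ') := by
    rw [coeff, coeff, ← integral_add_right_eq_self _ x', ← integral_const_mul]
    congr 1
    ext y
    simp only [phaseShift_apply, conjS_apply, map_mul, Complex.conj_ofReal, ← Complex.exp_conj,
      Complex.conj_I]
    have h1 : y + x' - x = y - (x - x') := by abel
    have h2 : y + x' - x' = y := by abel
    have h3 : Complex.exp (Complex.I * ((inner ℝ ξ (y + x') / ħ : ℝ) : ℂ)) *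
        Complex.exp (-Complex.I * ((inner ℝ ξ' (y + x') / ħ : ℝ) : ℂ)) =
        Complex.exp (((inner ℝ (ξ - ξ') x' / ħ : ℝ) : ℂ) * Complex.I) *
        Complex.exp (Complex.I * ((inner ℝ (ξ - ξ') y / ħ : ℝ) : ℂ)) := by
      rw [← Complex.exp_add, ← Complex.exp_add, inner_sub_left, inner_sub_left, inner_add_right,
        inner_add_right]
      congr 1
      push_cast
      ring
    rw [h1, h2]
    linear_combination ((((2 * Real.pi * ħ) ^ (-((n : ℝ) / 2)) : ℝ) : ℂ) ^ 2 *
      γ (y - (x - x')) * starRingEnd ℂ (θ y)) * h3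
  rw [e, norm_mul, norm_mul, Complex.norm_exp_ofReal_mul_I, mul_one]

/-- If the norm of `f` is finite for some nonzero window, it is finite for every window. -/
theorem modNorm_lt_top_of_window {ħ : ℝ} (hħ : 0 < ħ) {g : 𝓢(EuclideanSpace ℝ (Fin n), ℂ)}
    (hg : g ≠ 0) {f : 𝓢'(EuclideanSpace ℝ (Fin n), ℂ)} (hf : modNorm ħ ∞ 1 g f < ∞)
    (θ : 𝓢(EuclideanSpace ℝ (Fin n), ℂ)) : modNorm ħ ∞ 1 θ f < ∞ := by
  rw [modNorm_top_one] at hf ⊢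
  set c : ℂ := (((2 * Real.pi * ħ) ^ (-((n : ℝ) / 2)) : ℝ) : ℂ)
  have hmG : Measurable fun z : EuclideanSpace ℝ (Fin n) × EuclideanSpace ℝ (Fin n) =>
      ‖coeff ħ g (conjS θ) z.1 z.2‖ₑ := (continuous_coeff ħ g (conjS θ)).enorm.measurable
  set G : EuclideanSpace ℝ (Fin n) → ℝ≥0∞ := fun ζ => ∫⁻ x, ‖coeff ħ g (conjS θ) x ζ‖ₑ with hG
  have hGm : Measurable G := hmG.lintegral_prod_left'
  have hGfin : ∫⁻ ζ, G ζ < ∞ := by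
    have := (integrable_coeff hħ g (conjS θ)).hasFiniteIntegral
    rwa [HasFiniteIntegral, lintegral_prod_symm' _ hmG] at this
  have hin : ‖innerS g g‖ₑ ≠ 0 := by simpa using innerS_self_ne_zero hg
  -- Inversion applied to the conjugate of π(x',ξ')θ bounds V_θ f by a convolution in frequency,
  -- uniformly in x', because the coefficients depend in modulus only on differences.
  have key : ∀ ξ', ‖innerS g g‖ₑ * supStft ħ θ f ξ' ≤
      ‖c‖ₑ * ∫⁻ ξ, supStft ħ g f ξ * G (ξ - ξ') := by
    intro ξ'
    rw [supStft, ENNReal.mul_iSup]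
    refine iSup_le fun x' => ?_
    rw [← enorm_mul, stft, inversion hħ f g g]
    refine (enorm_integral_stft_mul_le ħ g f).trans ?_
    have e : ∀ z : EuclideanSpace ℝ (Fin n) × EuclideanSpace ℝ (Fin n),
        ‖coeff ħ g (conjS (phaseShift ħ x' ξ' θ)) z.1 z.2‖ₑ =
        ‖c‖ₑ * ‖coeff ħ g (conjS θ) (z.1 - x') (z.2 - ξ')‖ₑ := by
      intro z
      rw [← enorm_mul, ← ofReal_norm, ← ofReal_norm, norm_coeff_conjS_phaseShift, norm_mul]
    have hm2 : Measurable fun z : EuclideanSpace ℝ (Fin n) × EuclideanSpace ℝ (Fin n) =>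
        ‖coeff ħ g (conjS θ) (z.1 - x') (z.2 - ξ')‖ₑ :=
      hmG.comp (f := fun z : EuclideanSpace ℝ (Fin n) × EuclideanSpace ℝ (Fin n) =>
        (z.1 - x', z.2 - ξ')) ((measurable_fst.sub_const x').prodMk (measurable_snd.sub_const ξ'))
    have hm3 : Measurable fun z : EuclideanSpace ℝ (Fin n) × EuclideanSpace ℝ (Fin n) =>
        supStft ħ g f z.2 * (‖c‖ₑ * ‖coeff ħ g (conjS θ) (z.1 - x') (z.2 - ξ')‖ₑ) :=
      ((measurable_supStft ħ g f).comp measurable_snd).mul (hm2.const_mul _)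
    simp_rw [e]
    have hm6 : Measurable fun ξ => supStft ħ g f ξ * G (ξ - ξ') :=
      (measurable_supStft ħ g f).mul (hGm.comp (measurable_id.sub_const ξ'))
    rw [lintegral_prod_symm' _ hm3, ← lintegral_const_mul _ hm6]
    refine le_of_eq (lintegral_congr fun ξ => ?_)
    have hm4 : Measurable fun x => ‖coeff ħ g (conjS θ) (x - x') (ξ - ξ')‖ₑ :=
      hm2.comp (f := fun x => (x, ξ)) (measurable_id.prodMk measurable_const)
    simp only
    rw [lintegral_const_mul _ (hm4.const_mul _), lintegral_const_mul _ hm4,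
      lintegral_sub_right_eq_self (fun x => ‖coeff ħ g (conjS θ) x (ξ - ξ')‖ₑ)]
    simp only [hG]
    ring
  -- Young's inequality for L¹ ∗ L¹, by Tonelli.
  have hle : ‖innerS g g‖ₑ * ∫⁻ ξ', supStft ħ θ f ξ' ≤
      ‖c‖ₑ * ((∫⁻ ξ, supStft ħ g f ξ) * ∫⁻ ζ, G ζ) := by
    have hm5 : Measurable fun z : EuclideanSpace ℝ (Fin n) × EuclideanSpace ℝ (Fin n) =>
        supStft ħ g f z.2 * G (z.2 - z.1) :=
      ((measurable_supStft ħ g f).comp measurable_snd).mul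
        (hGm.comp (measurable_snd.sub measurable_fst))
    calc ‖innerS g g‖ₑ * ∫⁻ ξ', supStft ħ θ f ξ'
        = ∫⁻ ξ', ‖innerS g g‖ₑ * supStft ħ θ f ξ' :=
          (lintegral_const_mul _ (measurable_supStft ħ θ f)).symm
      _ ≤ ∫⁻ ξ', ‖c‖ₑ * ∫⁻ ξ, supStft ħ g f ξ * G (ξ - ξ') := lintegral_mono key
      _ = ‖c‖ₑ * ∫⁻ ξ', ∫⁻ ξ, supStft ħ g f ξ * G (ξ - ξ') :=
          lintegral_const_mul _ hm5.lintegral_prod_right'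
      _ = ‖c‖ₑ * ∫⁻ ξ, ∫⁻ ξ', supStft ħ g f ξ * G (ξ - ξ') := by
          rw [lintegral_lintegral_swap hm5.aemeasurable]
      _ = _ := by
          congr 1
          rw [← lintegral_mul_const _ (measurable_supStft ħ g f)]
          refine lintegral_congr fun ξ => ?_
          have hm7 : Measurable fun ξ' => G (ξ - ξ') :=
            hGm.comp (measurable_const.sub measurable_id)
          rw [lintegral_const_mul _ hm7, lintegral_sub_left_eq_self]
  have hfin : ‖innerS g g‖ₑ * ∫⁻ ξ', supStft ħ θ f ξ' < ∞ :=
    hle.trans_lt (ENNReal.mul_lt_top enorm_lt_top (ENNReal.mul_lt_top hf hGfin))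
  by_contra h
  rw [not_lt, top_le_iff] at h
  rw [h, ENNReal.mul_top hin] at hfin
  exact lt_irrefl _ hfin

/-! ### The modulation space is a linear space -/

theorem gaussWindow_ne_zero {ħ : ℝ} (hħ : 0 < ħ) {q : Fin n → ℝ} (hq : ∀ j, 0 < q j) :
    gaussWindow hħ hq ≠ 0 := by
  intro h
  have h1 := gaussWindow_apply hħ hq 0
  rw [h] at h1
  have h2 : 0 < (2 * Real.pi * ħ) ^ (-((n : ℝ) / 2)) := Real.rpow_pos_of_pos (by positivity) _
  refine (mul_ne_zero (Complex.ofReal_ne_zero.2 h2.ne')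
    (Complex.ofReal_ne_zero.2 (Real.exp_pos _).ne')) h1.symm

theorem mem_modSpace_iff {ħ : ℝ} (hħ : 0 < ħ) {g : 𝓢(EuclideanSpace ℝ (Fin n), ℂ)} (hg : g ≠ 0)
    {f : 𝓢'(EuclideanSpace ℝ (Fin n), ℂ)} :
    f ∈ modSpace ħ n ∞ 1 ↔ modNorm ħ ∞ 1 g f < ∞ :=
  ⟨fun ⟨_, hg', hf⟩ => modNorm_lt_top_of_window hħ hg' hf g, fun h => ⟨g, hg, h⟩⟩

theorem stft_add_smul (ħ : ℝ) (g : 𝓢(EuclideanSpace ℝ (Fin n), ℂ))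
    (f h : 𝓢'(EuclideanSpace ℝ (Fin n), ℂ)) (a b : ℂ) (x ξ : EuclideanSpace ℝ (Fin n)) :
    stft ħ g (a • f + b • h) x ξ = a * stft ħ g f x ξ + b * stft ħ g h x ξ := rfl

theorem modNorm_add_smul_le (ħ : ℝ) (g : 𝓢(EuclideanSpace ℝ (Fin n), ℂ))
    (f h : 𝓢'(EuclideanSpace ℝ (Fin n), ℂ)) (a b : ℂ) :
    modNorm ħ ∞ 1 g (a • f + b • h) ≤ ‖a‖ₑ * modNorm ħ ∞ 1 g f + ‖b‖ₑ * modNorm ħ ∞ 1 g h := by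
  simp only [modNorm_top_one]
  rw [← lintegral_const_mul _ (measurable_supStft ħ g f),
    ← lintegral_const_mul _ (measurable_supStft ħ g h),
    ← lintegral_add_left ((measurable_supStft ħ g f).const_mul _)]
  refine lintegral_mono fun ξ => iSup_le fun x => ?_
  rw [stft_add_smul]
  refine (enorm_add_le _ _).trans ?_
  rw [enorm_mul, enorm_mul]
  gcongr
  · exact enorm_stft_le_supStft ħ g f x ξ
  · exact enorm_stft_le_supStft ħ g h x ξ

/-- The two memberships may come with different windows; window independence lets one window serve
both. -/
theorem add_smul_mem_modSpace {ħ : ℝ} (hħ : 0 < ħ) {f h : 𝓢'(EuclideanSpace ℝ (Fin n), ℂ)}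
    (hf : f ∈ modSpace ħ n ∞ 1) (hh : h ∈ modSpace ħ n ∞ 1) (a b : ℂ) :
    a • f + b • h ∈ modSpace ħ n ∞ 1 := by
  obtain ⟨g, hg, hgf⟩ := hf
  exact ⟨g, hg, (modNorm_add_smul_le ħ g f h a b).trans_lt (ENNReal.add_lt_top.2
    ⟨ENNReal.mul_lt_top enorm_lt_top hgf,
      ENNReal.mul_lt_top enorm_lt_top ((mem_modSpace_iff hħ hg).1 hh)⟩)⟩

end Sjostrand

namespace Sjostrand

open scoped FourierTransform

variable {n : ℕ}

/-- Dominated convergence with a dominating function with values in `[0,∞]`. -/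
theorem tendsto_integral_of_enorm_le {X ι : Type*} [MeasurableSpace X] {μ : Measure X}
    {l : Filter ι} [l.IsCountablyGenerated] {F : ι → X → ℂ} {G : X → ℂ}
    (hF : ∀ᶠ i in l, AEStronglyMeasurable (F i) μ) {B : X → ℝ≥0∞} (hBm : Measurable B)
    (hB : ∫⁻ z, B z ∂μ ≠ ∞) (h : ∀ᶠ i in l, ∀ z, ‖F i z‖ₑ ≤ B z)
    (hl : ∀ z, Tendsto (fun i => F i z) l (𝓝 (G z))) :
    Tendsto (fun i => ∫ z, F i z ∂μ) l (𝓝 (∫ z, G z ∂μ)) := by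
  refine tendsto_integral_filter_of_dominated_convergence (fun z => (B z).toReal) hF ?_
    (integrable_toReal_of_lintegral_ne_top hBm.aemeasurable hB) (ae_of_all _ hl)
  filter_upwards [h] with i hi
  -- The majorant may be infinite on a null set; `toReal` is faithful off it.
  filter_upwards [ae_lt_top hBm hB] with z hz
  have := ENNReal.toReal_mono hz.ne (hi z)
  rwa [toReal_enorm] at this

/-! ### Elements of the modulation space are bounded continuous functions -/

theorem continuous_phaseShift_apply (ħ : ℝ) (γ : 𝓢(EuclideanSpace ℝ (Fin n), ℂ)) :
    Continuous fun p : (EuclideanSpace ℝ (Fin n) × EuclideanSpace ℝ (Fin n)) ×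
      EuclideanSpace ℝ (Fin n) => phaseShift ħ p.1.1 p.1.2 γ p.2 := by
  simp_rw [phaseShift_apply]
  have h1 : Continuous fun p : (EuclideanSpace ℝ (Fin n) × EuclideanSpace ℝ (Fin n)) ×
      EuclideanSpace ℝ (Fin n) => inner ℝ p.1.2 p.2 / ħ :=
    ((continuous_snd.comp continuous_fst).inner continuous_snd).div_const ħ
  have h2 : Continuous fun p : (EuclideanSpace ℝ (Fin n) × EuclideanSpace ℝ (Fin n)) ×
      EuclideanSpace ℝ (Fin n) => γ (p.2 - p.1.1) :=
    γ.continuous.comp (f := fun p : (EuclideanSpace ℝ (Fin n) × EuclideanSpace ℝ (Fin n)) ×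
      EuclideanSpace ℝ (Fin n) => p.2 - p.1.1) (by fun_prop)
  exact (continuous_const.mul (Complex.continuous_exp.comp
    (continuous_const.mul (Complex.continuous_ofReal.comp h1)))).mul h2

theorem norm_phaseShift_apply (ħ : ℝ) (γ : 𝓢(EuclideanSpace ℝ (Fin n), ℂ))
    (x ξ y : EuclideanSpace ℝ (Fin n)) :
    ‖phaseShift ħ x ξ γ y‖ =
      ‖(((2 * Real.pi * ħ) ^ (-((n : ℝ) / 2)) : ℝ) : ℂ)‖ * ‖γ (y - x)‖ := by
  rw [phaseShift_apply, norm_mul, norm_mul, mul_comm Complex.I, Complex.norm_exp_ofReal_mul_I,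
    mul_one]

theorem continuous_phaseShift_apply_left (ħ : ℝ) (γ : 𝓢(EuclideanSpace ℝ (Fin n), ℂ))
    (y : EuclideanSpace ℝ (Fin n)) :
    Continuous fun z : EuclideanSpace ℝ (Fin n) × EuclideanSpace ℝ (Fin n) =>
      phaseShift ħ z.1 z.2 γ y :=
  (continuous_phaseShift_apply ħ γ).comp (f := fun z => (z, y))
    (continuous_id.prodMk continuous_const)

/-- The constant `(2πħ)^{-n/2} ‖γ‖_{L¹}`. -/
noncomputable def windowMass (ħ : ℝ) (γ : 𝓢(EuclideanSpace ℝ (Fin n), ℂ)) : ℝ≥0∞ :=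
  ‖(((2 * Real.pi * ħ) ^ (-((n : ℝ) / 2)) : ℝ) : ℂ)‖ₑ * ∫⁻ y, ‖γ y‖ₑ

theorem windowMass_lt_top (ħ : ℝ) (γ : 𝓢(EuclideanSpace ℝ (Fin n), ℂ)) : windowMass ħ γ < ∞ :=
  ENNReal.mul_lt_top enorm_lt_top (γ.integrable (μ := volume)).hasFiniteIntegral

theorem lintegral_enorm_phaseShift (ħ : ℝ) (γ : 𝓢(EuclideanSpace ℝ (Fin n), ℂ))
    (ξ y : EuclideanSpace ℝ (Fin n)) : ∫⁻ x, ‖phaseShift ħ x ξ γ y‖ₑ = windowMass ħ γ := by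
  have e : ∀ x, ‖phaseShift ħ x ξ γ y‖ₑ =
      ‖(((2 * Real.pi * ħ) ^ (-((n : ℝ) / 2)) : ℝ) : ℂ)‖ₑ * ‖γ (y - x)‖ₑ := fun x => by
    rw [← enorm_mul, ← ofReal_norm, ← ofReal_norm, norm_phaseShift_apply, norm_mul]
  have hm : Measurable fun x => ‖γ (y - x)‖ₑ :=
    (γ.continuous.comp (f := fun x => y - x) (by fun_prop)).enorm.measurable
  simp_rw [e]
  rw [lintegral_const_mul _ hm, lintegral_sub_left_eq_self (fun x => ‖γ x‖ₑ), windowMass]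

theorem lintegral_supStft_mul_phaseShift_le (ħ : ℝ) (g γ : 𝓢(EuclideanSpace ℝ (Fin n), ℂ))
    (f : 𝓢'(EuclideanSpace ℝ (Fin n), ℂ)) (y : EuclideanSpace ℝ (Fin n)) :
    ∫⁻ z, supStft ħ g f z.2 * ‖phaseShift ħ z.1 z.2 γ y‖ₑ ∂(volume.prod volume) ≤
      windowMass ħ γ * modNorm ħ ∞ 1 g f := by
  rw [modNorm_top_one]
  exact lintegral_mul_kernel_le (measurable_supStft ħ g f)
    (continuous_phaseShift_apply_left ħ γ y).enorm.measurable
    (fun ξ => (lintegral_enorm_phaseShift ħ γ ξ y).le)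

/-- A majorant integrable in x, free of ξ and locally bounded in y: what dominated convergence needs
for continuity of the synthesis. -/
theorem phaseShift_decay (ħ : ℝ) (γ : 𝓢(EuclideanSpace ℝ (Fin n), ℂ)) :
    ∃ C : ℝ, 0 ≤ C ∧ ∀ x ξ y, ‖phaseShift ħ x ξ γ y‖ ≤
      C * (1 + ‖y‖) ^ (n + 1) * ((1 + ‖x‖) ^ (n + 1))⁻¹ := by
  obtain ⟨C, hC, h⟩ := schwartz_decay γ (n + 1)
  set c := ‖(((2 * Real.pi * ħ) ^ (-((n : ℝ) / 2)) : ℝ) : ℂ)‖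
  refine ⟨c * C, by positivity, fun x ξ y => ?_⟩
  rw [norm_phaseShift_apply, ← div_eq_mul_inv, le_div_iff₀ (by positivity)]
  calc c * ‖γ (y - x)‖ * (1 + ‖x‖) ^ (n + 1)
      ≤ c * ‖γ (y - x)‖ * ((1 + ‖y - x‖) * (1 + ‖y‖)) ^ (n + 1) := by
        gcongr
        exact one_add_norm_le_mul x y
    _ = c * ((1 + ‖y - x‖) ^ (n + 1) * ‖γ (y - x)‖) * (1 + ‖y‖) ^ (n + 1) := by
        rw [mul_pow]; ring
    _ ≤ _ := by
        gcongr
        exact h (y - x)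

theorem lintegral_ofReal_weight_lt_top (C : ℝ) :
    ∫⁻ x : EuclideanSpace ℝ (Fin n), ENNReal.ofReal (C * ((1 + ‖x‖) ^ (n + 1))⁻¹) < ∞ :=
  ((integrable_inv_one_add_norm_pow n.lt_add_one).const_mul C).lintegral_lt_top

/-- The Gabor synthesis of `V_g f` with window `γ`. -/
noncomputable def synthesis (ħ : ℝ) (g γ : 𝓢(EuclideanSpace ℝ (Fin n), ℂ))
    (f : 𝓢'(EuclideanSpace ℝ (Fin n), ℂ)) (y : EuclideanSpace ℝ (Fin n)) : ℂ :=
  ∫ z : EuclideanSpace ℝ (Fin n) × EuclideanSpace ℝ (Fin n),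
    stft ħ g f z.1 z.2 * phaseShift ħ z.1 z.2 γ y ∂(volume.prod volume)

theorem continuous_synthesis {ħ : ℝ} {g : 𝓢(EuclideanSpace ℝ (Fin n), ℂ)}
    (γ : 𝓢(EuclideanSpace ℝ (Fin n), ℂ)) {f : 𝓢'(EuclideanSpace ℝ (Fin n), ℂ)}
    (hf : modNorm ħ ∞ 1 g f < ∞) : Continuous (synthesis ħ g γ f) := by
  obtain ⟨C, hC, h⟩ := phaseShift_decay ħ γ
  rw [continuous_iff_continuousAt]
  intro y₀
  -- On the unit ball around y₀ one has 1 + ‖y‖ ≤ 2 + ‖y₀‖.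
  set D : ℝ := C * (2 + ‖y₀‖) ^ (n + 1)
  have hbm : Measurable fun z : EuclideanSpace ℝ (Fin n) × EuclideanSpace ℝ (Fin n) =>
      ENNReal.ofReal (D * ((1 + ‖z.1‖) ^ (n + 1))⁻¹) := by fun_prop
  refine tendsto_integral_of_enorm_le (B := fun z => supStft ħ g f z.2 *
    ENNReal.ofReal (D * ((1 + ‖z.1‖) ^ (n + 1))⁻¹)) (Eventually.of_forall fun y => ?_)
    (((measurable_supStft ħ g f).comp measurable_snd).mul hbm) ?_ ?_ (fun z => ?_)
  · exact ((continuous_stft ħ g f).mul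
      (continuous_phaseShift_apply_left ħ γ y)).aestronglyMeasurable
  · refine ((lintegral_mul_kernel_le (measurable_supStft ħ g f) hbm
      (C := ∫⁻ x : EuclideanSpace ℝ (Fin n), ENNReal.ofReal (D * ((1 + ‖x‖) ^ (n + 1))⁻¹))
      (fun ξ => le_rfl)).trans_lt
      ?_).ne
    rw [modNorm_top_one] at hf
    exact ENNReal.mul_lt_top (lintegral_ofReal_weight_lt_top D) hf
  · filter_upwards [Metric.ball_mem_nhds y₀ one_pos] with y hy z
    rw [enorm_mul]
    gcongr
    · exact enorm_stft_le_supStft ħ g f z.1 z.2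
    · rw [← ofReal_norm]
      refine ENNReal.ofReal_le_ofReal ((h z.1 z.2 y).trans ?_)
      have h1 : 1 + ‖y‖ ≤ 2 + ‖y₀‖ := by
        rw [mem_ball_iff_norm] at hy
        linarith [norm_le_norm_add_norm_sub' y y₀]
      have h2 : C * (1 + ‖y‖) ^ (n + 1) ≤ D :=
        mul_le_mul_of_nonneg_left (pow_le_pow_left₀ (by positivity) h1 _) hC
      exact mul_le_mul_of_nonneg_right h2 (by positivity)
  · exact (((phaseShift ħ z.1 z.2 γ).continuous.tendsto y₀).const_mul _)

theorem enorm_synthesis_le (ħ : ℝ) (g γ : 𝓢(EuclideanSpace ℝ (Fin n), ℂ))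
    (f : 𝓢'(EuclideanSpace ℝ (Fin n), ℂ)) (y : EuclideanSpace ℝ (Fin n)) :
    ‖synthesis ħ g γ f y‖ₑ ≤ windowMass ħ γ * modNorm ħ ∞ 1 g f :=
  (enorm_integral_stft_mul_le ħ g f).trans (lintegral_supStft_mul_phaseShift_le ħ g γ f y)

/-- Integrating over phase space first gives a bound uniform in y, after which φ is integrable. -/
theorem integrable_stft_mul_phaseShift_mul {ħ : ℝ} {g : 𝓢(EuclideanSpace ℝ (Fin n), ℂ)}
    (γ : 𝓢(EuclideanSpace ℝ (Fin n), ℂ)) {f : 𝓢'(EuclideanSpace ℝ (Fin n), ℂ)}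
    (hf : modNorm ħ ∞ 1 g f < ∞) (φ : 𝓢(EuclideanSpace ℝ (Fin n), ℂ)) :
    Integrable (Function.uncurry fun (z : EuclideanSpace ℝ (Fin n) × EuclideanSpace ℝ (Fin n))
      (y : EuclideanSpace ℝ (Fin n)) => stft ħ g f z.1 z.2 * (phaseShift ħ z.1 z.2 γ y * φ y))
      (((volume : Measure (EuclideanSpace ℝ (Fin n))).prod volume).prod volume) := by
  have hcont : Continuous fun p : (EuclideanSpace ℝ (Fin n) × EuclideanSpace ℝ (Fin n)) ×
      EuclideanSpace ℝ (Fin n) =>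
      stft ħ g f p.1.1 p.1.2 * (phaseShift ħ p.1.1 p.1.2 γ p.2 * φ p.2) :=
    ((continuous_stft ħ g f).comp (f := fun p : (EuclideanSpace ℝ (Fin n) ×
      EuclideanSpace ℝ (Fin n)) × EuclideanSpace ℝ (Fin n) => p.1) continuous_fst).mul
      ((continuous_phaseShift_apply ħ γ).mul (φ.continuous.comp (f := fun p :
      (EuclideanSpace ℝ (Fin n) × EuclideanSpace ℝ (Fin n)) × EuclideanSpace ℝ (Fin n) => p.2)
      continuous_snd))
  rw [Function.uncurry_def]
  refine ⟨hcont.aestronglyMeasurable, ?_⟩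
  rw [HasFiniteIntegral, lintegral_prod_symm' _ hcont.enorm.measurable]
  have hφ : ∫⁻ y, ‖φ y‖ₑ < ∞ := (φ.integrable (μ := volume)).hasFiniteIntegral
  calc _ ≤ ∫⁻ y, (windowMass ħ γ * modNorm ħ ∞ 1 g f) * ‖φ y‖ₑ := by
        refine lintegral_mono fun y => ?_
        refine le_trans ?_ (mul_le_mul_left
          (lintegral_supStft_mul_phaseShift_le ħ g γ f y) ‖φ y‖ₑ)
        have hm : Measurable fun z : EuclideanSpace ℝ (Fin n) × EuclideanSpace ℝ (Fin n) =>
            supStft ħ g f z.2 * ‖phaseShift ħ z.1 z.2 γ y‖ₑ :=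
          ((measurable_supStft ħ g f).comp measurable_snd).mul
            (continuous_phaseShift_apply_left ħ γ y).enorm.measurable
        rw [← lintegral_mul_const _ hm]
        refine lintegral_mono fun z => ?_
        simp only [enorm_mul]
        rw [← mul_assoc]
        gcongr
        exact enorm_stft_le_supStft ħ g f z.1 z.2
    _ = (windowMass ħ γ * modNorm ħ ∞ 1 g f) * ∫⁻ y, ‖φ y‖ₑ :=
        lintegral_const_mul _ φ.continuous.enorm.measurable
    _ < ∞ := ENNReal.mul_lt_top (ENNReal.mul_lt_top (windowMass_lt_top ħ γ) hf) hφ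

theorem integral_synthesis_mul {ħ : ℝ} (hħ : 0 < ħ) {g : 𝓢(EuclideanSpace ℝ (Fin n), ℂ)}
    (γ : 𝓢(EuclideanSpace ℝ (Fin n), ℂ)) {f : 𝓢'(EuclideanSpace ℝ (Fin n), ℂ)}
    (hf : modNorm ħ ∞ 1 g f < ∞) (φ : 𝓢(EuclideanSpace ℝ (Fin n), ℂ)) :
    innerS γ g * f φ = ∫ y, synthesis ħ g γ f y * φ y := by
  rw [inversion hħ]
  simp_rw [coeff, ← integral_const_mul]
  rw [integral_integral_swap (integrable_stft_mul_phaseShift_mul γ hf φ)]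
  congr 1
  ext y
  rw [synthesis, ← integral_mul_const]
  simp_rw [mul_assoc]

/-- By Fubini in the inversion formula, the synthesis with γ = g, divided by ⟨g,g⟩, is such a
function. -/
theorem exists_represents {ħ : ℝ} (hħ : 0 < ħ) {f : 𝓢'(EuclideanSpace ℝ (Fin n), ℂ)}
    (hf : f ∈ modSpace ħ n ∞ 1) : ∃ u, Represents f u := by
  obtain ⟨g, hg, hgf⟩ := hf
  have hb : windowMass ħ g * modNorm ħ ∞ 1 g f ≠ ∞ :=
    (ENNReal.mul_lt_top (windowMass_lt_top ħ g) hgf).ne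
  refine ⟨BoundedContinuousFunction.ofNormedAddCommGroup
    (fun y => (innerS g g)⁻¹ * synthesis ħ g g f y)
    (continuous_const.mul (continuous_synthesis g hgf))
    (‖(innerS g g)⁻¹‖ * (windowMass ħ g * modNorm ħ ∞ 1 g f).toReal) (fun y => ?_), fun φ => ?_⟩
  · rw [norm_mul]
    gcongr
    have := ENNReal.toReal_mono hb (enorm_synthesis_le ħ g g f y)
    rwa [toReal_enorm] at this
  · simp only [BoundedContinuousFunction.coe_ofNormedAddCommGroup, mul_assoc]
    rw [integral_const_mul, ← integral_synthesis_mul hħ g hgf φ,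
      inv_mul_cancel_left₀ (innerS_self_ne_zero hg)]

theorem integrable_bcf_mul_schwartz (u : EuclideanSpace ℝ (Fin n) →ᵇ ℂ)
    (φ : 𝓢(EuclideanSpace ℝ (Fin n), ℂ)) : Integrable fun x => u x * φ x :=
  φ.integrable.bdd_mul (c := ‖u‖) u.continuous.aestronglyMeasurable
    (ae_of_all _ fun x => u.norm_coe_le_norm x)

theorem Represents.unique {f : 𝓢'(EuclideanSpace ℝ (Fin n), ℂ)}
    {u v : EuclideanSpace ℝ (Fin n) →ᵇ ℂ} (hu : Represents f u) (hv : Represents f v) : u = v := by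
  have h : (u : EuclideanSpace ℝ (Fin n) → ℂ) =ᵐ[volume] v := by
    refine ae_eq_of_integral_contDiff_smul_eq u.continuous.locallyIntegrable
      v.continuous.locallyIntegrable fun g hg hgc => ?_
    have hc : HasCompactSupport fun x => (g x : ℂ) := hgc.comp_left Complex.ofReal_zero
    have hs : ContDiff ℝ ((⊤ : ℕ∞) : WithTop ℕ∞) fun x => (g x : ℂ) := Complex.ofRealCLM.contDiff.comp hg
    have h1 := hu (hc.toSchwartzMap hs)
    rw [hv (hc.toSchwartzMap hs)] at h1
    simp only [Complex.real_smul]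
    simpa [mul_comm] using h1.symm
  exact DFunLike.coe_injective ((Continuous.ae_eq_iff_eq volume u.continuous v.continuous).1 h)

theorem toFunction_eq {f : 𝓢'(EuclideanSpace ℝ (Fin n), ℂ)}
    {u : EuclideanSpace ℝ (Fin n) →ᵇ ℂ} (hu : Represents f u) : toFunction f = u :=
  (Classical.epsilon_spec (p := Represents f) ⟨u, hu⟩).unique hu

end Sjostrand

namespace Sjostrand

open scoped FourierTransform

variable {n : ℕ}

/-! ### The Fresnel functional -/

/-- The pairing of a phase space shift with the Fresnel function. -/
noncomputable def fresnelCoeff (ħ : ℝ) (γ : 𝓢(EuclideanSpace ℝ (Fin n), ℂ))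
    (x ξ : EuclideanSpace ℝ (Fin n)) : ℂ :=
  fresnelDist ħ n (phaseShift ħ x ξ γ)

theorem fresnelCoeff_eq (ħ : ℝ) (γ : 𝓢(EuclideanSpace ℝ (Fin n), ℂ))
    (x ξ : EuclideanSpace ℝ (Fin n)) :
    fresnelCoeff ħ γ x ξ = ∫ y, phaseShift ħ x ξ γ y * fresnelFun ħ n y := rfl

/-- The Fourier transform of the product of the Fresnel function with a window. -/
noncomputable def fresnelFourier (ħ : ℝ) (γ : 𝓢(EuclideanSpace ℝ (Fin n), ℂ)) :
    𝓢(EuclideanSpace ℝ (Fin n), ℂ) :=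
  𝓕 (SchwartzMap.smulLeftCLM ℂ (fresnelFun ħ n) γ)

/-- Shifting y by x in the chirp produces the linear phase x·y, which joins ξ·y, and a unimodular
constant. Hence only x + ξ matters, and the norm of F₊ becomes an L¹ norm of a single Schwartz
function. -/
theorem norm_fresnelCoeff (ħ : ℝ) (γ : 𝓢(EuclideanSpace ℝ (Fin n), ℂ))
    (x ξ : EuclideanSpace ℝ (Fin n)) :
    ‖fresnelCoeff ħ γ x ξ‖ = ‖(((2 * Real.pi * ħ) ^ (-((n : ℝ) / 2)) : ℝ) : ℂ)‖ *
      ‖fresnelFourier ħ γ (-((2 * Real.pi * ħ)⁻¹ • (x + ξ)))‖ := by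
  have e : fresnelCoeff ħ γ x ξ = (((2 * Real.pi * ħ) ^ (-((n : ℝ) / 2)) : ℝ) : ℂ) *
      Complex.exp (((inner ℝ ξ x / ħ + ‖x‖ ^ 2 / (2 * ħ) : ℝ) : ℂ) * Complex.I) *
      fresnelFourier ħ γ (-((2 * Real.pi * ħ)⁻¹ • (x + ξ))) := by
    rw [fresnelCoeff_eq, fresnelFourier, SchwartzMap.fourier_coe, Real.fourier_eq',
      ← integral_add_right_eq_self _ x, ← integral_const_mul]
    congr 1
    ext y
    rw [SchwartzMap.smulLeftCLM_apply_apply (fresnelFun_hasTemperateGrowth ħ n), phaseShift_apply,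
      fresnelFun, fresnelFun, add_sub_cancel_right, smul_eq_mul, smul_eq_mul]
    have h3 : Complex.exp (Complex.I * ((inner ℝ ξ (y + x) / ħ : ℝ) : ℂ)) *
        Complex.exp (Complex.I * ((‖y + x‖ ^ 2 / (2 * ħ) : ℝ) : ℂ)) =
        Complex.exp (((inner ℝ ξ x / ħ + ‖x‖ ^ 2 / (2 * ħ) : ℝ) : ℂ) * Complex.I) *
        Complex.exp (((-2 * Real.pi * inner ℝ y (-((2 * Real.pi * ħ)⁻¹ • (x + ξ))) : ℝ) : ℂ) *
          Complex.I) *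
        Complex.exp (Complex.I * ((‖y‖ ^ 2 / (2 * ħ) : ℝ) : ℂ)) := by
      rw [← Complex.exp_add, ← Complex.exp_add, ← Complex.exp_add]
      congr 1
      rw [mul_comm Complex.I, mul_comm Complex.I, mul_comm Complex.I, ← add_mul, ← add_mul,
        ← add_mul, ← Complex.ofReal_add, ← Complex.ofReal_add, ← Complex.ofReal_add]
      congr 2
      rw [inner_neg_right, inner_smul_right, inner_add_right, inner_add_right, norm_add_sq_real,
        real_inner_comm y ξ]
      have hp : Real.pi ≠ 0 := Real.pi_ne_zero
      -- No positivity is assumed here; for ħ = 0 all phases vanish since division by zero gives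
      -- zero.
      rcases eq_or_ne ħ 0 with rfl | hħ
      · simp
      · field_simp
        ring
    linear_combination ((((2 * Real.pi * ħ) ^ (-((n : ℝ) / 2)) : ℝ) : ℂ) * γ y *
      (2 * Real.pi * Complex.I * ħ : ℂ) ^ (-((n : ℂ) / 2))) * h3
  rw [e, norm_mul, norm_mul, Complex.norm_exp_ofReal_mul_I, mul_one]

theorem continuous_fresnelCoeff (ħ : ℝ) (γ : 𝓢(EuclideanSpace ℝ (Fin n), ℂ)) :
    Continuous fun z : EuclideanSpace ℝ (Fin n) × EuclideanSpace ℝ (Fin n) =>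
      fresnelCoeff ħ γ z.1 z.2 :=
  (ContinuousLinearMap.continuous
    (fresnelDist ħ n : 𝓢(EuclideanSpace ℝ (Fin n), ℂ) →L[ℂ] ℂ)).comp (continuous_phaseShift ħ γ)

/-- The Fresnel coefficients decay rapidly away from the antidiagonal. -/
theorem fresnelCoeff_decay {ħ : ℝ} (hħ : 0 < ħ) (γ : 𝓢(EuclideanSpace ℝ (Fin n), ℂ)) (N : ℕ) :
    ∃ C : ℝ, 0 ≤ C ∧ ∀ x ξ, ‖fresnelCoeff ħ γ x ξ‖ ≤ C * ((1 + ‖x + ξ‖) ^ N)⁻¹ := by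
  obtain ⟨C, hC, h⟩ := schwartz_decay (fresnelFourier ħ γ) N
  set c := ‖(((2 * Real.pi * ħ) ^ (-((n : ℝ) / 2)) : ℝ) : ℂ)‖
  set K := 1 + 2 * Real.pi * ħ
  have hK : 0 ≤ K := by positivity
  refine ⟨K ^ N * c * C, by positivity, fun x ξ => ?_⟩
  have h0 := h (-((2 * Real.pi * ħ)⁻¹ • (x + ξ)))
  have h1 : 1 + ‖x + ξ‖ ≤ K * (1 + ‖-((2 * Real.pi * ħ)⁻¹ • (x + ξ))‖) := by
    have hp : 0 < 2 * Real.pi * ħ := by positivity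
    rw [norm_neg, norm_smul, Real.norm_of_nonneg (by positivity)]
    have : (1 + 2 * Real.pi * ħ) * (1 + (2 * Real.pi * ħ)⁻¹ * ‖x + ξ‖) =
      1 + ‖x + ξ‖ + 2 * Real.pi * ħ + (2 * Real.pi * ħ)⁻¹ * ‖x + ξ‖ := by
      field_simp
      ring
    rw [this]
    have : 0 ≤ (2 * Real.pi * ħ)⁻¹ * ‖x + ξ‖ := by positivity
    linarith
  rw [norm_fresnelCoeff, ← div_eq_mul_inv, le_div_iff₀ (by positivity)]
  set X := ‖fresnelFourier ħ γ (-((2 * Real.pi * ħ)⁻¹ • (x + ξ)))‖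
  set Y := 1 + ‖-((2 * Real.pi * ħ)⁻¹ • (x + ξ))‖
  calc c * X * (1 + ‖x + ξ‖) ^ N ≤ c * X * (K * Y) ^ N := by gcongr
    _ = K ^ N * c * (Y ^ N * X) := by rw [mul_pow]; ring
    _ ≤ K ^ N * c * C := mul_le_mul_of_nonneg_left h0 (by positivity)

/-! ### Regularized Fresnel integrals and their limit -/

/-- The dilation `y ↦ φ(εy)` of a Schwartz function. -/
noncomputable def dilate {ε : ℝ} (hε : ε ≠ 0) (φ : 𝓢(EuclideanSpace ℝ (Fin n), ℂ)) :
    𝓢(EuclideanSpace ℝ (Fin n), ℂ) :=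
  SchwartzMap.compCLMOfContinuousLinearEquiv ℂ
    (ContinuousLinearEquiv.smulLeft (R₁ := ℝ) (Units.mk0 ε hε)) φ

theorem dilate_apply {ε : ℝ} (hε : ε ≠ 0) (φ : 𝓢(EuclideanSpace ℝ (Fin n), ℂ))
    (y : EuclideanSpace ℝ (Fin n)) : dilate hε φ y = φ (ε • y) := rfl

/-- A cutoff φ(ε·) is a superposition of plane waves, each of which merely moves the frequency of
the shift. -/
theorem phaseShift_mul_exp {ħ : ℝ} (hħ : 0 < ħ) (γ : 𝓢(EuclideanSpace ℝ (Fin n), ℂ)) (ε : ℝ)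
    (x ξ η y : EuclideanSpace ℝ (Fin n)) :
    phaseShift ħ x ξ γ y *
      Complex.exp (((2 * Real.pi * inner ℝ η (ε • y) : ℝ) : ℂ) * Complex.I) =
      phaseShift ħ x (ξ + (2 * Real.pi * ħ * ε) • η) γ y := by
  rw [phaseShift_apply, phaseShift_apply]
  have e : Complex.exp (Complex.I * ((inner ℝ ξ y / ħ : ℝ) : ℂ)) *
      Complex.exp (((2 * Real.pi * inner ℝ η (ε • y) : ℝ) : ℂ) * Complex.I) =
      Complex.exp (Complex.I *
        ((inner ℝ (ξ + (2 * Real.pi * ħ * ε) • η) y / ħ : ℝ) : ℂ)) := by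
    rw [← Complex.exp_add, mul_comm Complex.I, mul_comm Complex.I, ← add_mul, ← Complex.ofReal_add]
    congr 3
    rw [inner_add_left, inner_smul_left, inner_smul_right]
    simp only [conj_trivial]
    field_simp
  linear_combination ((((2 * Real.pi * ħ) ^ (-((n : ℝ) / 2)) : ℝ) : ℂ) * γ (y - x)) * e

theorem integrable_phaseShift_mul_fresnelFun (ħ : ℝ) (γ : 𝓢(EuclideanSpace ℝ (Fin n), ℂ))
    (x ξ : EuclideanSpace ℝ (Fin n)) :
    Integrable fun y => phaseShift ħ x ξ γ y * fresnelFun ħ n y := by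
  have h := (SchwartzMap.smulLeftCLM ℂ (fresnelFun ħ n) (phaseShift ħ x ξ γ)).integrable
    (μ := volume)
  refine h.congr (ae_of_all _ fun y => ?_)
  rw [SchwartzMap.smulLeftCLM_apply_apply (fresnelFun_hasTemperateGrowth ħ n), smul_eq_mul,
    mul_comm]

/-- Multiplying the Fresnel function by a dilated Schwartz function averages the coefficients. -/
theorem coeff_fresnelFun_mul_dilate {ħ : ℝ} (hħ : 0 < ħ) {ε : ℝ} (hε : ε ≠ 0)
    (γ φ : 𝓢(EuclideanSpace ℝ (Fin n), ℂ)) (x ξ : EuclideanSpace ℝ (Fin n)) :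
    coeff ħ γ (SchwartzMap.smulLeftCLM ℂ (fresnelFun ħ n) (dilate hε φ)) x ξ =
      ∫ η, 𝓕 φ η * fresnelCoeff ħ γ x (ξ + (2 * Real.pi * ħ * ε) • η) := by
  have hinv : ∀ y, dilate hε φ y =
      ∫ η, Complex.exp (((2 * Real.pi * inner ℝ η (ε • y) : ℝ) : ℂ) * Complex.I) * 𝓕 φ η := by
    intro y
    rw [dilate_apply]
    conv_lhs => rw [← FourierTransform.fourierInv_fourier_eq
      (F := 𝓢(EuclideanSpace ℝ (Fin n), ℂ)) φ]
    rw [SchwartzMap.fourierInv_coe, Real.fourierInv_eq']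
    rfl
  have hint : Integrable (Function.uncurry fun (y η : EuclideanSpace ℝ (Fin n)) =>
      𝓕 φ η * (phaseShift ħ x (ξ + (2 * Real.pi * ħ * ε) • η) γ y * fresnelFun ħ n y))
      (volume.prod volume) := by
    -- The modulus of a phase space shift does not depend on its frequency, so the integrand is
    -- comparable with a product of functions of y and η.
    have h1 := (integrable_phaseShift_mul_fresnelFun ħ γ x ξ).mul_prod
      ((𝓕 φ).integrable (μ := volume))
    refine h1.mono ?_ (ae_of_all _ fun p => ?_)
    · refine Continuous.aestronglyMeasurable ?_
      have h2 : Continuous fun p : EuclideanSpace ℝ (Fin n) × EuclideanSpace ℝ (Fin n) =>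
          phaseShift ħ x (ξ + (2 * Real.pi * ħ * ε) • p.2) γ p.1 :=
        (continuous_phaseShift_apply ħ γ).comp
          (f := fun p : EuclideanSpace ℝ (Fin n) × EuclideanSpace ℝ (Fin n) =>
            ((x, ξ + (2 * Real.pi * ħ * ε) • p.2), p.1)) (by fun_prop)
      have h3 : Continuous fun p : EuclideanSpace ℝ (Fin n) × EuclideanSpace ℝ (Fin n) =>
          fresnelFun ħ n p.1 :=
        (fresnelFun_hasTemperateGrowth ħ n).1.continuous.comp
          (f := fun p : EuclideanSpace ℝ (Fin n) × EuclideanSpace ℝ (Fin n) => p.1) continuous_fst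
      have h4 : Continuous fun p : EuclideanSpace ℝ (Fin n) × EuclideanSpace ℝ (Fin n) =>
          (𝓕 φ) p.2 :=
        (𝓕 φ).continuous.comp
          (f := fun p : EuclideanSpace ℝ (Fin n) × EuclideanSpace ℝ (Fin n) => p.2) continuous_snd
      exact h4.mul (h2.mul h3)
    · simp only [Function.uncurry_def, norm_mul, norm_phaseShift_apply]
      exact le_of_eq (by ring)
  have hsw := integral_integral_swap hint
  have e1 : ∀ y, ∫ η, 𝓕 φ η * (phaseShift ħ x (ξ + (2 * Real.pi * ħ * ε) • η) γ y *
      fresnelFun ħ n y) = phaseShift ħ x ξ γ y *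
        SchwartzMap.smulLeftCLM ℂ (fresnelFun ħ n) (dilate hε φ) y := by
    intro y
    rw [SchwartzMap.smulLeftCLM_apply_apply (fresnelFun_hasTemperateGrowth ħ n), hinv, smul_eq_mul,
      ← integral_const_mul, ← integral_const_mul]
    congr 1
    ext η
    rw [← phaseShift_mul_exp hħ]
    ring
  have e2 : ∀ η, ∫ y, 𝓕 φ η * (phaseShift ħ x (ξ + (2 * Real.pi * ħ * ε) • η) γ y *
      fresnelFun ħ n y) = 𝓕 φ η * fresnelCoeff ħ γ x (ξ + (2 * Real.pi * ħ * ε) • η) := by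
    intro η
    rw [integral_const_mul, ← fresnelCoeff_eq]
  simp_rw [e1, e2] at hsw
  exact hsw

/-- Averaging over the frequency shifts 2πħεη loses, by the Peetre-type inequality, a factor
(1+‖η‖)^{n+1} when |ε| ≤ 1, which the decay of the Fourier transform of φ absorbs. Uniformity in ε
is the point. -/
theorem coeff_fresnelFun_mul_dilate_decay {ħ : ℝ} (hħ : 0 < ħ)
    (γ φ : 𝓢(EuclideanSpace ℝ (Fin n), ℂ)) :
    ∃ C : ℝ, ∀ (ε : ℝ) (hε : ε ≠ 0), |ε| ≤ 1 → ∀ x ξ,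
      ‖coeff ħ γ (SchwartzMap.smulLeftCLM ℂ (fresnelFun ħ n) (dilate hε φ)) x ξ‖ ≤
        C * ((1 + ‖x + ξ‖) ^ (n + 1))⁻¹ := by
  obtain ⟨C, hC, h⟩ := fresnelCoeff_decay hħ γ (n + 1)
  -- One n + 1 pays for the frequency shift, the other for integrability in η.
  obtain ⟨D, hD, h'⟩ := schwartz_decay (𝓕 φ) (n + 1 + (n + 1))
  set K := 1 + 2 * Real.pi * ħ
  have hK : 0 ≤ K := by positivity
  refine ⟨∫ η : EuclideanSpace ℝ (Fin n), D * C * K ^ (n + 1) * ((1 + ‖η‖) ^ (n + 1))⁻¹,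
    fun ε hε hε1 x ξ => ?_⟩
  rw [coeff_fresnelFun_mul_dilate hħ hε, ← integral_mul_const]
  refine norm_integral_le_of_norm_le (((integrable_inv_one_add_norm_pow n.lt_add_one).const_mul
    _).mul_const _) (ae_of_all _ fun η => ?_)
  rw [norm_mul]
  have h1 := h x (ξ + (2 * Real.pi * ħ * ε) • η)
  have h2 : 1 + ‖x + ξ‖ ≤ (K * (1 + ‖η‖)) * (1 + ‖x + (ξ + (2 * Real.pi * ħ * ε) • η)‖) := by
    have h3 := one_add_norm_le_mul (x + ξ) (x + (ξ + (2 * Real.pi * ħ * ε) • η))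
    have h4 : x + (ξ + (2 * Real.pi * ħ * ε) • η) - (x + ξ) = (2 * Real.pi * ħ * ε) • η := by
      abel
    rw [h4, norm_smul, norm_mul, Real.norm_of_nonneg (by positivity : 0 ≤ 2 * Real.pi * ħ),
      Real.norm_eq_abs] at h3
    refine h3.trans ?_
    gcongr
    have h5 : 2 * Real.pi * ħ * |ε| * ‖η‖ ≤ 2 * Real.pi * ħ * 1 * ‖η‖ := by gcongr
    have h6 : K * (1 + ‖η‖) = 1 + 2 * Real.pi * ħ + ‖η‖ + 2 * Real.pi * ħ * 1 * ‖η‖ := by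
      simp only [K]
      ring
    rw [h6]
    have : 0 ≤ 2 * Real.pi * ħ := by positivity
    linarith [norm_nonneg η]
  set S := 1 + ‖x + (ξ + (2 * Real.pi * ħ * ε) • η)‖ with hS
  have hSp : 0 < S := by positivity
  have h7 : (S ^ (n + 1))⁻¹ ≤ K ^ (n + 1) * (1 + ‖η‖) ^ (n + 1) * ((1 + ‖x + ξ‖) ^ (n + 1))⁻¹ := by
    rw [← div_eq_mul_inv, le_div_iff₀ (by positivity), inv_mul_le_iff₀ (by positivity)]
    calc (1 + ‖x + ξ‖) ^ (n + 1) ≤ ((K * (1 + ‖η‖)) * S) ^ (n + 1) := by gcongr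
      _ = _ := by rw [mul_pow, mul_pow]; ring
  have h8 : ‖𝓕 φ η‖ * (1 + ‖η‖) ^ (n + 1) ≤ D * ((1 + ‖η‖) ^ (n + 1))⁻¹ := by
    rw [← div_eq_mul_inv, le_div_iff₀ (by positivity)]
    have := h' η
    rw [pow_add] at this
    linarith
  calc ‖𝓕 φ η‖ * ‖fresnelCoeff ħ γ x (ξ + (2 * Real.pi * ħ * ε) • η)‖
      ≤ ‖𝓕 φ η‖ * (C * (K ^ (n + 1) * (1 + ‖η‖) ^ (n + 1) * ((1 + ‖x + ξ‖) ^ (n + 1))⁻¹)) := by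
        gcongr
        exact h1.trans (mul_le_mul_of_nonneg_left h7 hC)
    _ = (‖𝓕 φ η‖ * (1 + ‖η‖) ^ (n + 1)) * (C * K ^ (n + 1) * ((1 + ‖x + ξ‖) ^ (n + 1))⁻¹) := by
        ring
    _ ≤ (D * ((1 + ‖η‖) ^ (n + 1))⁻¹) * (C * K ^ (n + 1) * ((1 + ‖x + ξ‖) ^ (n + 1))⁻¹) := by
        gcongr
    _ = _ := by ring

/-- The product of the Fresnel function and a dilated Schwartz function; zero without dilation. -/
noncomputable def fresnelCutoff (ħ ε : ℝ) (φ : 𝓢(EuclideanSpace ℝ (Fin n), ℂ)) :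
    𝓢(EuclideanSpace ℝ (Fin n), ℂ) :=
  if hε : ε ≠ 0 then SchwartzMap.smulLeftCLM ℂ (fresnelFun ħ n) (dilate hε φ) else 0

theorem fresnelCutoff_apply (ħ : ℝ) {ε : ℝ} (hε : ε ≠ 0) (φ : 𝓢(EuclideanSpace ℝ (Fin n), ℂ))
    (y : EuclideanSpace ℝ (Fin n)) :
    fresnelCutoff ħ ε φ y = fresnelFun ħ n y * φ (ε • y) := by
  rw [fresnelCutoff, dif_pos hε,
    SchwartzMap.smulLeftCLM_apply_apply (fresnelFun_hasTemperateGrowth ħ n), dilate_apply,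
    smul_eq_mul]

theorem tendsto_coeff_fresnelCutoff (ħ : ℝ) (γ : 𝓢(EuclideanSpace ℝ (Fin n), ℂ))
    {φ : 𝓢(EuclideanSpace ℝ (Fin n), ℂ)} (hφ : φ 0 = 1) (x ξ : EuclideanSpace ℝ (Fin n)) :
    Tendsto (fun ε : ℝ => coeff ħ γ (fresnelCutoff ħ ε φ) x ξ) (𝓝[>] 0)
      (𝓝 (fresnelCoeff ħ γ x ξ)) := by
  obtain ⟨C, hC, h⟩ := schwartz_decay φ 0
  refine tendsto_integral_filter_of_dominated_convergence
    (fun y => C * ‖phaseShift ħ x ξ γ y * fresnelFun ħ n y‖)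
    (Eventually.of_forall fun ε => ?_) ?_
    ((integrable_phaseShift_mul_fresnelFun ħ γ x ξ).norm.const_mul C) (ae_of_all _ fun y => ?_)
  · exact ((phaseShift ħ x ξ γ).continuous.mul
      (fresnelCutoff ħ ε φ).continuous).aestronglyMeasurable
  · filter_upwards [self_mem_nhdsWithin] with ε hε
    refine ae_of_all _ fun y => ?_
    rw [fresnelCutoff_apply ħ (ne_of_gt hε), ← mul_assoc, norm_mul, mul_comm]
    gcongr
    simpa using h (ε • y)
  · have h1 : Tendsto (fun ε : ℝ => φ (ε • y)) (𝓝[>] 0) (𝓝 1) := by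
      have : Continuous fun ε : ℝ => φ (ε • y) :=
        φ.continuous.comp (f := fun ε : ℝ => ε • y) (by fun_prop)
      have h2 := this.tendsto 0
      simp only [zero_smul, hφ] at h2
      exact h2.mono_left nhdsWithin_le_nhds
    have h2 : Tendsto (fun ε : ℝ => phaseShift ħ x ξ γ y * fresnelFun ħ n y * φ (ε • y)) (𝓝[>] 0)
        (𝓝 (phaseShift ħ x ξ γ y * fresnelFun ħ n y)) := by
      simpa using h1.const_mul (phaseShift ħ x ξ γ y * fresnelFun ħ n y)
    refine h2.congr' ?_
    filter_upwards [self_mem_nhdsWithin] with ε hε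
    rw [fresnelCutoff_apply ħ (ne_of_gt hε), mul_assoc]

theorem lintegral_add_weight (C : ℝ) (ξ : EuclideanSpace ℝ (Fin n)) :
    ∫⁻ x : EuclideanSpace ℝ (Fin n), ENNReal.ofReal (C * ((1 + ‖x + ξ‖) ^ (n + 1))⁻¹) =
      ∫⁻ x : EuclideanSpace ℝ (Fin n), ENNReal.ofReal (C * ((1 + ‖x‖) ^ (n + 1))⁻¹) :=
  lintegral_add_right_eq_self
    (fun x : EuclideanSpace ℝ (Fin n) => ENNReal.ofReal (C * ((1 + ‖x‖) ^ (n + 1))⁻¹)) ξ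

/-- The majorant is the supremum of V_g f at ξ times C(1+‖x+ξ‖)^{-(n+1)}; its x-integral removes the
dependence on ξ, leaving the M^{∞,1} norm. -/
theorem tendsto_integral_stft_mul_coeff {ħ : ℝ} (hħ : 0 < ħ) {g : 𝓢(EuclideanSpace ℝ (Fin n), ℂ)}
    (γ : 𝓢(EuclideanSpace ℝ (Fin n), ℂ)) {f : 𝓢'(EuclideanSpace ℝ (Fin n), ℂ)}
    (hf : modNorm ħ ∞ 1 g f < ∞) {φ : 𝓢(EuclideanSpace ℝ (Fin n), ℂ)} (hφ : φ 0 = 1) :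
    Tendsto (fun ε : ℝ => ∫ z : EuclideanSpace ℝ (Fin n) × EuclideanSpace ℝ (Fin n),
      stft ħ g f z.1 z.2 * coeff ħ γ (fresnelCutoff ħ ε φ) z.1 z.2 ∂(volume.prod volume)) (𝓝[>] 0)
      (𝓝 (∫ z : EuclideanSpace ℝ (Fin n) × EuclideanSpace ℝ (Fin n),
        stft ħ g f z.1 z.2 * fresnelCoeff ħ γ z.1 z.2 ∂(volume.prod volume))) := by
  obtain ⟨C, h⟩ := coeff_fresnelFun_mul_dilate_decay hħ γ φ
  have hbm : Measurable fun z : EuclideanSpace ℝ (Fin n) × EuclideanSpace ℝ (Fin n) =>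
      ENNReal.ofReal (C * ((1 + ‖z.1 + z.2‖) ^ (n + 1))⁻¹) := by fun_prop
  refine tendsto_integral_of_enorm_le (B := fun z => supStft ħ g f z.2 *
    ENNReal.ofReal (C * ((1 + ‖z.1 + z.2‖) ^ (n + 1))⁻¹)) (Eventually.of_forall fun ε => ?_)
    (((measurable_supStft ħ g f).comp measurable_snd).mul hbm) ?_ ?_ (fun z => ?_)
  · exact ((continuous_stft ħ g f).mul (continuous_coeff ħ γ _)).aestronglyMeasurable
  · refine ((lintegral_mul_kernel_le (measurable_supStft ħ g f) hbm
      (C := ∫⁻ x : EuclideanSpace ℝ (Fin n), ENNReal.ofReal (C * ((1 + ‖x‖) ^ (n + 1))⁻¹))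
      (fun ξ => (lintegral_add_weight C ξ).le)).trans_lt ?_).ne
    rw [modNorm_top_one] at hf
    exact ENNReal.mul_lt_top (lintegral_ofReal_weight_lt_top C) hf
  · filter_upwards [self_mem_nhdsWithin, nhdsWithin_le_nhds (Metric.closedBall_mem_nhds 0 one_pos)]
      with ε hε hε1 z
    rw [enorm_mul]
    gcongr
    · exact enorm_stft_le_supStft ħ g f z.1 z.2
    · rw [← ofReal_norm, fresnelCutoff, dif_pos (ne_of_gt hε)]
      exact ENNReal.ofReal_le_ofReal (h ε (ne_of_gt hε) (by simpa using hε1) z.1 z.2)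
  · exact (tendsto_coeff_fresnelCutoff ħ γ hφ z.1 z.2).const_mul _

/-- Elements of the modulation space are Fresnel integrable. -/
theorem hasFresnelIntegral_of_represents {ħ : ℝ} (hħ : 0 < ħ)
    {g γ : 𝓢(EuclideanSpace ℝ (Fin n), ℂ)} (hγ : innerS γ g ≠ 0)
    {f : 𝓢'(EuclideanSpace ℝ (Fin n), ℂ)} (hf : modNorm ħ ∞ 1 g f < ∞)
    {u : EuclideanSpace ℝ (Fin n) →ᵇ ℂ} (hu : Represents f u) :
    HasFresnelIntegral ħ u ((innerS γ g)⁻¹ *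
      ∫ z : EuclideanSpace ℝ (Fin n) × EuclideanSpace ℝ (Fin n),
        stft ħ g f z.1 z.2 * fresnelCoeff ħ γ z.1 z.2 ∂(volume.prod volume)) := by
  intro φ hφ
  constructor
  · filter_upwards [self_mem_nhdsWithin] with ε hε
    have h1 := integrable_bcf_mul_schwartz u (dilate (ne_of_gt hε) φ)
    have hexp : Continuous fun x : EuclideanSpace ℝ (Fin n) =>
        Complex.exp (Complex.I * ((‖x‖ ^ 2 / (2 * ħ) : ℝ) : ℂ)) := by fun_prop
    refine h1.mono ((hexp.mul u.continuous).mul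
      (dilate (ne_of_gt hε) φ).continuous).aestronglyMeasurable (ae_of_all _ fun x => ?_)
    rw [norm_mul, norm_mul, norm_mul, mul_comm Complex.I, Complex.norm_exp_ofReal_mul_I, one_mul,
      dilate_apply]
  · refine ((tendsto_integral_stft_mul_coeff hħ γ hf hφ).const_mul (innerS γ g)⁻¹).congr' ?_
    filter_upwards [self_mem_nhdsWithin] with ε hε
    -- Inversion read backwards: the phase space integral is ⟨γ,g⟩ times the value of `f` on the
    -- cut-off Fresnel function.
    rw [← inversion hħ, inv_mul_cancel_left₀ hγ, hu, ← integral_const_mul]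
    congr 1
    ext x
    rw [fresnelCutoff_apply ħ (ne_of_gt hε), fresnelFun]
    ring

/-- Ensures that `HasFresnelIntegral` is not vacuous, so that Fresnel integrals are unique. -/
theorem exists_schwartz_apply_zero_eq_one (n : ℕ) :
    ∃ φ : 𝓢(EuclideanSpace ℝ (Fin n), ℂ), φ 0 = 1 := by
  have hq : ∀ j : Fin n, (0 : ℝ) < (fun _ => 1) j := fun _ => one_pos
  have h0 : gaussWindow one_pos hq 0 ≠ 0 := by
    rw [gaussWindow_apply]
    have h2 : 0 < (2 * Real.pi * 1) ^ (-((n : ℝ) / 2)) := Real.rpow_pos_of_pos (by positivity) _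
    exact mul_ne_zero (Complex.ofReal_ne_zero.2 h2.ne')
      (Complex.ofReal_ne_zero.2 (Real.exp_pos _).ne')
  exact ⟨(gaussWindow one_pos hq 0)⁻¹ • gaussWindow one_pos hq, inv_mul_cancel₀ h0⟩

theorem HasFresnelIntegral.unique {ħ : ℝ} {u : EuclideanSpace ℝ (Fin n) → ℂ} {c d : ℂ}
    (hc : HasFresnelIntegral ħ u c) (hd : HasFresnelIntegral ħ u d) : c = d := by
  obtain ⟨φ, hφ⟩ := exists_schwartz_apply_zero_eq_one n
  exact tendsto_nhds_unique (hc φ hφ).2 (hd φ hφ).2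

theorem fresnelFunctional_eq_of_hasFresnelIntegral {ħ : ℝ} {f : 𝓢'(EuclideanSpace ℝ (Fin n), ℂ)}
    {u : EuclideanSpace ℝ (Fin n) →ᵇ ℂ} (hu : Represents f u) {c : ℂ}
    (hc : HasFresnelIntegral ħ u c) : fresnelFunctional ħ f = c := by
  rw [fresnelFunctional, toFunction_eq hu]
  exact (Classical.epsilon_spec (p := HasFresnelIntegral ħ u) ⟨c, hc⟩).unique hc

/-- The Fresnel functional in terms of the Gabor transform. -/
theorem fresnelFunctional_eq {ħ : ℝ} (hħ : 0 < ħ)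
    {g γ : 𝓢(EuclideanSpace ℝ (Fin n), ℂ)} (hγ : innerS γ g ≠ 0)
    {f : 𝓢'(EuclideanSpace ℝ (Fin n), ℂ)} (hf : f ∈ modSpace ħ n ∞ 1)
    (hgf : modNorm ħ ∞ 1 g f < ∞) :
    fresnelFunctional ħ f = (innerS γ g)⁻¹ *
      ∫ z : EuclideanSpace ℝ (Fin n) × EuclideanSpace ℝ (Fin n),
        stft ħ g f z.1 z.2 * fresnelCoeff ħ γ z.1 z.2 ∂(volume.prod volume) := by
  obtain ⟨u, hu⟩ := exists_represents hħ hf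
  exact fresnelFunctional_eq_of_hasFresnelIntegral hu
    (hasFresnelIntegral_of_represents hħ hγ hgf hu)

theorem hasFresnelIntegral_fresnelFunctional {ħ : ℝ} (hħ : 0 < ħ)
    {f : 𝓢'(EuclideanSpace ℝ (Fin n), ℂ)} (hf : f ∈ modSpace ħ n ∞ 1)
    {u : EuclideanSpace ℝ (Fin n) →ᵇ ℂ} (hu : Represents f u) :
    HasFresnelIntegral ħ u (fresnelFunctional ħ f) := by
  have ⟨g, hg, hgf⟩ := hf
  have h := hasFresnelIntegral_of_represents hħ (innerS_self_ne_zero hg) hgf hu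
  rwa [fresnelFunctional_eq_of_hasFresnelIntegral hu h]

theorem fresnelFunctional_add_smul {ħ : ℝ} (hħ : 0 < ħ) {f h : 𝓢'(EuclideanSpace ℝ (Fin n), ℂ)}
    (hf : f ∈ modSpace ħ n ∞ 1) (hh : h ∈ modSpace ħ n ∞ 1) (a b : ℂ) :
    fresnelFunctional ħ (a • f + b • h) =
      a * fresnelFunctional ħ f + b * fresnelFunctional ħ h := by
  obtain ⟨u, hu⟩ := exists_represents hħ hf
  obtain ⟨v, hv⟩ := exists_represents hħ hh
  have hw : Represents (a • f + b • h) (a • u + b • v) := by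
    intro φ
    change a * f φ + b * h φ = ∫ x, (a * u x + b * v x) * φ x
    rw [hu, hv, ← integral_const_mul, ← integral_const_mul,
      ← integral_add ((integrable_bcf_mul_schwartz u φ).const_mul a)
        ((integrable_bcf_mul_schwartz v φ).const_mul b)]
    congr 1
    ext x
    ring
  have hmem := add_smul_mem_modSpace hħ hf hh a b
  refine (hasFresnelIntegral_fresnelFunctional hħ hmem hw).unique fun φ hφ => ?_
  obtain ⟨hui, hul⟩ := hasFresnelIntegral_fresnelFunctional hħ hf hu φ hφ
  obtain ⟨hvi, hvl⟩ := hasFresnelIntegral_fresnelFunctional hħ hh hv φ hφ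
  have e : ∀ (ε : ℝ) (x : EuclideanSpace ℝ (Fin n)),
      Complex.exp (Complex.I * ((‖x‖ ^ 2 / (2 * ħ) : ℝ) : ℂ)) *
      (a • u + b • v : EuclideanSpace ℝ (Fin n) →ᵇ ℂ) x * φ (ε • x) =
      a * (Complex.exp (Complex.I * ((‖x‖ ^ 2 / (2 * ħ) : ℝ) : ℂ)) * u x * φ (ε • x)) +
      b * (Complex.exp (Complex.I * ((‖x‖ ^ 2 / (2 * ħ) : ℝ) : ℂ)) * v x * φ (ε • x)) := by
    intro ε x
    change _ * (a * u x + b * v x) * _ = _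
    ring
  simp_rw [e]
  constructor
  · filter_upwards [hui, hvi] with ε h1 h2
    exact (h1.const_mul a).add (h2.const_mul b)
  · refine ((hul.const_mul a).add (hvl.const_mul b)).congr' ?_
    filter_upwards [hui, hvi] with ε h1 h2
    rw [integral_add (h1.const_mul a) (h2.const_mul b), integral_const_mul, integral_const_mul]
    ring

/-! ### The upper bound -/

theorem conjS_phaseShift (ħ : ℝ) (γ : 𝓢(EuclideanSpace ℝ (Fin n), ℂ))
    (x ξ : EuclideanSpace ℝ (Fin n)) :
    conjS (phaseShift ħ x ξ γ) = phaseShift ħ x (-ξ) (conjS γ) := by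
  ext y
  simp only [conjS_apply, phaseShift_apply, map_mul, Complex.conj_ofReal, ← Complex.exp_conj,
    Complex.conj_I, inner_neg_left, neg_div, Complex.ofReal_neg]
  rw [neg_mul, mul_neg]

theorem stft_fresnelDist (ħ : ℝ) (γ : 𝓢(EuclideanSpace ℝ (Fin n), ℂ))
    (x ξ : EuclideanSpace ℝ (Fin n)) :
    stft ħ γ (fresnelDist ħ n) x ξ = fresnelCoeff ħ (conjS γ) x (-ξ) := by
  rw [stft, conjS_phaseShift, fresnelCoeff]

theorem lintegral_enorm_fresnelCoeff (ħ : ℝ) (γ : 𝓢(EuclideanSpace ℝ (Fin n), ℂ))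
    (ξ : EuclideanSpace ℝ (Fin n)) :
    ∫⁻ x, ‖fresnelCoeff ħ γ x ξ‖ₑ = ∫⁻ x, ‖fresnelCoeff ħ γ x 0‖ₑ := by
  rw [← lintegral_add_right_eq_self (fun x => ‖fresnelCoeff ħ γ x 0‖ₑ) ξ]
  refine lintegral_congr fun x => ?_
  rw [← ofReal_norm, ← ofReal_norm, norm_fresnelCoeff, norm_fresnelCoeff, add_zero]

/-- The coefficients depend in modulus only on x + ξ, so the inner L¹ norm is constant in ξ and the
essential supremum is that constant. -/
theorem modNorm_fresnelDist (ħ : ℝ) (γ : 𝓢(EuclideanSpace ℝ (Fin n), ℂ)) :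
    modNorm ħ 1 ∞ γ (fresnelDist ħ n) = ∫⁻ x, ‖fresnelCoeff ħ (conjS γ) x 0‖ₑ := by
  have h : ∀ ξ, eLpNorm (fun x => stft ħ γ (fresnelDist ħ n) x ξ) 1 volume =
      ∫⁻ x, ‖fresnelCoeff ħ (conjS γ) x 0‖ₑ := by
    intro ξ
    simp_rw [eLpNorm_one_eq_lintegral_enorm, stft_fresnelDist]
    exact lintegral_enorm_fresnelCoeff ħ (conjS γ) (-ξ)
  rw [modNorm]
  simp_rw [h]
  rw [eLpNorm_exponent_top, eLpNormEssSup]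
  simp only [enorm_eq_self]
  exact essSup_const' _

theorem innerS_conjS (g γ : 𝓢(EuclideanSpace ℝ (Fin n), ℂ)) (hg : conjS g = g) :
    innerS (conjS γ) g = innerS g γ := by
  rw [innerS, innerS]
  congr 1
  ext y
  rw [← conjS_apply g, hg, conjS_apply, mul_comm]

theorem conjS_gaussWindow {ħ : ℝ} (hħ : 0 < ħ) {q : Fin n → ℝ} (hq : ∀ j, 0 < q j) :
    conjS (gaussWindow hħ hq) = gaussWindow hħ hq := by
  ext y
  rw [conjS_apply, gaussWindow_apply, map_mul, Complex.conj_ofReal, Complex.conj_ofReal]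

/-- The duality bound for the Fresnel functional. -/
theorem enorm_fresnelFunctional_le {ħ : ℝ} (hħ : 0 < ħ)
    {g γ : 𝓢(EuclideanSpace ℝ (Fin n), ℂ)} (hg : conjS g = g) (hγ : innerS g γ ≠ 0)
    {f : 𝓢'(EuclideanSpace ℝ (Fin n), ℂ)} (hf : f ∈ modSpace ħ n ∞ 1)
    (hgf : modNorm ħ ∞ 1 g f < ∞) :
    ‖fresnelFunctional ħ f‖ₑ ≤
      modNorm ħ 1 ∞ γ (fresnelDist ħ n) / ‖innerS g γ‖ₑ * modNorm ħ ∞ 1 g f := by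
  -- The Gabor transform conjugates its window while the synthesis does not, so the synthesis window
  -- is the conjugate of γ; g being real keeps the inner product.
  have hγ' : innerS (conjS γ) g ≠ 0 := by rwa [innerS_conjS g γ hg]
  rw [fresnelFunctional_eq hħ hγ' hf hgf, enorm_mul, innerS_conjS g γ hg, enorm_inv hγ,
    modNorm_fresnelDist, modNorm_top_one, mul_comm (_ / _), ENNReal.div_eq_inv_mul, mul_left_comm]
  gcongr
  rw [mul_comm]
  exact (enorm_integral_stft_mul_le ħ g f).trans (lintegral_mul_kernel_le
    (measurable_supStft ħ g f) (continuous_fresnelCoeff ħ (conjS γ)).enorm.measurable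
    (fun ξ => (lintegral_enorm_fresnelCoeff ħ (conjS γ) ξ).le))

end Sjostrand

namespace Sjostrand

open scoped FourierTransform

variable {n : ℕ}

/-! ### Gaussian chirps -/

theorem integral_gaussian_euclidean {b : Fin n → ℂ} (hb : ∀ j, 0 < (b j).re) (c : Fin n → ℂ) :
    ∫ y : EuclideanSpace ℝ (Fin n),
      Complex.exp (-∑ j, b j * (y j : ℂ) ^ 2 + ∑ j, c j * (y j : ℂ)) =
      ∏ j, (Real.pi / b j) ^ (1 / 2 : ℂ) * Complex.exp (c j ^ 2 / (4 * b j)) := by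
  rw [← GaussianFourier.integral_cexp_neg_sum_mul_add hb c,
    ← (PiLp.volume_preserving_toLp (Fin n)).integral_comp
      (MeasurableEquiv.toLp 2 _).measurableEmbedding]

theorem norm_cpow_half (z : ℂ) : ‖z ^ (1 / 2 : ℂ)‖ = ‖z‖ ^ (1 / 2 : ℝ) := by
  rw [← Complex.norm_cpow_real]
  norm_num

theorem norm_cpow_neg_half_nat (z : ℂ) (n : ℕ) :
    ‖z ^ (-((n : ℂ) / 2))‖ = ‖z‖ ^ (-((n : ℝ) / 2)) := by
  rw [← Complex.norm_cpow_real]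
  norm_num

theorem norm_fresnel_const {ħ : ℝ} (hħ : 0 < ħ) (n : ℕ) :
    ‖(2 * Real.pi * Complex.I * ħ : ℂ) ^ (-((n : ℂ) / 2))‖ =
      (2 * Real.pi * ħ) ^ (-((n : ℝ) / 2)) := by
  rw [norm_cpow_neg_half_nat]
  simp [abs_of_pos Real.pi_pos, abs_of_pos hħ]

theorem rpow_neg_half_nat {ħ : ℝ} (hħ : 0 < ħ) (n : ℕ) :
    (2 * Real.pi * ħ) ^ (-((n : ℝ) / 2)) = ∏ _j : Fin n, (2 * Real.pi * ħ) ^ (-(1 / 2 : ℝ)) := by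
  rw [Finset.prod_const, Finset.card_univ, Fintype.card_fin, ← Real.rpow_natCast,
    ← Real.rpow_mul (by positivity)]
  congr 1
  ring

theorem chirpPhase_hasTemperateGrowth (ħ : ℝ) (n : ℕ) :
    (fun y : EuclideanSpace ℝ (Fin n) =>
      Complex.exp (Complex.I * ((-(‖y‖ ^ 2 / (2 * ħ)) : ℝ) : ℂ))).HasTemperateGrowth := by
  have h : (fun x : EuclideanSpace ℝ (Fin n) => -(‖x‖ ^ 2 / (2 * ħ))).HasTemperateGrowth := by
    simp only [div_eq_mul_inv]
    fun_prop
  exact hasTemperateGrowth_exp_I.comp h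

/-- The Gaussian chirp `y ↦ e^{-(a+i)|y|²/(2ħ)}`. -/
noncomputable def chirp {ħ : ℝ} (hħ : 0 < ħ) (n : ℕ) {a : ℝ} (ha : 0 < a) :
    𝓢(EuclideanSpace ℝ (Fin n), ℂ) :=
  (((2 * Real.pi * ħ) ^ (-((n : ℝ) / 2)) : ℝ) : ℂ)⁻¹ •
    SchwartzMap.smulLeftCLM ℂ (fun y : EuclideanSpace ℝ (Fin n) =>
      Complex.exp (Complex.I * ((-(‖y‖ ^ 2 / (2 * ħ)) : ℝ) : ℂ)))
      (gaussWindow hħ (q := fun _ : Fin n => a) fun _ => ha)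

theorem chirp_apply {ħ : ℝ} (hħ : 0 < ħ) {a : ℝ} (ha : 0 < a) (y : EuclideanSpace ℝ (Fin n)) :
    chirp hħ n ha y = Complex.exp (-∑ j, (a + Complex.I) / (2 * ħ) * (y j : ℂ) ^ 2) := by
  have hc : ((((2 * Real.pi * ħ) ^ (-((n : ℝ) / 2)) : ℝ) : ℂ)) ≠ 0 :=
    Complex.ofReal_ne_zero.2 (Real.rpow_pos_of_pos (by positivity) _).ne'
  change (((2 * Real.pi * ħ) ^ (-((n : ℝ) / 2)) : ℝ) : ℂ)⁻¹ * (SchwartzMap.smulLeftCLM ℂ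
    (fun y : EuclideanSpace ℝ (Fin n) =>
      Complex.exp (Complex.I * ((-(‖y‖ ^ 2 / (2 * ħ)) : ℝ) : ℂ)))
      (gaussWindow hħ (q := fun _ : Fin n => a) fun _ => ha)) y = _
  rw [SchwartzMap.smulLeftCLM_apply_apply (chirpPhase_hasTemperateGrowth ħ n), gaussWindow_apply,
    smul_eq_mul, mul_left_comm, inv_mul_cancel_left₀ hc, Complex.ofReal_exp, ← Complex.exp_add]
  congr 1
  rw [EuclideanSpace.norm_sq_eq]
  simp only [Real.norm_eq_abs, sq_abs]
  push_cast
  rw [← Finset.mul_sum, ← Finset.mul_sum]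
  have : (ħ : ℂ) ≠ 0 := Complex.ofReal_ne_zero.2 hħ.ne'
  field_simp
  ring

/-- The purpose of the chirp: it cancels the oscillation of F₊ and leaves a real Gaussian of width
governed by a. -/
theorem exp_mul_chirp {ħ : ℝ} (hħ : 0 < ħ) {a : ℝ} (ha : 0 < a) (y : EuclideanSpace ℝ (Fin n)) :
    Complex.exp (Complex.I * ((‖y‖ ^ 2 / (2 * ħ) : ℝ) : ℂ)) * chirp hħ n ha y =
      Complex.exp (-((a / (2 * ħ) : ℝ) : ℂ) * (‖y‖ : ℂ) ^ 2) := by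
  rw [chirp_apply, ← Complex.exp_add, ← Finset.mul_sum]
  congr 1
  rw [← Complex.ofReal_pow, EuclideanSpace.norm_sq_eq]
  simp only [Real.norm_eq_abs, sq_abs]
  push_cast
  have : (ħ : ℂ) ≠ 0 := Complex.ofReal_ne_zero.2 hħ.ne'
  field_simp
  ring

theorem norm_add_I (s : ℝ) : ‖(s : ℂ) + Complex.I‖ = (s ^ 2 + 1) ^ (1 / 2 : ℝ) := by
  rw [← Real.sqrt_eq_rpow, ← mul_one Complex.I, ← Complex.ofReal_one, mul_comm,
    Complex.norm_add_mul_I]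
  norm_num

/-- Origin of the fourth roots: a one-dimensional Gaussian integral is a square root, and |s + i| =
(s²+1)^{1/2}. -/
theorem norm_gaussian_factor {ħ : ℝ} (hħ : 0 < ħ) (s : ℝ) :
    ‖((Real.pi : ℂ) / ((s + Complex.I) / (2 * ħ))) ^ (1 / 2 : ℂ)‖ =
      (2 * Real.pi * ħ) ^ (1 / 2 : ℝ) * (s ^ 2 + 1) ^ (-(1 / 4) : ℝ) := by
  have hs : 0 < s ^ 2 + 1 := by positivity
  have e : ‖(Real.pi : ℂ) / ((s + Complex.I) / (2 * ħ))‖ =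
      (2 * Real.pi * ħ) * ((s ^ 2 + 1) ^ (1 / 2 : ℝ))⁻¹ := by
    rw [norm_div, norm_div, norm_add_I]
    simp only [norm_mul, Complex.norm_real, Complex.norm_ofNat, Real.norm_eq_abs,
      abs_of_pos Real.pi_pos, abs_of_pos hħ]
    field_simp
  rw [norm_cpow_half, e, Real.mul_rpow (by positivity) (by positivity), ← Real.rpow_neg hs.le,
    ← Real.rpow_mul hs.le]
  norm_num

/-! ### The norm of the Fresnel function for a chirped window -/

theorem norm_fresnelCoeff_chirp {ħ : ℝ} (hħ : 0 < ħ) {a : ℝ} (ha : 0 < a)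
    (x : EuclideanSpace ℝ (Fin n)) :
    ‖fresnelCoeff ħ (chirp hħ n ha) x 0‖ =
      (2 * Real.pi * ħ * a) ^ (-((n : ℝ) / 2)) * Real.exp (-(1 / (2 * ħ * a)) * ‖x‖ ^ 2) := by
  have hp := Real.pi_pos
  have e : (SchwartzMap.smulLeftCLM ℂ (fresnelFun ħ n) (chirp hħ n ha) :
      EuclideanSpace ℝ (Fin n) → ℂ) = fun y => (2 * Real.pi * Complex.I * ħ : ℂ) ^ (-((n : ℂ) / 2)) •
        Complex.exp (-((a / (2 * ħ) : ℝ) : ℂ) * (‖y‖ : ℂ) ^ 2) := by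
    ext y
    rw [SchwartzMap.smulLeftCLM_apply_apply (fresnelFun_hasTemperateGrowth ħ n), fresnelFun,
      smul_eq_mul, mul_assoc, exp_mul_chirp, smul_eq_mul]
  have hb : 0 < (((a / (2 * ħ) : ℝ) : ℂ)).re := by
    rw [Complex.ofReal_re]
    positivity
  rw [norm_fresnelCoeff, fresnelFourier, SchwartzMap.fourier_coe, e, add_zero]
  have hsm : ∀ (c : ℂ) (f : EuclideanSpace ℝ (Fin n) → ℂ) (w : EuclideanSpace ℝ (Fin n)),
      𝓕 (fun y => c • f y) w = c * 𝓕 f w := fun c f w => by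
    rw [Real.fourier_eq', Real.fourier_eq', ← integral_const_mul]
    simp only [smul_eq_mul, mul_left_comm c]
  rw [hsm, fourier_gaussian_innerProductSpace hb, norm_mul, norm_mul,
    norm_fresnel_const hħ, Complex.norm_real, Real.norm_of_nonneg (by positivity)]
  have h1 : ‖((Real.pi : ℂ) / ((a / (2 * ħ) : ℝ) : ℂ)) ^
      ((Module.finrank ℝ (EuclideanSpace ℝ (Fin n)) : ℂ) / 2)‖ =
      (2 * Real.pi * ħ / a) ^ ((n : ℝ) / 2) := by
    have h2 : ((Real.pi : ℂ) / ((a / (2 * ħ) : ℝ) : ℂ)) = ((2 * Real.pi * ħ / a : ℝ) : ℂ) := by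
      rw [← Complex.ofReal_div]
      congr 1
      field_simp
    rw [h2, finrank_euclideanSpace, Fintype.card_fin, Complex.norm_cpow_eq_rpow_re_of_pos (by positivity)]
    congr 1
    rw [show ((n : ℂ) / 2) = (((n : ℝ) / 2 : ℝ) : ℂ) by push_cast; rfl, Complex.ofReal_re]
  have h3 : ‖Complex.exp (-(Real.pi : ℂ) ^ 2 * (‖-((2 * Real.pi * ħ)⁻¹ • x)‖ : ℂ) ^ 2 /
      ((a / (2 * ħ) : ℝ) : ℂ))‖ = Real.exp (-(1 / (2 * ħ * a)) * ‖x‖ ^ 2) := by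
    rw [Complex.norm_exp, norm_neg, norm_smul, Real.norm_of_nonneg (by positivity)]
    congr 1
    rw [show (-(Real.pi : ℂ) ^ 2 * (((2 * Real.pi * ħ)⁻¹ * ‖x‖ : ℝ) : ℂ) ^ 2 /
      ((a / (2 * ħ) : ℝ) : ℂ)) = ((-Real.pi ^ 2 * ((2 * Real.pi * ħ)⁻¹ * ‖x‖) ^ 2 /
        (a / (2 * ħ)) : ℝ) : ℂ) by push_cast; rfl, Complex.ofReal_re]
    field_simp
  rw [h1, h3]
  have h4 : (2 * Real.pi * ħ) ^ (-((n : ℝ) / 2)) * ((2 * Real.pi * ħ) ^ (-((n : ℝ) / 2)) *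
      (2 * Real.pi * ħ / a) ^ ((n : ℝ) / 2)) = (2 * Real.pi * ħ * a) ^ (-((n : ℝ) / 2)) := by
    rw [Real.div_rpow (by positivity) ha.le, Real.mul_rpow (by positivity) ha.le,
      Real.rpow_neg (by positivity), Real.rpow_neg ha.le]
    field_simp
  rw [← h4]
  ring

theorem conjS_conjS (g : 𝓢(EuclideanSpace ℝ (Fin n), ℂ)) : conjS (conjS g) = g := by
  ext y
  simp [conjS_apply]

/-- The product of F₊ and the chirp has Gaussian Fourier modulus, whose mass is 1 in this
normalization whatever a is. Only the inner product with the window then depends on a. -/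
theorem modNorm_fresnelDist_chirp {ħ : ℝ} (hħ : 0 < ħ) {a : ℝ} (ha : 0 < a) :
    modNorm ħ 1 ∞ (conjS (chirp hħ n ha)) (fresnelDist ħ n) = 1 := by
  have hp := Real.pi_pos
  rw [modNorm_fresnelDist, conjS_conjS]
  have e : ∀ x, ‖fresnelCoeff ħ (chirp hħ n ha) x 0‖ₑ = ENNReal.ofReal
      ((2 * Real.pi * ħ * a) ^ (-((n : ℝ) / 2)) * Real.exp (-(1 / (2 * ħ * a)) * ‖x‖ ^ 2)) :=
    fun x => by rw [← ofReal_norm, norm_fresnelCoeff_chirp]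
  simp_rw [e]
  have hb : 0 < 1 / (2 * ħ * a) := by positivity
  have hint : Integrable fun x : EuclideanSpace ℝ (Fin n) =>
      Real.exp (-(1 / (2 * ħ * a)) * ‖x‖ ^ 2) := by
    -- A non-integrable function would have integral 0, against the positive value of the Gaussian
    -- formula.
    by_contra hni
    have h := GaussianFourier.integral_rexp_neg_mul_sq_norm (V := EuclideanSpace ℝ (Fin n)) hb
    rw [integral_undef hni] at h
    have : 0 < (Real.pi / (1 / (2 * ħ * a))) ^
      ((Module.finrank ℝ (EuclideanSpace ℝ (Fin n)) : ℝ) / 2) := by positivity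
    linarith
  rw [← ofReal_integral_eq_lintegral_ofReal (hint.const_mul _)
    (ae_of_all _ fun x => by positivity), integral_const_mul,
    GaussianFourier.integral_rexp_neg_mul_sq_norm hb, finrank_euclideanSpace, Fintype.card_fin,
    ← ENNReal.ofReal_one]
  congr 1
  have h1 : Real.pi / (1 / (2 * ħ * a)) = 2 * Real.pi * ħ * a := by
    field_simp
  rw [h1, Real.rpow_neg (by positivity)]
  exact inv_mul_cancel₀ (by positivity)

theorem norm_innerS_gaussWindow_chirp {ħ : ℝ} (hħ : 0 < ħ) {q : Fin n → ℝ} (hq : ∀ j, 0 < q j)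
    {a : ℝ} (ha : 0 < a) :
    ‖innerS (gaussWindow hħ hq) (conjS (chirp hħ n ha))‖ =
      ∏ j, ((q j + a) ^ 2 + 1) ^ (-(1 / 4) : ℝ) := by
  have hp := Real.pi_pos
  have e : innerS (gaussWindow hħ hq) (conjS (chirp hħ n ha)) =
      (((2 * Real.pi * ħ) ^ (-((n : ℝ) / 2)) : ℝ) : ℂ) *
      ∏ j, (Real.pi / ((((q j + a : ℝ) : ℂ) + Complex.I) / (2 * ħ))) ^ (1 / 2 : ℂ) := by
    have hb : ∀ j, 0 < ((((q j + a : ℝ) : ℂ) + Complex.I) / (2 * ħ)).re := by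
      intro j
      rw [show (2 * (ħ : ℂ)) = ((2 * ħ : ℝ) : ℂ) by push_cast; rfl, Complex.div_ofReal_re]
      simp only [Complex.add_re, Complex.ofReal_re, Complex.I_re, add_zero]
      have := hq j
      positivity
    have h := integral_gaussian_euclidean hb 0
    simp only [Pi.zero_apply, zero_mul, Finset.sum_const_zero, add_zero, ne_eq, OfNat.ofNat_ne_zero,
      not_false_eq_true, zero_pow, zero_div, Complex.exp_zero, mul_one] at h
    rw [← h, ← integral_const_mul, innerS]
    congr 1
    ext y
    rw [conjS_apply, Complex.conj_conj, gaussWindow_apply, chirp_apply, mul_assoc,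
      Complex.ofReal_exp, ← Complex.exp_add]
    congr 2
    push_cast
    rw [← neg_add, Finset.mul_sum, ← Finset.sum_add_distrib]
    congr 1
    refine Finset.sum_congr rfl fun j _ => ?_
    have : (ħ : ℂ) ≠ 0 := Complex.ofReal_ne_zero.2 hħ.ne'
    field_simp
    ring
  rw [e, norm_mul, norm_prod, Complex.norm_real, Real.norm_of_nonneg (by positivity),
    rpow_neg_half_nat hħ, ← Finset.prod_mul_distrib]
  refine Finset.prod_congr rfl fun j _ => ?_
  rw [norm_gaussian_factor hħ, ← mul_assoc, ← Real.rpow_add (by positivity)]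
  norm_num

end Sjostrand

namespace Sjostrand

variable {n : ℕ}

/-! ### Chirps almost attain the norm of the Fresnel functional -/

/-- The left side is the real exponent of one coordinate factor of the Gabor transform of the chirp.
It differs from the right side by minus a multiple of a square, which vanishes at x = -ξ/(1+a(q+a));
the bound is thus the maximum over x. -/
theorem chirp_exponent_le {ħ : ℝ} (hħ : 0 < ħ) {q a : ℝ} (hq : 0 < q) (ha : 0 < a) (x ξ : ℝ) :
    -(q * x ^ 2) / (2 * ħ) + ((((q * x : ℝ) - (ξ : ℝ) * Complex.I) / ħ) ^ 2 /
      (4 * ((((q + a : ℝ) : ℂ) + Complex.I) / (2 * ħ)))).re ≤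
      -(a / (2 * ħ * (1 + a * (q + a)))) * ξ ^ 2 := by
  set s := q + a with hs
  -- P and R are the real and imaginary parts of (qx - iξ)²/(s + i).
  set P := (s * (q ^ 2 * x ^ 2 - ξ ^ 2) - 2 * (q * x * ξ)) / (s ^ 2 + 1) with hP
  set R := (-(q ^ 2 * x ^ 2 - ξ ^ 2) - 2 * (q * x * ξ) * s) / (s ^ 2 + 1) with hR
  have hD : 0 < s ^ 2 + 1 := by positivity
  have hne : (s : ℂ) + Complex.I ≠ 0 := fun h => by
    have := congrArg Complex.im h
    simp at this
  have hre : q ^ 2 * x ^ 2 - ξ ^ 2 = P * s - R := by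
    rw [hP, hR]
    field_simp
    ring
  have him : -(2 * (q * x * ξ)) = P + R * s := by
    rw [hP, hR]
    field_simp
    ring
  have key : (((q * x : ℝ) : ℂ) - (ξ : ℝ) * Complex.I) ^ 2 =
      ((P : ℂ) + R * Complex.I) * (s + Complex.I) := by
    apply Complex.ext
    · simp [pow_two]
      linear_combination hre
    · simp [pow_two]
      linear_combination him
  have hħ' : (ħ : ℂ) ≠ 0 := Complex.ofReal_ne_zero.2 hħ.ne'
  have e : (((q * x : ℝ) - (ξ : ℝ) * Complex.I) / ħ) ^ 2 /
      (4 * (((s : ℂ) + Complex.I) / (2 * ħ))) =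
      ((P / (2 * ħ) : ℝ) : ℂ) + ((R / (2 * ħ) : ℝ) : ℂ) * Complex.I := by
    rw [div_pow, key]
    push_cast
    field_simp
    ring
  rw [e]
  simp only [Complex.add_re, Complex.ofReal_re, Complex.mul_re, Complex.I_re, mul_zero,
    Complex.ofReal_im, Complex.I_im, mul_one, sub_self, add_zero]
  have hs0 : 0 < s := by positivity
  have hm : 0 < 1 + a * s := by positivity
  have hdiff : -(q * x ^ 2) / (2 * ħ) + P / (2 * ħ) - -(a / (2 * ħ * (1 + a * s))) * ξ ^ 2 =
      -(q * ((1 + a * s) * x + ξ) ^ 2 / (2 * ħ * (1 + a * s) * (s ^ 2 + 1))) := by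
    rw [hP]
    have : q = s - a := by rw [hs]; ring
    rw [this]
    field_simp
    ring
  have : 0 ≤ q * ((1 + a * s) * x + ξ) ^ 2 / (2 * ħ * (1 + a * s) * (s ^ 2 + 1)) := by positivity
  linarith

/-- The Gaussian chirp as a tempered distribution. -/
noncomputable def chirpDist {ħ : ℝ} (hħ : 0 < ħ) (n : ℕ) {a : ℝ} (ha : 0 < a) :
    𝓢'(EuclideanSpace ℝ (Fin n), ℂ) :=
  SchwartzMap.toTemperedDistributionCLM (EuclideanSpace ℝ (Fin n)) ℂ volume (chirp hħ n ha)

theorem chirpDist_apply {ħ : ℝ} (hħ : 0 < ħ) {a : ℝ} (ha : 0 < a)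
    (φ : 𝓢(EuclideanSpace ℝ (Fin n), ℂ)) :
    chirpDist hħ n ha φ = ∫ y, φ y * chirp hħ n ha y := rfl

/-- The transform is an explicit Gaussian integral that factors over the coordinates;
`chirp_exponent_le` removes x from each factor. -/
theorem norm_stft_chirpDist_le {ħ : ℝ} (hħ : 0 < ħ) {q : Fin n → ℝ} (hq : ∀ j, 0 < q j)
    {a : ℝ} (ha : 0 < a) (x ξ : EuclideanSpace ℝ (Fin n)) :
    ‖stft ħ (gaussWindow hħ hq) (chirpDist hħ n ha) x ξ‖ ≤
      (∏ j, (2 * Real.pi * ħ) ^ (-(1 / 2) : ℝ) * ((q j + a) ^ 2 + 1) ^ (-(1 / 4) : ℝ)) *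
        Real.exp (-∑ j, a / (2 * ħ * (1 + a * (q j + a))) * ξ j ^ 2) := by
  have hp := Real.pi_pos
  have hħ' : (ħ : ℂ) ≠ 0 := Complex.ofReal_ne_zero.2 hħ.ne'
  have hb : ∀ j, 0 < ((((q j + a : ℝ) : ℂ) + Complex.I) / (2 * ħ)).re := by
    intro j
    rw [show (2 * (ħ : ℂ)) = ((2 * ħ : ℝ) : ℂ) by push_cast; rfl, Complex.div_ofReal_re]
    simp only [Complex.add_re, Complex.ofReal_re, Complex.I_re, add_zero]
    have := hq j
    positivity
  have e : stft ħ (gaussWindow hħ hq) (chirpDist hħ n ha) x ξ =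
      (((2 * Real.pi * ħ) ^ (-((n : ℝ) / 2)) : ℝ) : ℂ) *
      (((2 * Real.pi * ħ) ^ (-((n : ℝ) / 2)) : ℝ) : ℂ) *
      ((Real.exp (∑ j, -(q j * x j ^ 2) / (2 * ħ)) : ℝ) : ℂ) *
      ∏ j, (Real.pi / ((((q j + a : ℝ) : ℂ) + Complex.I) / (2 * ħ))) ^ (1 / 2 : ℂ) *
        Complex.exp ((((q j * x j : ℝ) - (ξ j : ℝ) * Complex.I) / ħ) ^ 2 /
          (4 * ((((q j + a : ℝ) : ℂ) + Complex.I) / (2 * ħ)))) := by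
    rw [← integral_gaussian_euclidean hb
      (fun j => ((q j * x j : ℝ) - (ξ j : ℝ) * Complex.I) / ħ), ← integral_const_mul, stft,
      chirpDist_apply]
    congr 1
    ext y
    have hc : starRingEnd ℂ (Complex.exp (Complex.I * ((inner ℝ ξ y / ħ : ℝ) : ℂ))) =
        Complex.exp (-(∑ j, Complex.I * (ξ j * y j) / ħ)) := by
      have hi : inner ℝ ξ y = ∑ j, ξ j * y j := by
        rw [PiLp.inner_apply]
        exact Finset.sum_congr rfl fun j _ => mul_comm _ _
      rw [← Complex.exp_conj, map_mul, Complex.conj_I, Complex.conj_ofReal, hi]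
      congr 1
      push_cast
      rw [← Finset.sum_div, ← Finset.mul_sum]
      ring
    rw [conjS_apply, phaseShift_apply, map_mul, map_mul, Complex.conj_ofReal, hc,
      gaussWindow_apply, map_mul, Complex.conj_ofReal, Complex.conj_ofReal, chirp_apply]
    have h : Complex.exp (-(∑ j, Complex.I * (ξ j * y j) / ħ)) *
        ((Real.exp (-(1 / (2 * ħ) * ∑ j, q j * (y - x) j ^ 2)) : ℝ) : ℂ) *
        Complex.exp (-∑ j, (a + Complex.I) / (2 * ħ) * (y j : ℂ) ^ 2) =
        ((Real.exp (∑ j, -(q j * x j ^ 2) / (2 * ħ)) : ℝ) : ℂ) *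
        Complex.exp (-∑ j, (((q j + a : ℝ) : ℂ) + Complex.I) / (2 * ħ) * (y j : ℂ) ^ 2 +
          ∑ j, ((q j * x j : ℝ) - (ξ j : ℝ) * Complex.I) / ħ * (y j : ℂ)) := by
      rw [Complex.ofReal_exp, Complex.ofReal_exp, ← Complex.exp_add, ← Complex.exp_add,
        ← Complex.exp_add]
      congr 1
      push_cast
      rw [Finset.mul_sum, ← Finset.sum_neg_distrib, ← Finset.sum_neg_distrib,
        ← Finset.sum_neg_distrib, ← Finset.sum_neg_distrib, ← Finset.sum_add_distrib,
        ← Finset.sum_add_distrib, ← Finset.sum_add_distrib, ← Finset.sum_add_distrib]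
      refine Finset.sum_congr rfl fun j _ => ?_
      simp only [PiLp.sub_apply, Complex.ofReal_sub]
      field_simp
      ring
    linear_combination ((((2 * Real.pi * ħ) ^ (-((n : ℝ) / 2)) : ℝ) : ℂ) *
      (((2 * Real.pi * ħ) ^ (-((n : ℝ) / 2)) : ℝ) : ℂ)) * h
  have hexp : Real.exp (∑ j, -(q j * x j ^ 2) / (2 * ħ)) =
      ∏ j, Real.exp (-(q j * x j ^ 2) / (2 * ħ)) := Real.exp_sum _ _
  have hexp' : Real.exp (-∑ j, a / (2 * ħ * (1 + a * (q j + a))) * ξ j ^ 2) =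
      ∏ j, Real.exp (-(a / (2 * ħ * (1 + a * (q j + a)))) * ξ j ^ 2) := by
    rw [← Real.exp_sum]
    congr 1
    simp only [neg_mul, Finset.sum_neg_distrib]
  rw [e, norm_mul, norm_mul, norm_mul, norm_prod, Complex.norm_real, Complex.norm_real,
    Real.norm_of_nonneg (by positivity), Real.norm_of_nonneg (by positivity), hexp, hexp',
    rpow_neg_half_nat hħ, ← Finset.prod_mul_distrib, ← Finset.prod_mul_distrib,
    ← Finset.prod_mul_distrib, ← Finset.prod_mul_distrib]
  refine Finset.prod_le_prod (fun j _ => by positivity) fun j _ => ?_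
  rw [norm_mul, norm_gaussian_factor hħ, Complex.norm_exp]
  have h1 := Real.exp_le_exp.2 (chirp_exponent_le hħ (hq j) ha (x j) (ξ j))
  rw [Real.exp_add] at h1
  have h2 : (2 * Real.pi * ħ) ^ (-(1 / 2) : ℝ) * (2 * Real.pi * ħ) ^ (1 / 2 : ℝ) = 1 := by
    rw [← Real.rpow_add (by positivity)]
    norm_num
  set E := ((((q j * x j : ℝ) - (ξ j : ℝ) * Complex.I) / ħ) ^ 2 /
          (4 * ((((q j + a : ℝ) : ℂ) + Complex.I) / (2 * ħ)))).re
  calc _ = ((2 * Real.pi * ħ) ^ (-(1 / 2) : ℝ) * (2 * Real.pi * ħ) ^ (1 / 2 : ℝ)) *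
        ((2 * Real.pi * ħ) ^ (-(1 / 2) : ℝ) * ((q j + a) ^ 2 + 1) ^ (-(1 / 4) : ℝ)) *
        (Real.exp (-(q j * x j ^ 2) / (2 * ħ)) * Real.exp E) := by ring
    _ ≤ _ := by
      rw [h2, one_mul]
      gcongr

theorem lintegral_gaussian_euclidean {k : Fin n → ℝ} (hk : ∀ j, 0 < k j) :
    ∫⁻ ξ : EuclideanSpace ℝ (Fin n), ENNReal.ofReal (Real.exp (-∑ j, k j * ξ j ^ 2)) =
      ENNReal.ofReal (∏ j, (Real.pi / k j) ^ (1 / 2 : ℝ)) := by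
  have hp := Real.pi_pos
  have h : ∫ ξ : EuclideanSpace ℝ (Fin n), Real.exp (-∑ j, k j * ξ j ^ 2) =
      ∏ j, (Real.pi / k j) ^ (1 / 2 : ℝ) := by
    have h1 := integral_gaussian_euclidean (n := n) (b := fun j => (k j : ℂ))
      (fun j => by simpa using hk j) 0
    simp only [Pi.zero_apply, zero_mul, Finset.sum_const_zero, add_zero, ne_eq, OfNat.ofNat_ne_zero,
      not_false_eq_true, zero_pow, zero_div, Complex.exp_zero, mul_one] at h1
    apply Complex.ofReal_injective
    rw [← integral_complex_ofReal]
    push_cast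
    rw [h1]
    refine Finset.prod_congr rfl fun j _ => ?_
    have := hk j
    rw [Complex.ofReal_cpow (by positivity)]
    push_cast
    rfl
  rw [← h, ofReal_integral_eq_lintegral_ofReal _ (ae_of_all _ fun x => by positivity)]
  by_contra hni
  rw [integral_undef hni] at h
  have : 0 < ∏ j, (Real.pi / k j) ^ (1 / 2 : ℝ) :=
    Finset.prod_pos fun j _ => by have := hk j; positivity
  linarith

/-- The bound grows like a^{-n/2} as a ↓ 0, the same rate as the Fresnel functional of the chirp, so
the quotient keeps a nonzero limit. -/
theorem modNorm_chirpDist_le {ħ : ℝ} (hħ : 0 < ħ) {q : Fin n → ℝ} (hq : ∀ j, 0 < q j)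
    {a : ℝ} (ha : 0 < a) :
    modNorm ħ ∞ 1 (gaussWindow hħ hq) (chirpDist hħ n ha) ≤
      ENNReal.ofReal (∏ j, ((q j + a) ^ 2 + 1) ^ (-(1 / 4) : ℝ) *
        ((1 + a * (q j + a)) / a) ^ (1 / 2 : ℝ)) := by
  have hp := Real.pi_pos
  have hk : ∀ j, 0 < a / (2 * ħ * (1 + a * (q j + a))) := fun j => by
    have := hq j
    positivity
  set A := ∏ j, (2 * Real.pi * ħ) ^ (-(1 / 2) : ℝ) * ((q j + a) ^ 2 + 1) ^ (-(1 / 4) : ℝ) with hA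
  have hA0 : 0 ≤ A := Finset.prod_nonneg fun j _ => by positivity
  rw [modNorm_top_one]
  calc ∫⁻ ξ, supStft ħ (gaussWindow hħ hq) (chirpDist hħ n ha) ξ
      ≤ ∫⁻ ξ : EuclideanSpace ℝ (Fin n), ENNReal.ofReal A *
        ENNReal.ofReal (Real.exp (-∑ j, a / (2 * ħ * (1 + a * (q j + a))) * ξ j ^ 2)) := by
        refine lintegral_mono fun ξ => iSup_le fun x => ?_
        rw [← ofReal_norm, ← ENNReal.ofReal_mul hA0]
        exact ENNReal.ofReal_le_ofReal (norm_stft_chirpDist_le hħ hq ha x ξ)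
    _ = _ := by
        rw [lintegral_const_mul' _ _ ENNReal.ofReal_ne_top, lintegral_gaussian_euclidean hk,
          ← ENNReal.ofReal_mul hA0, hA, ← Finset.prod_mul_distrib]
        congr 1
        refine Finset.prod_congr rfl fun j _ => ?_
        have hm : 0 < 1 + a * (q j + a) := by
          have := hq j
          positivity
        have e : Real.pi / (a / (2 * ħ * (1 + a * (q j + a)))) =
            (2 * Real.pi * ħ) * ((1 + a * (q j + a)) / a) := by
          field_simp
        have h2 : (2 * Real.pi * ħ) ^ (-(1 / 2) : ℝ) * (2 * Real.pi * ħ) ^ (1 / 2 : ℝ) = 1 := by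
          rw [← Real.rpow_add (by positivity)]
          norm_num
        rw [e, Real.mul_rpow (x := 2 * Real.pi * ħ) (by positivity) (by positivity)]
        linear_combination (((q j + a) ^ 2 + 1) ^ (-(1 / 4) : ℝ) *
          ((1 + a * (q j + a)) / a) ^ (1 / 2 : ℝ)) * h2

/-- The Fresnel integral of a Schwartz function is a convergent integral. -/
theorem hasFresnelIntegral_schwartz (ħ : ℝ) (h : 𝓢(EuclideanSpace ℝ (Fin n), ℂ)) :
    HasFresnelIntegral ħ h ((2 * Real.pi * Complex.I * ħ : ℂ) ^ (-((n : ℂ) / 2)) *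
      ∫ x, Complex.exp (Complex.I * ((‖x‖ ^ 2 / (2 * ħ) : ℝ) : ℂ)) * h x) := by
  intro φ hφ
  have hn : ∀ t : ℝ, ‖Complex.exp (Complex.I * (t : ℂ))‖ = 1 := fun t => by
    rw [mul_comm, Complex.norm_exp_ofReal_mul_I]
  have hcont : Continuous fun x : EuclideanSpace ℝ (Fin n) =>
      Complex.exp (Complex.I * ((‖x‖ ^ 2 / (2 * ħ) : ℝ) : ℂ)) * h x := by
    have := h.continuous
    fun_prop
  have hφc := φ.continuous
  obtain ⟨C, hC⟩ : ∃ C : ℝ, ∀ x, ‖φ x‖ ≤ C :=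
    ⟨_, fun x => φ.toBoundedContinuousFunction.norm_coe_le_norm x⟩
  have hb : ∀ (ε : ℝ) (x : EuclideanSpace ℝ (Fin n)),
      ‖Complex.exp (Complex.I * ((‖x‖ ^ 2 / (2 * ħ) : ℝ) : ℂ)) * h x * φ (ε • x)‖ ≤ C * ‖h x‖ := by
    intro ε x
    rw [norm_mul, norm_mul, hn, one_mul, mul_comm]
    gcongr
    exact hC _
  have hint : Integrable fun x => C * ‖h x‖ := (h.integrable (μ := volume)).norm.const_mul C
  have hm : ∀ ε : ℝ, AEStronglyMeasurable (fun x : EuclideanSpace ℝ (Fin n) =>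
      Complex.exp (Complex.I * ((‖x‖ ^ 2 / (2 * ħ) : ℝ) : ℂ)) * h x * φ (ε • x)) := fun ε =>
    (hcont.mul (hφc.comp (f := fun x => ε • x) (continuous_const_smul ε))).aestronglyMeasurable
  have hlim : ∀ x : EuclideanSpace ℝ (Fin n), Tendsto (fun ε : ℝ =>
      Complex.exp (Complex.I * ((‖x‖ ^ 2 / (2 * ħ) : ℝ) : ℂ)) * h x * φ (ε • x)) (𝓝[>] 0)
      (𝓝 (Complex.exp (Complex.I * ((‖x‖ ^ 2 / (2 * ħ) : ℝ) : ℂ)) * h x)) := by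
    intro x
    have hc : Continuous fun ε : ℝ => φ (ε • x) :=
      hφc.comp (f := fun ε : ℝ => ε • x) (continuous_id.smul continuous_const)
    have h1 := (hc.tendsto 0).mono_left (nhdsWithin_le_nhds (s := Set.Ioi 0))
    rw [zero_smul, hφ] at h1
    simpa only [mul_one] using
      h1.const_mul (Complex.exp (Complex.I * ((‖x‖ ^ 2 / (2 * ħ) : ℝ) : ℂ)) * h x)
  refine ⟨Eventually.of_forall fun ε => hint.mono' (hm ε) (ae_of_all _ (hb ε)), ?_⟩
  have := tendsto_integral_filter_of_dominated_convergence _ (Eventually.of_forall hm)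
      (Eventually.of_forall fun ε => ae_of_all _ (hb ε)) hint (ae_of_all _ hlim)
  exact this.const_mul _

theorem norm_fresnelFunctional_chirpDist {ħ : ℝ} (hħ : 0 < ħ) {a : ℝ} (ha : 0 < a) :
    ‖fresnelFunctional ħ (chirpDist hħ n ha)‖ = a ^ (-((n : ℝ) / 2)) := by
  have hp := Real.pi_pos
  have hu : Represents (chirpDist hħ n ha) (chirp hħ n ha).toBoundedContinuousFunction := by
    intro φ
    rw [chirpDist_apply]
    exact integral_congr_ae (ae_of_all _ fun y => mul_comm (φ y) (chirp hħ n ha y))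
  have hF := hasFresnelIntegral_schwartz ħ (chirp hħ n ha)
  rw [fresnelFunctional_eq_of_hasFresnelIntegral hu hF]
  have hb : 0 < (((a / (2 * ħ) : ℝ) : ℂ)).re := by
    rw [Complex.ofReal_re]
    positivity
  simp_rw [exp_mul_chirp]
  rw [GaussianFourier.integral_cexp_neg_mul_sq_norm hb, norm_mul, norm_fresnel_const hħ,
    finrank_euclideanSpace, Fintype.card_fin]
  have h2 : ((Real.pi : ℂ) / ((a / (2 * ħ) : ℝ) : ℂ)) = ((2 * Real.pi * ħ / a : ℝ) : ℂ) := by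
    rw [← Complex.ofReal_div]
    congr 1
    field_simp
  rw [h2, Complex.norm_cpow_eq_rpow_re_of_pos (by positivity),
    show ((n : ℂ) / 2) = (((n : ℝ) / 2 : ℝ) : ℂ) by push_cast; rfl, Complex.ofReal_re,
    Real.div_rpow (by positivity) ha.le, Real.rpow_neg (by positivity), Real.rpow_neg ha.le]
  field_simp

end Sjostrand

namespace Sjostrand

variable {n : ℕ}

/-! ### The norm of the Fresnel functional -/

theorem chirpDist_mem_modSpace {ħ : ℝ} (hħ : 0 < ħ) {a : ℝ} (ha : 0 < a) :
    chirpDist hħ n ha ∈ modSpace ħ n ∞ 1 :=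
  ⟨gaussWindow hħ (q := fun _ => 1) fun _ => one_pos, gaussWindow_ne_zero hħ _,
    (modNorm_chirpDist_le hħ _ ha).trans_lt ENNReal.ofReal_lt_top⟩

/-- The Fresnel functional is linear, hence zero at 0, but takes a value of modulus a^{-n/2} on the
chirp. -/
theorem chirpDist_ne_zero {ħ : ℝ} (hħ : 0 < ħ) {a : ℝ} (ha : 0 < a) :
    chirpDist hħ n ha ≠ 0 := by
  intro h
  have h1 := norm_fresnelFunctional_chirpDist (n := n) hħ ha
  have hm := chirpDist_mem_modSpace (n := n) hħ ha
  have h2 := fresnelFunctional_add_smul hħ hm hm 0 0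
  have h3 : (0 : ℂ) • chirpDist hħ n ha + (0 : ℂ) • chirpDist hħ n ha = chirpDist hħ n ha := by
    ext φ
    change (0 : ℂ) * chirpDist hħ n ha φ + 0 * chirpDist hħ n ha φ = chirpDist hħ n ha φ
    rw [h, zero_mul, add_zero]
    rfl
  rw [h3, zero_mul, add_zero] at h2
  rw [h2, norm_zero] at h1
  exact (Real.rpow_pos_of_pos ha _).ne h1

theorem ofReal_prod_le_ratio_chirpDist {ħ : ℝ} (hħ : 0 < ħ) {q : Fin n → ℝ} (hq : ∀ j, 0 < q j)
    {a : ℝ} (ha : 0 < a) :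
    ENNReal.ofReal (∏ j, ((q j + a) ^ 2 + 1) ^ ((1 : ℝ) / 4) *
      (1 + a * (q j + a)) ^ (-(1 / 2) : ℝ)) ≤
      ‖fresnelFunctional ħ (chirpDist hħ n ha)‖ₑ /
        modNorm ħ ∞ 1 (gaussWindow hħ hq) (chirpDist hħ n ha) := by
  have hm : ∀ j, 0 < 1 + a * (q j + a) := fun j => by
    have := hq j
    positivity
  have hM : 0 < ∏ j, ((q j + a) ^ 2 + 1) ^ (-(1 / 4) : ℝ) *
        ((1 + a * (q j + a)) / a) ^ (1 / 2 : ℝ) := Finset.prod_pos fun j _ => by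
    have := hm j
    positivity
  refine le_trans ?_ (ENNReal.div_le_div_left (modNorm_chirpDist_le hħ hq ha) _)
  rw [← ofReal_norm, norm_fresnelFunctional_chirpDist, ← ENNReal.ofReal_div_of_pos hM]
  refine ENNReal.ofReal_le_ofReal (le_of_eq ?_)
  have hn : a ^ (-((n : ℝ) / 2)) = ∏ _j : Fin n, a ^ (-(1 / 2 : ℝ)) := by
    rw [Finset.prod_const, Finset.card_univ, Fintype.card_fin, ← Real.rpow_natCast,
      ← Real.rpow_mul ha.le]
    congr 1
    ring
  rw [hn, ← Finset.prod_div_distrib]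
  refine Finset.prod_congr rfl fun j _ => ?_
  have hmj := hm j
  have hD : 0 < (q j + a) ^ 2 + 1 := by positivity
  rw [Real.div_rpow hmj.le ha.le, Real.rpow_neg hmj.le, Real.rpow_neg hD.le, Real.rpow_neg ha.le]
  field_simp

theorem tendsto_ofReal_of_continuousAt {F : ℝ → ℝ} (hF : ContinuousAt F 0) :
    Tendsto (fun a => ENNReal.ofReal (F a)) (𝓝[>] 0) (𝓝 (ENNReal.ofReal (F 0))) :=
  (ENNReal.continuous_ofReal.continuousAt.comp hF).tendsto.mono_left nhdsWithin_le_nhds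

theorem ofReal_prod_le_iSup_ratio {ħ : ℝ} (hħ : 0 < ħ) {q : Fin n → ℝ} (hq : ∀ j, 0 < q j) :
    ENNReal.ofReal (∏ j, (q j ^ 2 + 1) ^ ((1 : ℝ) / 4)) ≤
      ⨆ (f : 𝓢'(EuclideanSpace ℝ (Fin n), ℂ)) (_ : f ∈ modSpace ħ n ∞ 1) (_ : f ≠ 0),
        ‖fresnelFunctional ħ f‖ₑ / modNorm ħ ∞ 1 (gaussWindow hħ hq) f := by
  have hF : ContinuousAt (fun a : ℝ => ∏ j, ((q j + a) ^ 2 + 1) ^ ((1 : ℝ) / 4) *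
      (1 + a * (q j + a)) ^ (-(1 / 2) : ℝ)) 0 := by
    refine tendsto_finsetProd _ fun j _ => ?_
    refine ContinuousAt.mul ?_ ?_
    · exact ContinuousAt.rpow_const (by fun_prop) (Or.inl (by positivity))
    · exact ContinuousAt.rpow_const (by fun_prop) (Or.inl (by simp))
  have h := tendsto_ofReal_of_continuousAt hF
  simp only [add_zero, zero_mul, Real.one_rpow, mul_one] at h
  refine le_of_tendsto h (eventually_mem_nhdsWithin.mono fun a (ha : 0 < a) => ?_)
  exact (ofReal_prod_le_ratio_chirpDist hħ hq ha).trans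
    (le_iSup_of_le (chirpDist hħ n ha) (le_iSup_of_le (chirpDist_mem_modSpace hħ ha)
      (le_iSup_of_le (chirpDist_ne_zero hħ ha) le_rfl)))

theorem iInf_ratio_le_ofReal_prod {ħ : ℝ} (hħ : 0 < ħ) {q : Fin n → ℝ} (hq : ∀ j, 0 < q j) :
    (⨅ (γ : 𝓢(EuclideanSpace ℝ (Fin n), ℂ)) (_ : innerS (gaussWindow hħ hq) γ ≠ 0),
        modNorm ħ 1 ∞ γ (fresnelDist ħ n) / ‖innerS (gaussWindow hħ hq) γ‖ₑ) ≤
      ENNReal.ofReal (∏ j, (q j ^ 2 + 1) ^ ((1 : ℝ) / 4)) := by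
  have hF : ContinuousAt (fun a : ℝ => ∏ j, ((q j + a) ^ 2 + 1) ^ ((1 : ℝ) / 4)) 0 :=
    tendsto_finsetProd _ fun j _ =>
      ContinuousAt.rpow_const (by fun_prop) (Or.inl (by positivity))
  have h := tendsto_ofReal_of_continuousAt hF
  simp only [add_zero] at h
  refine ge_of_tendsto h (eventually_mem_nhdsWithin.mono fun a (ha : 0 < a) => ?_)
  have hn := norm_innerS_gaussWindow_chirp hħ hq (a := a) ha
  have hpos : 0 < ∏ j, ((q j + a) ^ 2 + 1) ^ (-(1 / 4) : ℝ) :=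
    Finset.prod_pos fun j _ => by positivity
  refine iInf₂_le_of_le (conjS (chirp hħ n ha)) (norm_pos_iff.1 (hn ▸ hpos)) (le_of_eq ?_)
  rw [modNorm_fresnelDist_chirp, ← ofReal_norm, hn, ← ENNReal.ofReal_one,
    ← ENNReal.ofReal_div_of_pos hpos, one_div, ← Finset.prod_inv_distrib]
  congr 1
  refine Finset.prod_congr rfl fun j _ => ?_
  rw [Real.rpow_neg (by positivity), inv_inv]

/-- Weak duality: the Hölder bound holds for each pair of an element f and a window γ. -/
theorem iSup_ratio_le_iInf_ratio {ħ : ℝ} (hħ : 0 < ħ) {q : Fin n → ℝ} (hq : ∀ j, 0 < q j) :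
    (⨆ (f : 𝓢'(EuclideanSpace ℝ (Fin n), ℂ)) (_ : f ∈ modSpace ħ n ∞ 1) (_ : f ≠ 0),
        ‖fresnelFunctional ħ f‖ₑ / modNorm ħ ∞ 1 (gaussWindow hħ hq) f) ≤
      ⨅ (γ : 𝓢(EuclideanSpace ℝ (Fin n), ℂ)) (_ : innerS (gaussWindow hħ hq) γ ≠ 0),
        modNorm ħ 1 ∞ γ (fresnelDist ħ n) / ‖innerS (gaussWindow hħ hq) γ‖ₑ :=
  iSup_le fun _ => iSup₂_le fun hf _ => le_iInf₂ fun _ hγ => ENNReal.div_le_of_le_mul <|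
    enorm_fresnelFunctional_le hħ (conjS_gaussWindow hħ hq) hγ hf
      ((mem_modSpace_iff hħ (gaussWindow_ne_zero hħ hq)).1 hf)

end Sjostrand

theorem theorem4p1 (ħ : ℝ) (hħ : 0 < ħ) (n : ℕ) (q : Fin n → ℝ) (hq : ∀ j, 0 < q j) :
    -- Each `f ∈ M^{∞,1}` has finite norm, and is a unique bounded continuous function,
    -- which is Fresnel integrable with Fresnel integral `L_n f`.
    (∀ f ∈ Sjostrand.modSpace ħ n ∞ 1,
      Sjostrand.modNorm ħ ∞ 1 (Sjostrand.gaussWindow hħ hq) f < ∞ ∧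
      (∃! u, Sjostrand.Represents f u) ∧
      ∀ u, Sjostrand.Represents f u →
        Sjostrand.HasFresnelIntegral ħ u (Sjostrand.fresnelFunctional ħ f)) ∧
    -- `M^{∞,1}` is a linear space, and `L_n` is linear on it.
    (∀ f ∈ Sjostrand.modSpace ħ n ∞ 1, ∀ h ∈ Sjostrand.modSpace ħ n ∞ 1, ∀ a b : ℂ,
      a • f + b • h ∈ Sjostrand.modSpace ħ n ∞ 1 ∧
      Sjostrand.fresnelFunctional ħ (a • f + b • h) =
        a * Sjostrand.fresnelFunctional ħ f + b * Sjostrand.fresnelFunctional ħ h) ∧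
    -- The operator norm of `L_n`.
    (⨆ (f : 𝓢'(EuclideanSpace ℝ (Fin n), ℂ)) (_ : f ∈ Sjostrand.modSpace ħ n ∞ 1) (_ : f ≠ 0),
        ‖Sjostrand.fresnelFunctional ħ f‖ₑ /
          Sjostrand.modNorm ħ ∞ 1 (Sjostrand.gaussWindow hħ hq) f) =
      ENNReal.ofReal (∏ j, (q j ^ 2 + 1) ^ ((1 : ℝ) / 4)) ∧
    -- The infimum over the windows `γ` with `⟨g_n, γ⟩ ≠ 0`.
    ENNReal.ofReal (∏ j, (q j ^ 2 + 1) ^ ((1 : ℝ) / 4)) =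
      ⨅ (γ : 𝓢(EuclideanSpace ℝ (Fin n), ℂ))
        (_ : Sjostrand.innerS (Sjostrand.gaussWindow hħ hq) γ ≠ 0),
        Sjostrand.modNorm ħ 1 ∞ γ (Sjostrand.fresnelDist ħ n) /
          ‖Sjostrand.innerS (Sjostrand.gaussWindow hħ hq) γ‖ₑ := by
  refine ⟨fun f hf => ?_, fun f hf h hh a b => ?_, ?_, ?_⟩
  · have hfin := (Sjostrand.mem_modSpace_iff hħ (Sjostrand.gaussWindow_ne_zero hħ hq)).1 hf
    obtain ⟨u, hu⟩ := Sjostrand.exists_represents hħ hf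
    exact ⟨hfin, ⟨u, hu, fun v hv => hv.unique hu⟩, fun v hv =>
      Sjostrand.hasFresnelIntegral_fresnelFunctional hħ hf hv⟩
  · exact ⟨Sjostrand.add_smul_mem_modSpace hħ hf hh a b,
      Sjostrand.fresnelFunctional_add_smul hħ hf hh a b⟩
  -- Both equalities come from the cycle supremum ≤ infimum ≤ product ≤ supremum.
  · exact le_antisymm
      ((Sjostrand.iSup_ratio_le_iInf_ratio hħ hq).trans (Sjostrand.iInf_ratio_le_ofReal_prod hħ hq))
      (Sjostrand.ofReal_prod_le_iSup_ratio hħ hq)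
  · exact le_antisymm
      ((Sjostrand.ofReal_prod_le_iSup_ratio hħ hq).trans (Sjostrand.iSup_ratio_le_iInf_ratio hħ hq))
      (Sjostrand.iInf_ratio_le_ofReal_prod hħ hq)
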